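/- Let $K$ be a number field of degree $n$ with $r_1$ real and $r_2$ complex places, $r=r_1+r_2$, ring of integers $\mathfrak o$, regulator $R$, discriminant of absolute value $D$, and $\omega$ roots of unity. Write $\alpha^{(i)}$ ($1\le i\le r$) for the images of $\alpha\in K$ under the embeddings attached to the places, and $N_i=1$ or $2$ according as the $i$-th place is real or complex. Let $\mathcal H=\mathscr H_2^{r_1}\times\mathscr H_3^{r_2}$ be the product of hyperbolic planes and hyperbolic three-spaces (upper half-space models, with points $\mathbf z=(\mathbf x,\mathbf y)$), let $\upsilon$ be the product of the hyperbolic volumes $dx\,dy/y^2$ on $\mathscr H_2$ and $dx\,dy/y^3$ on $\mathscr H_3$, and put $\mathbb N(\mathbf y)=\prod_i y_i^{N_i}$. The group $\Gamma=PSL(2,\mathfrak o)\subset PSL(2,K)$ acts on $\mathcal H$ by fractional linear transformations through the embeddings; let $\mathscr M=\Gamma\backslash\mathcal H$ carry the induced measure, also denoted $\upsilon$ (integration over a fundamental domain). Let $\lambda=\rho/\sigma\in\mathbb P^1(K)$ be a cusp, $\mathfrak a=\langle\rho,\sigma\rangle$ the fractional ideal generated by $\rho,\sigma$, and $A=\begin{pmatrix}\rho&\xi\\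 \sigma&\eta\end{pmatrix}\in SL(2,K)$ with $\xi,\eta\in\mathfrak a^{-1}$. The height of $\mathbf z$ at $\lambda$ is $$\mu(\lambda,\mathbf z)=\mathbb N(\mathfrak a)^2\,\mathbb N(\mathbf y)\,\prod_i\bigl|-\sigma^{(i)}z_i+\rho^{(i)}\bigr|^{-2N_i},$$ which does not depend on the choice of $\rho,\sigma$. With $\Gamma_\lambda$ the stabilizer of $\lambda$ in $\Gamma$, let $$E_\lambda(\mathbf z,s)=\sum_{\gamma\in\Gamma_\lambda\backslash\Gamma}\mu(\lambda,\gamma\mathbf z)^s,\qquad \Re(s)>1 .$$ Let $\alpha_1,\dots,\alpha_n$ be a $\mathbb Z$-basis of $\mathfrak a^{-2}$ and $\varepsilon_1,\dots,\varepsilon_{r-1}$ a system of fundamental units of $K$. For $X\in\mathbb R^n$, $Y\in\mathbb R^{r-1}$, $q>0$ let $\mathbf z(X,Y,q)=A\mathbf z^\star$, where $\mathbf z^\star=(\mathbf x^\star,\mathbf y^\star)$ is given by $$x^\star_i=\sum_{j=1}^nX_j\alpha_j^{(i)},\qquad y^\star_i=\Bigl(\frac{q}{\mathbb N(\mathfrak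 a)^2}\Bigr)^{1/n}\prod_{k=1}^{r-1}\bigl|\varepsilon_k^{(i)}\bigr|^{2Y_k}\qquad(1\le i\le r);$$ then $\mu(\lambda,\mathbf z(X,Y,q))=q$. For a continuous $f:\mathscr M\to\mathbb C$ put $$m_\lambda(f,q)=\int_{[-\frac12,\frac12]^{r-1}}\int_{[-\frac12,\frac12]^n} f(\mathbf z(X,Y,q))\,dX\,dY,\qquad \mathcal M_\lambda(f,s)=\int_0^\infty m_\lambda(f,q)\,q^{s-1}\,\frac{dq}{q},$$ so that $\mathcal M_\lambda(f,\cdot)$ is the Mellin transform of $q\mapsto m_\lambda(f,q)q^{-1}$. **Proposition.** Let $f:\mathscr M\to\mathbb C$ be continuous with compact support and let $\Re(s)>1$. Then the series $E_\lambda(\mathbf z,s)$ converges absolutely for every $\mathbf z\in\mathcal H$, the function $E_\lambda(\cdot,s)f$ is integrable on $\mathscr M$, the integral $\mathcal M_\lambda(f,s)$ converges absolutely, and $$\int_{\mathscr M}E_\lambda(\mathbf z,s)\,f(\mathbf z)\,d\upsilon(\mathbf z)=\omega^{-1}\,2^{r_1-r_2}\,R\,\sqrt D\;\mathcal M_\lambda(f,s).$$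 -/

import Mathlib

open MeasureTheory NumberField NumberField.InfinitePlace
open scoped MatrixGroups UpperHalfPlane LinearAlgebra.Projectivization nonZeroDivisors ComplexConjugate

noncomputable section

/-- Hyperbolic three-space in the upper half-space model: the points `x + y j` with `x : ℂ`
and `y > 0`. -/
def UpperHalfSpace : Type := {p : ℂ × ℝ // 0 < p.2}

namespace UpperHalfSpace

instance : TopologicalSpace UpperHalfSpace :=
  inferInstanceAs (TopologicalSpace {p : ℂ × ℝ // 0 < p.2})

instance : MeasurableSpace UpperHalfSpace :=
  inferInstanceAs (MeasurableSpace {p : ℂ × ℝ // 0 < p.2})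

/-- The complex coordinate `x` of `x + y j`. -/
def x (z : UpperHalfSpace) : ℂ := z.1.1

/-- The vertical coordinate `y > 0` of `x + y j`. -/
def y (z : UpperHalfSpace) : ℝ := z.1.2

theorem y_pos (z : UpperHalfSpace) : 0 < z.y := z.2

theorem ext' {z w : UpperHalfSpace} (hx : z.x = w.x) (hy : z.y = w.y) : z = w :=
  Subtype.ext (Prod.ext hx hy)

/-- The hyperbolic volume `dx dy / y ^ 3`, with `dx` the Lebesgue measure of the plane. -/
instance : MeasureSpace UpperHalfSpace :=
  ⟨((volume : Measure (ℂ × ℝ)).comap Subtype.val).withDensity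
    fun z : UpperHalfSpace ↦ ENNReal.ofReal (1 / z.y ^ 3)⟩

/-- The square `|c x + d| ^ 2 + |c| ^ 2 y ^ 2` of the norm of the quaternion `c (x + y j) + d`. -/
def normSqDenom (c d : ℂ) (z : UpperHalfSpace) : ℝ :=
  Complex.normSq (c * z.x + d) + Complex.normSq c * z.y ^ 2

theorem normSqDenom_pos {c d : ℂ} (h : c ≠ 0 ∨ d ≠ 0) (z : UpperHalfSpace) :
    0 < normSqDenom c d z := by
  have hy := z.y_pos
  unfold normSqDenom
  by_cases hc : c = 0
  · have hd : d ≠ 0 := by tauto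
    simpa [hc] using hd
  · have := Complex.normSq_pos.2 hc
    have := Complex.normSq_nonneg (c * z.x + d)
    positivity

theorem row_ne_zero (g : SL(2, ℂ)) : g 1 0 ≠ 0 ∨ g 1 1 ≠ 0 := by
  by_contra! h
  have := g.det_coe
  rw [Matrix.det_fin_two] at this
  simp [h.1, h.2] at this

/-- The point `(a z + b) (c z + d)⁻¹`, computed in the quaternions `z = x + y j`. -/
instance : SMul SL(2, ℂ) UpperHalfSpace where
  smul g z := ⟨(((g 0 0 * z.x + g 0 1) * conj (g 1 0 * z.x + g 1 1) +
      g 0 0 * conj (g 1 0) * (z.y : ℂ) ^ 2) / (normSqDenom (g 1 0) (g 1 1) z : ℂ),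
    z.y / normSqDenom (g 1 0) (g 1 1) z), div_pos z.y_pos (normSqDenom_pos (row_ne_zero g) z)⟩

theorem smul_x (g : SL(2, ℂ)) (z : UpperHalfSpace) :
    (g • z).x = ((g 0 0 * z.x + g 0 1) * conj (g 1 0 * z.x + g 1 1) +
      g 0 0 * conj (g 1 0) * (z.y : ℂ) ^ 2) / (normSqDenom (g 1 0) (g 1 1) z : ℂ) := rfl

theorem smul_y (g : SL(2, ℂ)) (z : UpperHalfSpace) :
    (g • z).y = z.y / normSqDenom (g 1 0) (g 1 1) z := rfl

theorem normSqDenom_coe (c d : ℂ) (z : UpperHalfSpace) :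
    (normSqDenom c d z : ℂ) =
      (c * z.x + d) * conj (c * z.x + d) + c * conj c * (z.y : ℂ) ^ 2 := by
  simp only [normSqDenom, Complex.ofReal_add, Complex.ofReal_mul, Complex.ofReal_pow,
    Complex.mul_conj]

/-- The cocycle relation for `|c z + d| ^ 2`. -/
theorem normSqDenom_smul (c d : ℂ) (g : SL(2, ℂ)) (z : UpperHalfSpace) :
    normSqDenom c d (g • z) * normSqDenom (g 1 0) (g 1 1) z =
      normSqDenom (c * g 0 0 + d * g 1 0) (c * g 0 1 + d * g 1 1) z := by
  have hdet := g.det_coe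
  rw [Matrix.det_fin_two] at hdet
  have hP := (normSqDenom_pos (row_ne_zero g) z).ne'
  have hP' : (normSqDenom (g 1 0) (g 1 1) z : ℂ) ≠ 0 := by exact_mod_cast hP
  apply Complex.ofReal_injective
  have hdet' := congrArg conj hdet
  simp only [map_sub, map_mul, map_one] at hdet'
  rw [Complex.ofReal_mul, normSqDenom_coe c d, normSqDenom_coe (c * _ + _), smul_x, smul_y]
  simp only [map_add, map_mul, map_div₀, Complex.conj_ofReal, Complex.ofReal_div, map_pow,
    Complex.conj_conj]
  field_simp
  rw [normSqDenom_coe]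
  simp only [map_add, map_mul]
  generalize z.x = x, (z.y : ℂ) = y, g 0 0 = a', g 0 1 = b', g 1 0 = c', g 1 1 = d' at *
  linear_combination (-(c * conj c * y ^ 2)) * ((conj a' * conj d' - conj b' * conj c') * hdet + hdet')

instance : MulAction SL(2, ℂ) UpperHalfSpace where
  one_smul z := by
    apply ext'
    · simp [smul_x, normSqDenom]
    · simp [smul_y, normSqDenom]
  mul_smul g h z := by
    have key := normSqDenom_smul (g 1 0) (g 1 1) h z
    have hP := (normSqDenom_pos (row_ne_zero h) z).ne'
    have hQ := (normSqDenom_pos (row_ne_zero g) (h • z)).ne'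
    have e : ∀ i j, (g * h) i j = g i 0 * h 0 j + g i 1 * h 1 j := fun i j ↦ by
      simp [Matrix.SpecialLinearGroup.coe_mul, Matrix.mul_apply, Fin.sum_univ_two]
    apply ext'
    · rw [smul_x (g * h), smul_x g]
      simp only [e]
      rw [← key]
      have hP' : (normSqDenom (h 1 0) (h 1 1) z : ℂ) ≠ 0 := by exact_mod_cast hP
      have hQ' : (normSqDenom (g 1 0) (g 1 1) (h • z) : ℂ) ≠ 0 := by exact_mod_cast hQ
      have hdet := h.det_coe
      rw [Matrix.det_fin_two] at hdet
      have hdet' := congrArg conj hdet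
      simp only [map_sub, map_mul, map_one] at hdet'
      rw [Complex.ofReal_mul, ← div_div, div_right_comm]
      congr 1
      rw [div_eq_iff hP', smul_x, smul_y]
      simp only [map_add, map_mul, map_div₀, Complex.conj_ofReal, Complex.ofReal_div, map_pow,
        Complex.conj_conj]
      field_simp
      rw [normSqDenom_coe]
      simp only [map_add, map_mul]
      generalize z.x = x, (z.y : ℂ) = y, h 0 0 = a', h 0 1 = b', h 1 0 = c', h 1 1 = d' at *
      linear_combination (g 0 0 * conj (g 1 0) * y ^ 2) *
        ((conj a' * conj d' - conj b' * conj c') * hdet + hdet')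
    · rw [smul_y (g * h), smul_y g, smul_y h]
      simp only [e]
      rw [← key, div_div, mul_comm]

theorem neg_smul' (g : SL(2, ℂ)) (z : UpperHalfSpace) : -g • z = g • z := by
  apply ext'
  · have : normSqDenom (-g 1 0) (-g 1 1) z = normSqDenom (g 1 0) (g 1 1) z := by
      simp only [normSqDenom, Complex.normSq_neg, neg_mul, ← neg_add]
    simp only [smul_x, Matrix.SpecialLinearGroup.coe_neg, Matrix.neg_apply, this]
    simp only [map_add, map_mul, map_neg]
    ring
  · have : normSqDenom (-g 1 0) (-g 1 1) z = normSqDenom (g 1 0) (g 1 1) z := by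
      simp only [normSqDenom, Complex.normSq_neg, neg_mul, ← neg_add]
    simp only [smul_y, Matrix.SpecialLinearGroup.coe_neg, Matrix.neg_apply, this]

end UpperHalfSpace

namespace HilbertModular

variable (K : Type*) [Field K] [NumberField K]

/-- The product of hyperbolic planes, one for each real place of `K`, and hyperbolic three-spaces,
one for each complex place of `K`. -/
def Space : Type _ := ({v : InfinitePlace K // v.IsReal} → ℍ) ×
  ({v : InfinitePlace K // v.IsComplex} → UpperHalfSpace)

namespace Space

instance : TopologicalSpace (Space K) :=
  inferInstanceAs (TopologicalSpace ((_ → ℍ) × (_ → UpperHalfSpace)))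

open scoped Classical in
/-- The product measure of the hyperbolic volumes of the factors. -/
instance : MeasureSpace (Space K) :=
  inferInstanceAs (MeasureSpace (({v : InfinitePlace K // v.IsReal} → ℍ) ×
    ({v : InfinitePlace K // v.IsComplex} → UpperHalfSpace)))

variable {K}

/-- `SL(2, K)` acts on the factor of index `v` through the embedding of `K` attached to `v`. -/
instance : MulAction SL(2, K) (Space K) where
  smul g z := (fun v ↦ Matrix.SpecialLinearGroup.map (embedding_of_isReal v.2) g • z.1 v,
    fun v ↦ Matrix.SpecialLinearGroup.map v.1.embedding g • z.2 v)
  one_smul z := by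
    refine Prod.ext (funext fun v ↦ ?_) (funext fun v ↦ ?_)
    · change Matrix.SpecialLinearGroup.map _ _ • _ = _
      rw [map_one, one_smul]
    · change Matrix.SpecialLinearGroup.map _ _ • _ = _
      rw [map_one, one_smul]
  mul_smul g h z := by
    refine Prod.ext (funext fun v ↦ ?_) (funext fun v ↦ ?_)
    · change Matrix.SpecialLinearGroup.map _ _ • _ = _
      rw [map_mul, mul_smul]; rfl
    · change Matrix.SpecialLinearGroup.map _ _ • _ = _
      rw [map_mul, mul_smul]; rfl

theorem center_smul {g : SL(2, K)} (hg : g ∈ Subgroup.center SL(2, K)) (z : Space K) :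
    g • z = z := by
  obtain ⟨r, hr, hgr⟩ := Matrix.SpecialLinearGroup.mem_center_iff.1 hg
  have hneg : ∀ z : Space K, (-1 : SL(2, K)) • z = z := fun z ↦ by
    refine Prod.ext (funext fun v ↦ ?_) (funext fun v ↦ ?_)
    · change Matrix.SpecialLinearGroup.map (embedding_of_isReal v.2) (-1) • z.1 v = z.1 v
      have : Matrix.SpecialLinearGroup.map (embedding_of_isReal v.2) (-1 : SL(2, K)) = -1 := by
        ext i j; fin_cases i <;> fin_cases j <;> simp
      rw [this]
      ext
      simp [UpperHalfPlane.coe_specialLinearGroup_apply]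
    · change Matrix.SpecialLinearGroup.map v.1.embedding (-1) • z.2 v = z.2 v
      have : Matrix.SpecialLinearGroup.map v.1.embedding (-1 : SL(2, K)) = -1 := by
        ext i j; fin_cases i <;> fin_cases j <;> simp
      rw [this, UpperHalfSpace.neg_smul', one_smul]
  have hr2 : r = 1 ∨ r = -1 := by
    simpa using hr
  rcases hr2 with rfl | rfl
  · have : g = 1 := Subtype.ext (by rw [← hgr]; simp)
    rw [this, one_smul]
  · have : g = -1 := Subtype.ext (by rw [← hgr]; ext i j; fin_cases i <;> fin_cases j <;> simp)
    rw [this, hneg]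

/-- The induced action of `PSL(2, K)`. -/
instance : MulAction PSL(2, K) (Space K) :=
  MulAction.compHom _ (QuotientGroup.lift (Subgroup.center SL(2, K))
    (MulAction.toPermHom SL(2, K) (Space K))
    fun _ hg ↦ Equiv.ext fun z ↦ center_smul hg z)

theorem mk_smul (g : SL(2, K)) (z : Space K) : (g : PSL(2, K)) • z = g • z := rfl

end Space

/-- The Hilbert modular group `PSL(2, 𝓞 K)`, as a subgroup of `PSL(2, K)`. -/
def modularGroup : Subgroup PSL(2, K) :=
  ((QuotientGroup.mk' (Subgroup.center SL(2, K))).comp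
    (Matrix.SpecialLinearGroup.map (algebraMap (𝓞 K) K))).range

/-- The Hilbert modular orbifold: the space of orbits of the Hilbert modular group. -/
abbrev Orbifold : Type _ := MulAction.orbitRel.Quotient (modularGroup K) (Space K)

variable {K}

/-- The canonical projection onto the orbifold. -/
def toOrbifold (z : Space K) : Orbifold K := Quotient.mk _ z

variable (K)

/-- The measure on the orbifold induced by the hyperbolic volume `υ`. It is the least measure which
dominates the image of `υ` restricted to `F` for every measurable set `F` that contains at most
one point of each orbit. The supremum is attained when `F` is a measurable fundamental domain, so
that integration against this measure is integration over a fundamental domain. -/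
def orbifoldVolume : Measure (Orbifold K) :=
  ⨆ (F : Set (Space K)) (_ : MeasurableSet F) (_ : Set.InjOn toOrbifold F),
    ((volume : Measure (Space K)).restrict F).map toOrbifold

variable {K}

open scoped Classical in
/-- `N(y) = ∏ y_i ^ N_i`, the product over all places, where `N_i` is `1` for a real and `2` for a
complex place. -/
def normY (z : Space K) : ℝ := (∏ v, (z.1 v).im) * ∏ v, (z.2 v).y ^ 2

open scoped Classical in
/-- `|N(c z + d)| ^ 2`, the product of the `|c z_i + d| ^ (2 N_i)` over all places. -/
def normSqDenom (c d : K) (z : Space K) : ℝ :=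
  (∏ v, Complex.normSq ((embedding_of_isReal v.2 c : ℂ) * z.1 v + (embedding_of_isReal v.2 d : ℂ))) *
    ∏ v, (UpperHalfSpace.normSqDenom (v.1.embedding c) (v.1.embedding d) (z.2 v)) ^ 2

/-- The fractional ideal generated by `ρ` and `σ`. -/
def idealOf (ρ σ : K) : FractionalIdeal (𝓞 K)⁰ K :=
  FractionalIdeal.spanSingleton _ ρ + FractionalIdeal.spanSingleton _ σ

theorem normSqDenom_smul (c d : K) (g : SL(2, K)) (z : Space K) :
    normSqDenom c d (g • z) * normSqDenom (g 1 0) (g 1 1) z =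
      normSqDenom (c * g 0 0 + d * g 1 0) (c * g 0 1 + d * g 1 1) z := by
  unfold normSqDenom
  rw [mul_mul_mul_comm, ← Finset.prod_mul_distrib, ← Finset.prod_mul_distrib]
  congr 1
  · refine Finset.prod_congr rfl fun v _ ↦ ?_
    change Complex.normSq (_ * ((Matrix.SpecialLinearGroup.map (embedding_of_isReal v.2) g •
      z.1 v : ℍ) : ℂ) + _) * _ = _
    have hne : ((embedding_of_isReal v.2 (g 1 0) : ℂ) * z.1 v +
        (embedding_of_isReal v.2 (g 1 1) : ℂ)) ≠ 0 := by
      have := UpperHalfPlane.denom_ne_zero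
        (Matrix.SpecialLinearGroup.map (embedding_of_isReal v.2) g : GL (Fin 2) ℝ) (z.1 v)
      simpa [UpperHalfPlane.denom] using this
    rw [← Complex.normSq_mul, UpperHalfPlane.coe_specialLinearGroup_apply]
    congr 1
    simp only [Matrix.SpecialLinearGroup.map_apply_coe, RingHom.mapMatrix_apply, Matrix.map_apply,
      Algebra.algebraMap_self, RingHom.id_apply, map_add, map_mul, Complex.ofReal_add,
      Complex.ofReal_mul]
    rw [add_mul, mul_assoc, div_mul_cancel₀ _ hne]
    ring
  · refine Finset.prod_congr rfl fun v _ ↦ ?_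
    rw [← mul_pow]
    congr 1
    have := UpperHalfSpace.normSqDenom_smul (v.1.embedding c) (v.1.embedding d)
      (Matrix.SpecialLinearGroup.map v.1.embedding g) (z.2 v)
    simp only [map_mul, map_add]
    exact this

theorem normSqDenom_ne_zero (g : SL(2, K)) (z : Space K) :
    normSqDenom (g 1 0) (g 1 1) z ≠ 0 := by
  refine mul_ne_zero (Finset.prod_ne_zero_iff.2 fun v _ ↦ ?_)
    (Finset.prod_ne_zero_iff.2 fun v _ ↦ ?_)
  · have := UpperHalfPlane.denom_ne_zero
      (Matrix.SpecialLinearGroup.map (embedding_of_isReal v.2) g : GL (Fin 2) ℝ) (z.1 v)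
    simpa [UpperHalfPlane.denom] using this
  · exact pow_ne_zero _ (UpperHalfSpace.normSqDenom_pos (UpperHalfSpace.row_ne_zero
      (Matrix.SpecialLinearGroup.map v.1.embedding g)) (z.2 v)).ne'

theorem normY_smul (g : SL(2, K)) (z : Space K) :
    normY (g • z) = normY z / normSqDenom (g 1 0) (g 1 1) z := by
  unfold normY normSqDenom
  rw [← div_mul_div_comm, ← Finset.prod_div_distrib, ← Finset.prod_div_distrib]
  congr 1
  · refine Finset.prod_congr rfl fun v _ ↦ ?_
    change (Matrix.SpecialLinearGroup.map (embedding_of_isReal v.2) g • z.1 v : ℍ).im = _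
    have := UpperHalfPlane.im_smul_eq_div_normSq
      (Matrix.SpecialLinearGroup.map (embedding_of_isReal v.2) g : GL (Fin 2) ℝ) (z.1 v)
    have h2 : (Matrix.SpecialLinearGroup.map (embedding_of_isReal v.2) g • z.1 v : ℍ) =
        (Matrix.SpecialLinearGroup.map (embedding_of_isReal v.2) g : GL (Fin 2) ℝ) • z.1 v := rfl
    rw [h2, this]
    simp [UpperHalfPlane.denom]
  · refine Finset.prod_congr rfl fun v _ ↦ ?_
    rw [← div_pow]
    rfl

open scoped Classical in
theorem normSqDenom_mul (t c d : K) (z : Space K) :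
    normSqDenom (t * c) (t * d) z = (Algebra.norm ℚ t : ℝ) ^ 2 * normSqDenom c d z := by
  have h : (Algebra.norm ℚ t : ℝ) ^ 2 =
      (∏ v : {v : InfinitePlace K // v.IsReal}, Complex.normSq (embedding_of_isReal v.2 t : ℂ)) *
        ∏ v : {v : InfinitePlace K // v.IsComplex}, (Complex.normSq (v.1.embedding t)) ^ 2 := by
    rw [← sq_abs, ← Rat.cast_abs, ← prod_eq_abs_norm, ← Finset.prod_pow, prod_eq_prod_mul_prod]
    congr 1
    · refine Finset.prod_congr rfl fun v _ ↦ ?_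
      rw [mult_isReal, pow_one, Complex.normSq_eq_norm_sq, embedding_of_isReal_apply,
        norm_embedding_eq]
    · refine Finset.prod_congr rfl fun v _ ↦ ?_
      rw [mult_isComplex, Complex.normSq_eq_norm_sq, norm_embedding_eq]
  rw [h]
  unfold normSqDenom
  rw [mul_mul_mul_comm, ← Finset.prod_mul_distrib, ← Finset.prod_mul_distrib]
  congr 1
  · refine Finset.prod_congr rfl fun v _ ↦ ?_
    rw [← Complex.normSq_mul]
    congr 1
    simp only [map_mul, Complex.ofReal_mul]
    ring
  · refine Finset.prod_congr rfl fun v _ ↦ ?_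
    rw [← mul_pow]
    congr 1
    simp only [UpperHalfSpace.normSqDenom, map_mul, mul_assoc, ← mul_add]

theorem idealOf_mul (t ρ σ : K) :
    idealOf (t * ρ) (t * σ) = FractionalIdeal.spanSingleton _ t * idealOf ρ σ := by
  simp only [idealOf, mul_add, FractionalIdeal.spanSingleton_mul_spanSingleton]

theorem idealOf_smul_le (g : SL(2, 𝓞 K)) (ρ σ : K) :
    idealOf (g 0 0 * ρ + g 0 1 * σ) (g 1 0 * ρ + g 1 1 * σ) ≤ idealOf ρ σ := by
  have key : ∀ a b : 𝓞 K, FractionalIdeal.spanSingleton (𝓞 K)⁰ ((a : K) * ρ + (b : K) * σ) ≤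
      idealOf ρ σ := fun a b ↦ by
    rw [FractionalIdeal.spanSingleton_le_iff_mem, idealOf, FractionalIdeal.mem_add]
    exact ⟨_, (FractionalIdeal.mem_spanSingleton _).2 ⟨a, Algebra.smul_def _ _⟩, _,
      (FractionalIdeal.mem_spanSingleton _).2 ⟨b, Algebra.smul_def _ _⟩, rfl⟩
  exact sup_le (key _ _) (key _ _)

theorem idealOf_smul (g : SL(2, 𝓞 K)) (ρ σ : K) :
    idealOf (g 0 0 * ρ + g 0 1 * σ) (g 1 0 * ρ + g 1 1 * σ) = idealOf ρ σ := by
  refine le_antisymm (idealOf_smul_le g ρ σ) ?_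
  have hdet : (g 0 0 : K) * g 1 1 - g 0 1 * g 1 0 = 1 := by
    have := g.det_coe
    rw [Matrix.det_fin_two] at this
    exact_mod_cast congrArg (algebraMap (𝓞 K) K) this
  have h := idealOf_smul_le g⁻¹ (g 0 0 * ρ + g 0 1 * σ) (g 1 0 * ρ + g 1 1 * σ)
  rw [Matrix.SpecialLinearGroup.SL2_inv_expl] at h
  convert h using 2
  · simp
    linear_combination -ρ * hdet
  · simp
    linear_combination -σ * hdet

/-- `N(𝔞) ^ 2 N(y) / |N(-σ z + ρ)| ^ 2` for `w = (ρ, σ)` and `𝔞` the ideal generated by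
`ρ` and `σ`. -/
def heightAux (w : Fin 2 → K) (z : Space K) : ℝ :=
  ((idealOf (w 0) (w 1)).absNorm : ℝ) ^ 2 * normY z / normSqDenom (-w 1) (w 0) z

theorem heightAux_smul (t : K) (ht : t ≠ 0) (w : Fin 2 → K) (z : Space K) :
    heightAux (t • w) z = heightAux w z := by
  have hN : (Algebra.norm ℚ t : ℝ) ^ 2 ≠ 0 := by
    simpa [Algebra.norm_eq_zero_iff] using ht
  simp only [heightAux, Pi.smul_apply, smul_eq_mul, idealOf_mul, map_mul,
    FractionalIdeal.absNorm_span_singleton, ← mul_neg, normSqDenom_mul]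
  push_cast
  rw [mul_pow, sq_abs, mul_assoc, mul_div_mul_left _ _ hN]

theorem heightAux_smul_smul (g : SL(2, 𝓞 K)) (w : Fin 2 → K) (z : Space K) :
    heightAux (Matrix.SpecialLinearGroup.map (algebraMap (𝓞 K) K) g • w)
      (Matrix.SpecialLinearGroup.map (algebraMap (𝓞 K) K) g • z) = heightAux w z := by
  set G := Matrix.SpecialLinearGroup.map (algebraMap (𝓞 K) K) g with hG
  have e : ∀ i, (G • w) i = G i 0 * w 0 + G i 1 * w 1 := fun i ↦ by
    change (G.1.mulVec w) i = _
    simp [Matrix.mulVec, dotProduct, Fin.sum_univ_two]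
  have hdet : G 0 0 * G 1 1 - G 0 1 * G 1 0 = 1 := by
    rw [← Matrix.det_fin_two]; exact G.2
  have h := normSqDenom_smul (-(G • w) 1) ((G • w) 0) G z
  have h0 := normSqDenom_ne_zero G z
  have e1 : -(G • w) 1 * G 0 0 + (G • w) 0 * G 1 0 = -w 1 := by
    rw [e, e]; linear_combination -w 1 * hdet
  have e2 : -(G • w) 1 * G 0 1 + (G • w) 0 * G 1 1 = w 0 := by
    rw [e, e]; linear_combination w 0 * hdet
  rw [e1, e2] at h
  have hI : idealOf ((G • w) 0) ((G • w) 1) = idealOf (w 0) (w 1) := by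
    rw [e, e]; exact idealOf_smul g (w 0) (w 1)
  rw [heightAux, heightAux, hI, normY_smul, ← h, mul_div_assoc', div_div, mul_comm (normSqDenom _ _ z)]

/-- The height `μ(λ, z)` of `z` at the cusp `λ = ρ / σ`, a point of the projective line over `K`
with homogeneous coordinates `(ρ, σ)`. -/
def height (lam : ℙ K (Fin 2 → K)) (z : Space K) : ℝ :=
  lam.lift (fun w ↦ heightAux w.1 z) (by
    rintro ⟨a, ha⟩ ⟨b, hb⟩ t rfl
    exact heightAux_smul t (by rintro rfl; simp at ha) b z)

/-- The height is invariant under the Hilbert modular group. -/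
theorem height_smul (γ : modularGroup K) (lam : ℙ K (Fin 2 → K)) (z : Space K) :
    height (γ • lam) (γ • z) = height lam z := by
  obtain ⟨_, g, rfl⟩ := γ
  induction lam using Projectivization.ind with | _ w hw =>
  exact heightAux_smul_smul g w z

/-- The term `μ(λ, γ z) ^ s` of the Eisenstein series, as a function of the coset
`c = Γ_λ γ` in `Γ_λ \ Γ`. -/
def eisensteinTerm (lam : ℙ K (Fin 2 → K)) (s : ℂ) (z : Space K)
    (c : Quotient (QuotientGroup.rightRel (MulAction.stabilizer (modularGroup K) lam))) : ℂ :=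
  c.liftOn' (fun γ ↦ (height lam (γ • z) : ℂ) ^ s) (by
    intro a b hab
    rw [QuotientGroup.rightRel_apply, MulAction.mem_stabilizer_iff] at hab
    have h := height_smul (b * a⁻¹) lam (a • z)
    rw [hab, smul_smul, inv_mul_cancel_right] at h
    simp only [h])

/-- The Eisenstein series `E_λ(z, s)`, the sum of `μ(λ, γ z) ^ s` over `Γ_λ \ Γ`. -/
def eisensteinSeries (lam : ℙ K (Fin 2 → K)) (s : ℂ) (z : Space K) : ℂ :=
  ∑' c, eisensteinTerm lam s z c

theorem eisensteinSeries_smul (lam : ℙ K (Fin 2 → K)) (s : ℂ) (γ : modularGroup K) (z : Space K) :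
    eisensteinSeries lam s (γ • z) = eisensteinSeries lam s z := by
  let e : Quotient (QuotientGroup.rightRel (MulAction.stabilizer (modularGroup K) lam)) ≃
      Quotient (QuotientGroup.rightRel (MulAction.stabilizer (modularGroup K) lam)) :=
    Quotient.congr (Equiv.mulRight γ) fun a b ↦ by
      simp [QuotientGroup.rightRel_apply]
  rw [eisensteinSeries, eisensteinSeries, ← e.tsum_eq (eisensteinTerm lam s z)]
  refine tsum_congr fun c ↦ ?_
  induction c using Quotient.inductionOn' with | _ δ =>
  change (height lam (δ • γ • z) : ℂ) ^ s = (height lam ((δ * γ) • z) : ℂ) ^ s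
  rw [mul_smul]

/-- The Eisenstein series as a function on the orbifold. -/
def eisensteinOrbifold (lam : ℙ K (Fin 2 → K)) (s : ℂ) : Orbifold K → ℂ :=
  Quotient.lift (eisensteinSeries lam s) (by
    rintro _ z ⟨γ, rfl⟩
    exact eisensteinSeries_smul lam s γ z)

/-- `A = (ρ, ξ; σ, η)` is a matrix associated to the cusp `λ`: it has determinant one, maps `∞` to
`λ = ρ / σ`, and `ξ` and `η` lie in the inverse of the ideal `𝔞` generated by `ρ` and `σ`. -/
structure IsAssociated (A : SL(2, K)) (lam : ℙ K (Fin 2 → K)) : Prop where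
  smul_infty : A • Projectivization.mk K ![(1 : K), 0] (by simp) = lam
  xi_mem : A 0 1 ∈ (idealOf (A 0 0) (A 1 0))⁻¹
  eta_mem : A 1 1 ∈ (idealOf (A 0 0) (A 1 0))⁻¹

open NumberField.Units in
/-- The units `ε` form a system of fundamental units: every unit is in exactly one way the product
of a root of unity and integral powers of the `ε k`. -/
def IsFundamentalSystem (ε : Fin (rank K) → (𝓞 K)ˣ) : Prop :=
  ∀ u : (𝓞 K)ˣ, ∃! p : torsion K × (Fin (rank K) → ℤ), u = p.1 * ∏ k, ε k ^ p.2 k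

theorem absNorm_idealOf_pos (A : SL(2, K)) :
    0 < ((idealOf (A 0 0) (A 1 0)).absNorm : ℝ) := by
  rw [Rat.cast_pos]
  refine (FractionalIdeal.absNorm_nonneg _).lt_of_ne' ?_
  rw [Ne, FractionalIdeal.absNorm_eq_zero_iff]
  intro h
  have h0 : A 0 0 = 0 ∧ A 1 0 = 0 := by
    unfold idealOf at h
    constructor
    · have := (FractionalIdeal.spanSingleton_le_iff_mem (S := (𝓞 K)⁰) (x := A 0 0)).1
        (le_sup_left.trans h.le)
      simpa using this
    · have := (FractionalIdeal.spanSingleton_le_iff_mem (S := (𝓞 K)⁰) (x := A 1 0)).1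
        (le_sup_right.trans h.le)
      simpa using this
  have := A.det_coe
  rw [Matrix.det_fin_two] at this
  simp [h0.1, h0.2] at this

/-- The coordinates `y⋆_v` with `N(𝔞) ^ 2 N(y⋆) = q` and
`log (y⋆_v / N(y⋆) ^ (1 / n)) / 2 = ∑ k, Y_k log |ε_k|_v` for all places `v`. -/
def localY (A : SL(2, K)) (ε : Fin (Units.rank K) → (𝓞 K)ˣ) (Y : Fin (Units.rank K) → ℝ) (q : ℝ)
    (v : InfinitePlace K) : ℝ :=
  (q / ((idealOf (A 0 0) (A 1 0)).absNorm : ℝ) ^ 2) ^ (1 / (Module.finrank ℚ K : ℝ)) *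
    ∏ k, v (ε k : K) ^ (2 * Y k)

theorem localY_pos (A : SL(2, K)) (ε : Fin (Units.rank K) → (𝓞 K)ˣ) (Y : Fin (Units.rank K) → ℝ)
    {q : ℝ} (hq : 0 < q) (v : InfinitePlace K) : 0 < localY A ε Y q v := by
  have := absNorm_idealOf_pos A
  refine mul_pos (by positivity) (Finset.prod_pos fun k _ ↦ Real.rpow_pos_of_pos ?_ _)
  exact InfinitePlace.pos_iff.2 (Units.coe_ne_zero _)

/-- The point `z⋆ = (x⋆, y⋆)` with `x⋆ = ∑ j, X_j α_j` and `y⋆` as in `localY`. -/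
def starPoint (A : SL(2, K)) (α : Fin (Module.finrank ℚ K) → K)
    (ε : Fin (Units.rank K) → (𝓞 K)ˣ) (X : Fin (Module.finrank ℚ K) → ℝ)
    (Y : Fin (Units.rank K) → ℝ) (q : ℝ) (hq : 0 < q) : Space K :=
  (fun v ↦ ⟨⟨∑ j, X j * embedding_of_isReal v.2 (α j), localY A ε Y q v.1⟩,
      localY_pos A ε Y hq v.1⟩,
    fun v ↦ ⟨(∑ j, X j * v.1.embedding (α j), localY A ε Y q v.1), localY_pos A ε Y hq v.1⟩)

/-- The point `z = A z⋆` with local coordinates `X, Y, q` at the cusp `A ∞`, with respect to the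
basis `α` and the fundamental units `ε`. -/
def localPoint (A : SL(2, K)) (α : Fin (Module.finrank ℚ K) → K)
    (ε : Fin (Units.rank K) → (𝓞 K)ˣ) (X : Fin (Module.finrank ℚ K) → ℝ)
    (Y : Fin (Units.rank K) → ℝ) (q : ℝ) (hq : 0 < q) : Space K :=
  A • starPoint A α ε X Y q hq

/-- The mean `m(f, q)` of `f` over the cusp cross section at height `q > 0`: the integral of
`f` in the local coordinates `X, Y`, all of them between `-1/2` and `1/2`. -/
def crossSectionMean (A : SL(2, K)) (α : Fin (Module.finrank ℚ K) → K)
    (ε : Fin (Units.rank K) → (𝓞 K)ˣ) (f : Orbifold K → ℂ) (q : ℝ) : ℂ :=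
  if hq : 0 < q then
    ∫ p : (Fin (Module.finrank ℚ K) → ℝ) × (Fin (Units.rank K) → ℝ) in
      (Set.univ.pi fun _ ↦ Set.Icc (-(1 / 2)) (1 / 2)) ×ˢ
        (Set.univ.pi fun _ ↦ Set.Icc (-(1 / 2)) (1 / 2)),
      f (toOrbifold (localPoint A α ε p.1 p.2 q hq))
  else 0

theorem normY_starPoint (A : SL(2, K)) (α : Fin (Module.finrank ℚ K) → K)
    (ε : Fin (Units.rank K) → (𝓞 K)ˣ) (X : Fin (Module.finrank ℚ K) → ℝ)
    (Y : Fin (Units.rank K) → ℝ) (q : ℝ) (hq : 0 < q) :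
    normY (starPoint A α ε X Y q hq) =
      q / ((idealOf (A 0 0) (A 1 0)).absNorm : ℝ) ^ 2 := by
  have hN := absNorm_idealOf_pos A
  have h1 : normY (starPoint A α ε X Y q hq) = ∏ v, localY A ε Y q v ^ v.mult := by
    rw [prod_eq_prod_mul_prod]
    refine congrArg₂ _ (Finset.prod_congr rfl fun v _ ↦ ?_) (Finset.prod_congr rfl fun v _ ↦ ?_)
    · rw [mult_isReal, pow_one]; rfl
    · rw [mult_isComplex]; rfl
  have hn : (Module.finrank ℚ K : ℝ) ≠ 0 := by
    exact_mod_cast Module.finrank_pos.ne'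
  rw [h1]
  simp only [localY, mul_pow, Finset.prod_mul_distrib, Finset.prod_pow_eq_pow_sum, sum_mult_eq]
  rw [← Real.rpow_natCast, ← Real.rpow_mul (by positivity), one_div_mul_cancel hn, Real.rpow_one]
  simp only [← Finset.prod_pow]
  rw [Finset.prod_comm, Finset.prod_eq_one, mul_one]
  intro k _
  have : ∀ v : InfinitePlace K, (v (ε k : K) ^ (2 * Y k)) ^ v.mult =
      (v (ε k : K) ^ v.mult) ^ (2 * Y k) := fun v ↦ by
    have h := apply_nonneg v (ε k : K)
    rw [← Real.rpow_natCast, ← Real.rpow_natCast, ← Real.rpow_mul h, ← Real.rpow_mul h, mul_comm]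
  simp only [this]
  rw [Real.finsetProd_rpow _ _ fun v _ ↦ by positivity, prod_eq_abs_norm]
  simp [Units.norm]

/-- The local coordinate `q` is the height at the cusp. -/
theorem height_localPoint {A : SL(2, K)} {lam : ℙ K (Fin 2 → K)} (hA : IsAssociated A lam)
    (α : Fin (Module.finrank ℚ K) → K)
    (ε : Fin (Units.rank K) → (𝓞 K)ˣ) (X : Fin (Module.finrank ℚ K) → ℝ)
    (Y : Fin (Units.rank K) → ℝ) (q : ℝ) (hq : 0 < q) :
    height lam (localPoint A α ε X Y q hq) = q := by
  have hN := absNorm_idealOf_pos A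
  have hdet := A.det_coe
  rw [Matrix.det_fin_two] at hdet
  rw [← hA.smul_infty]
  have e : ∀ i, (A • ![(1 : K), 0]) i = A i 0 := fun i ↦ by
    change (A.1.mulVec ![(1 : K), 0]) i = _
    simp [Matrix.mulVec, dotProduct, Fin.sum_univ_two]
  change heightAux (A • ![(1 : K), 0]) _ = q
  rw [heightAux, e, e, localPoint, normY_smul, normY_starPoint]
  set w := starPoint A α ε X Y q hq
  have h := normSqDenom_smul (-A 1 0) (A 0 0) A w
  have h0 := normSqDenom_ne_zero A w
  rw [show -A 1 0 * A 0 0 + A 0 0 * A 1 0 = 0 by ring,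
    show -A 1 0 * A 0 1 + A 0 0 * A 1 1 = 1 by linear_combination hdet,
    show normSqDenom (0 : K) 1 w = 1 by simp [normSqDenom, UpperHalfSpace.normSqDenom]] at h
  have h2 := left_ne_zero_of_mul_eq_one h
  generalize normSqDenom (-A 1 0) (A 0 0) (A • w) = E, normSqDenom (A 1 0) (A 1 1) w = D,
    ((idealOf (A 0 0) (A 1 0)).absNorm : ℝ) = N at *
  field_simp
  linear_combination -h

end HilbertModular
end

open HilbertModular

/-! The proof is Rankin–Selberg unfolding at one cusp. After conjugation by `A`, the stabilizer
`Γ_λ` consists of the maps `z ↦ u² z + b` with `u` a unit and `b ∈ 𝔞⁻²`, taken modulo `u ↦ -u`. In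
the coordinates `(X, Y, q)`, which are global, `q` is invariant, `u` shifts `Y` by its exponents and
`b` shifts `X` by integers. Given a point, `Y` fixes `u` up to a root of unity `ζ`, and each `ζ`
then allows exactly one `b` that brings the point into the unit box. Since `ζ` and `-ζ` give the
same element of `PSL(2, K)`, exactly `ω / 2` elements of `Γ_λ` bring a given point into the box
(`finite_stabilizer_smul_mem_cuspBox`). So `E_λ f` is `2 / ω` times the sum over all of `Γ` of the
translates of `μ(λ, ·)^s f` cut off to the box, and its integral over a fundamental domain is `2 /
ω` times one integral over the box (`integral_eisenstein_mul`).

In these coordinates with `τ = log q`, the hyperbolic volume is a constant times `e^(-τ) dX dY dτ`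
(`measurePreserving_starMap`). The constant is the product of the covolume of `𝔞⁻²` and the
determinant of the logarithms of the fundamental units. The powers of `N(𝔞)` cancel, and twice the
constant is `2^(r₁ - r₂) R √D` (`two_mul_jacobian`). Fubini then leaves the Mellin transform.

Absolute convergence comes from the same unfolding applied to `μ^σ`. On a bounded set the heights at
all cusps are bounded, and their values at any two points are comparable uniformly in the cusp. The
series at one point is therefore bounded by an average over a bounded set, hence by the integral of
`μ^σ` over the part of the box below some height, which is finite for `σ > 1`
(`tsum_height_rpow_ne_top`).

Two preliminaries support this: the invariance of the volume, and a measurable set of orbit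
representatives that is a fundamental domain because nontrivial elements fix only null sets
(`isFundamentalDomain_fundamentalSet`). It attains the supremum defining the orbifold measure
(`orbifoldVolume_eq`). -/

set_option linter.unusedSimpArgs false
set_option linter.unusedSectionVars false

noncomputable section

/-! ### Topology of the spaces, and coordinates at each place. -/

namespace UpperHalfSpace

theorem isOpenEmbedding_val :
    Topology.IsOpenEmbedding (Subtype.val : UpperHalfSpace → ℂ × ℝ) :=
  (isOpen_lt continuous_const continuous_snd).isOpenEmbedding_subtypeVal

instance : SecondCountableTopology UpperHalfSpace :=
  isOpenEmbedding_val.isEmbedding.secondCountableTopology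

instance instMeasurableSpaceOfMeasureSpace : MeasurableSpace UpperHalfSpace :=
  instMeasureSpace.toMeasurableSpace

instance : BorelSpace UpperHalfSpace :=
  inferInstanceAs (BorelSpace {p : ℂ × ℝ // 0 < p.2})

instance : T2Space UpperHalfSpace := isOpenEmbedding_val.isEmbedding.t2Space

@[fun_prop]
theorem continuous_x : Continuous x := continuous_fst.comp continuous_subtype_val

@[fun_prop]
theorem continuous_y : Continuous y := continuous_snd.comp continuous_subtype_val

end UpperHalfSpace

namespace HilbertModular

variable {K : Type*} [Field K] [NumberField K]

namespace Space

instance : SecondCountableTopology (Space K) :=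
  inferInstanceAs (SecondCountableTopology ((_ → ℍ) × (_ → UpperHalfSpace)))

instance : T2Space (Space K) :=
  inferInstanceAs (T2Space ((_ → ℍ) × (_ → UpperHalfSpace)))

instance : BorelSpace (Space K) :=
  inferInstanceAs (BorelSpace (({v : InfinitePlace K // v.IsReal} → ℍ) ×
    ({v : InfinitePlace K // v.IsComplex} → UpperHalfSpace)))

theorem continuous_fst : Continuous fun z : Space K ↦ z.1 := _root_.continuous_fst

theorem continuous_snd : Continuous fun z : Space K ↦ z.2 := _root_.continuous_snd

open scoped Classical in
/-- The horizontal coordinate at the place `v`, as a complex number. -/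
def xAt (v : InfinitePlace K) (z : Space K) : ℂ :=
  if h : v.IsReal then ((z.1 ⟨v, h⟩).re : ℂ) else (z.2 ⟨v, not_isReal_iff_isComplex.1 h⟩).x

open scoped Classical in
/-- The vertical coordinate at the place `v`. -/
def yAt (v : InfinitePlace K) (z : Space K) : ℝ :=
  if h : v.IsReal then (z.1 ⟨v, h⟩).im else (z.2 ⟨v, not_isReal_iff_isComplex.1 h⟩).y

/-- The square `|c x + d| ^ 2 + |c| ^ 2 y ^ 2` of the norm of `c z + d` at the place `v`. -/
def denomAt (c d : K) (v : InfinitePlace K) (z : Space K) : ℝ :=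
  Complex.normSq (v.embedding c * xAt v z + v.embedding d) +
    Complex.normSq (v.embedding c) * yAt v z ^ 2

theorem xAt_real {v : InfinitePlace K} (h : v.IsReal) (z : Space K) :
    xAt v z = ((z.1 ⟨v, h⟩).re : ℂ) := dif_pos h

theorem yAt_real {v : InfinitePlace K} (h : v.IsReal) (z : Space K) :
    yAt v z = (z.1 ⟨v, h⟩).im := dif_pos h

theorem xAt_complex {v : InfinitePlace K} (h : v.IsComplex) (z : Space K) :
    xAt v z = (z.2 ⟨v, h⟩).x := dif_neg (not_isReal_iff_isComplex.2 h)

theorem yAt_complex {v : InfinitePlace K} (h : v.IsComplex) (z : Space K) :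
    yAt v z = (z.2 ⟨v, h⟩).y := dif_neg (not_isReal_iff_isComplex.2 h)

theorem ext_coord {z w : Space K} (hx : ∀ v, xAt v z = xAt v w) (hy : ∀ v, yAt v z = yAt v w) :
    z = w := by
  refine Prod.ext (funext fun v ↦ ?_) (funext fun v ↦ ?_)
  · have h1 := hx v.1
    have h2 := hy v.1
    rw [xAt_real v.2, xAt_real v.2, Complex.ofReal_inj] at h1
    rw [yAt_real v.2, yAt_real v.2] at h2
    exact UpperHalfPlane.ext (Complex.ext h1 h2)
  · have h1 := hx v.1
    have h2 := hy v.1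
    rw [xAt_complex v.2, xAt_complex v.2] at h1
    rw [yAt_complex v.2, yAt_complex v.2] at h2
    exact UpperHalfSpace.ext' h1 h2

@[fun_prop]
theorem continuous_xAt (v : InfinitePlace K) : Continuous (xAt v) := by
  by_cases h : v.IsReal
  · simp only [funext (xAt_real h)]
    exact Complex.continuous_ofReal.comp
      (UpperHalfPlane.continuous_re.comp ((continuous_apply _).comp continuous_fst))
  · simp only [funext (xAt_complex (not_isReal_iff_isComplex.1 h))]
    exact UpperHalfSpace.continuous_x.comp ((continuous_apply _).comp continuous_snd)

@[fun_prop]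
theorem continuous_yAt (v : InfinitePlace K) : Continuous (yAt v) := by
  by_cases h : v.IsReal
  · simp only [funext (yAt_real h)]
    exact UpperHalfPlane.continuous_im.comp ((continuous_apply _).comp continuous_fst)
  · simp only [funext (yAt_complex (not_isReal_iff_isComplex.1 h))]
    exact UpperHalfSpace.continuous_y.comp ((continuous_apply _).comp continuous_snd)

theorem yAt_pos (v : InfinitePlace K) (z : Space K) : 0 < yAt v z := by
  by_cases h : v.IsReal
  · rw [yAt_real h]; exact UpperHalfPlane.im_pos _
  · rw [yAt_complex (not_isReal_iff_isComplex.1 h)]; exact UpperHalfSpace.y_pos _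

@[fun_prop]
theorem continuous_denomAt (c d : K) (v : InfinitePlace K) : Continuous (denomAt c d v) := by
  unfold denomAt
  have := Complex.continuous_normSq
  fun_prop

/-- For real `c, d` the number `c z + d` has real part `c x + d` and imaginary part `c y`, so the
formula for three-space also covers the plane and both kinds of place can be treated together. -/
theorem denomAt_real (c d : K) {v : InfinitePlace K} (h : v.IsReal) (z : Space K) :
    denomAt c d v z = Complex.normSq ((embedding_of_isReal h c : ℂ) * z.1 ⟨v, h⟩ +
      (embedding_of_isReal h d : ℂ)) := by
  rw [denomAt, xAt_real h, yAt_real h, ← embedding_of_isReal_apply h, ← embedding_of_isReal_apply h]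
  simp only [Complex.normSq_apply, Complex.add_re, Complex.mul_re, Complex.add_im, Complex.mul_im,
    Complex.ofReal_re, Complex.ofReal_im, UpperHalfPlane.coe_re, UpperHalfPlane.coe_im]
  ring

theorem denomAt_complex (c d : K) {v : InfinitePlace K} (h : v.IsComplex) (z : Space K) :
    denomAt c d v z =
      UpperHalfSpace.normSqDenom (v.embedding c) (v.embedding d) (z.2 ⟨v, h⟩) := by
  rw [denomAt, xAt_complex h, yAt_complex h]; rfl

theorem denomAt_pos {c d : K} (h : c ≠ 0 ∨ d ≠ 0) (v : InfinitePlace K) (z : Space K) :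
    0 < denomAt c d v z := by
  have hy := yAt_pos v z
  unfold denomAt
  by_cases hc : c = 0
  · have hd : d ≠ 0 := by tauto
    simpa [hc] using hd
  · have := Complex.normSq_pos.2 ((map_ne_zero v.embedding).2 hc)
    have := Complex.normSq_nonneg (v.embedding c * xAt v z + v.embedding d)
    positivity

theorem row_ne_zero (g : SL(2, K)) (i : Fin 2) : g i 0 ≠ 0 ∨ g i 1 ≠ 0 := by
  by_contra! h
  have := g.det_coe
  rw [Matrix.det_fin_two] at this
  fin_cases i <;> simp_all

theorem denomAt_smul (c d : K) (g : SL(2, K)) (v : InfinitePlace K) (z : Space K) :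
    denomAt c d v (g • z) * denomAt (g 1 0) (g 1 1) v z =
      denomAt (c * g 0 0 + d * g 1 0) (c * g 0 1 + d * g 1 1) v z := by
  by_cases h : v.IsReal
  · rw [denomAt_real _ _ h, denomAt_real _ _ h, denomAt_real _ _ h]
    change Complex.normSq (_ * ((Matrix.SpecialLinearGroup.map (embedding_of_isReal h) g •
      z.1 ⟨v, h⟩ : ℍ) : ℂ) + _) * _ = _
    have hne : ((embedding_of_isReal h (g 1 0) : ℂ) * z.1 ⟨v, h⟩ +
        (embedding_of_isReal h (g 1 1) : ℂ)) ≠ 0 := by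
      have := UpperHalfPlane.denom_ne_zero
        (Matrix.SpecialLinearGroup.map (embedding_of_isReal h) g : GL (Fin 2) ℝ) (z.1 ⟨v, h⟩)
      simpa [UpperHalfPlane.denom] using this
    rw [← Complex.normSq_mul, UpperHalfPlane.coe_specialLinearGroup_apply]
    congr 1
    simp only [Matrix.SpecialLinearGroup.map_apply_coe, RingHom.mapMatrix_apply, Matrix.map_apply,
      Algebra.algebraMap_self, RingHom.id_apply, map_add, map_mul, Complex.ofReal_add,
      Complex.ofReal_mul]
    rw [add_mul, mul_assoc, div_mul_cancel₀ _ hne]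
    ring
  · replace h := not_isReal_iff_isComplex.1 h
    rw [denomAt_complex _ _ h, denomAt_complex _ _ h, denomAt_complex _ _ h]
    have := UpperHalfSpace.normSqDenom_smul (v.embedding c) (v.embedding d)
      (Matrix.SpecialLinearGroup.map v.embedding g) (z.2 ⟨v, h⟩)
    simp only [map_mul, map_add]
    exact this

theorem yAt_smul (g : SL(2, K)) (v : InfinitePlace K) (z : Space K) :
    yAt v (g • z) = yAt v z / denomAt (g 1 0) (g 1 1) v z := by
  by_cases h : v.IsReal
  · rw [yAt_real h, yAt_real h, denomAt_real _ _ h]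
    have := UpperHalfPlane.im_smul_eq_div_normSq
      (Matrix.SpecialLinearGroup.map (embedding_of_isReal h) g : GL (Fin 2) ℝ) (z.1 ⟨v, h⟩)
    have h2 : (g • z).1 ⟨v, h⟩ =
        (Matrix.SpecialLinearGroup.map (embedding_of_isReal h) g : GL (Fin 2) ℝ) • z.1 ⟨v, h⟩ :=
      rfl
    rw [h2, this]
    simp [UpperHalfPlane.denom]
  · replace h := not_isReal_iff_isComplex.1 h
    rw [yAt_complex h, yAt_complex h, denomAt_complex _ _ h]
    rfl

theorem normY_eq (z : Space K) : normY z = ∏ v, yAt v z ^ v.mult := by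
  classical
  rw [prod_eq_prod_mul_prod, normY]
  refine congrArg₂ _ (Finset.prod_congr (by congr) fun v _ ↦ ?_)
    (Finset.prod_congr (by congr) fun v _ ↦ ?_)
  · rw [mult_isReal, pow_one, yAt_real v.2]
  · rw [mult_isComplex, yAt_complex v.2]

theorem normSqDenom_eq (c d : K) (z : Space K) :
    normSqDenom c d z = ∏ v, denomAt c d v z ^ v.mult := by
  classical
  rw [prod_eq_prod_mul_prod, normSqDenom]
  refine congrArg₂ _ (Finset.prod_congr (by congr) fun v _ ↦ ?_)
    (Finset.prod_congr (by congr) fun v _ ↦ ?_)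
  · rw [mult_isReal, pow_one, denomAt_real _ _ v.2]
  · rw [mult_isComplex, denomAt_complex _ _ v.2]

theorem normY_pos (z : Space K) : 0 < normY z := by
  rw [normY_eq]
  exact Finset.prod_pos fun v _ ↦ pow_pos (yAt_pos v z) _

theorem normSqDenom_pos {c d : K} (h : c ≠ 0 ∨ d ≠ 0) (z : Space K) : 0 < normSqDenom c d z := by
  rw [normSqDenom_eq]
  exact Finset.prod_pos fun v _ ↦ pow_pos (denomAt_pos h v z) _

@[fun_prop]
theorem continuous_normY : Continuous (normY : Space K → ℝ) := by
  simp only [funext normY_eq]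
  fun_prop

@[fun_prop]
theorem continuous_normSqDenom (c d : K) : Continuous (normSqDenom c d) := by
  simp only [funext (normSqDenom_eq c d)]
  fun_prop

end Space

end HilbertModular

/-! ### Continuity of the group actions. -/

namespace UpperHalfSpace

theorem continuous_normSqDenom (c d : ℂ) : Continuous (normSqDenom c d) := by
  unfold normSqDenom
  have := Complex.continuous_normSq
  fun_prop

instance : ContinuousConstSMul SL(2, ℂ) UpperHalfSpace where
  continuous_const_smul g := by
    have h := continuous_normSqDenom (g 1 0) (g 1 1)
    have h' := fun z ↦ (normSqDenom_pos (row_ne_zero g) z).ne'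
    refine Topology.IsInducing.subtypeVal.continuous_iff.2 (Continuous.prodMk ?_ ?_)
    · change Continuous fun z : UpperHalfSpace ↦ (((g 0 0 * z.x + g 0 1) *
        conj (g 1 0 * z.x + g 1 1) + g 0 0 * conj (g 1 0) * (z.y : ℂ) ^ 2) /
          (normSqDenom (g 1 0) (g 1 1) z : ℂ))
      refine Continuous.div ?_ (Complex.continuous_ofReal.comp h)
        fun z ↦ Complex.ofReal_ne_zero.2 (h' z)
      fun_prop
    · exact Continuous.div continuous_y h h'

end UpperHalfSpace

namespace HilbertModular.Space

variable {K : Type*} [Field K] [NumberField K]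

instance : ContinuousConstSMul SL(2, K) (Space K) where
  continuous_const_smul g := by
    refine Continuous.prodMk (continuous_pi fun v ↦ ?_) (continuous_pi fun v ↦ ?_)
    · exact (continuous_const_smul
        (Matrix.SpecialLinearGroup.map (embedding_of_isReal v.2) g : GL (Fin 2) ℝ)).comp
          ((continuous_apply v).comp continuous_fst)
    · exact (continuous_const_smul (Matrix.SpecialLinearGroup.map v.1.embedding g)).comp
        ((continuous_apply v).comp continuous_snd)

instance : ContinuousConstSMul PSL(2, K) (Space K) where
  continuous_const_smul γ := by
    induction γ using QuotientGroup.induction_on with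
    | H g => exact continuous_const_smul g

end HilbertModular.Space

/-! ### Invariance of the hyperbolic volume. -/

open scoped Pointwise

namespace UpperHalfSpace

/-- The coordinates `(x, y)` of a point of the upper half-space. -/
def toProd (z : UpperHalfSpace) : ℂ × ℝ := z.1

theorem x_eq (z : UpperHalfSpace) : z.x = z.toProd.1 := rfl

theorem y_eq (z : UpperHalfSpace) : z.y = z.toProd.2 := rfl

theorem isOpenEmbedding_toProd : Topology.IsOpenEmbedding toProd := isOpenEmbedding_val

theorem volume_eq : (volume : Measure UpperHalfSpace) =
    ((volume : Measure (ℂ × ℝ)).comap toProd).withDensity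
      fun z ↦ ENNReal.ofReal (1 / z.y ^ 3) := rfl

theorem volume_apply (s : Set UpperHalfSpace) (hs : MeasurableSet s) :
    volume s = ∫⁻ p in toProd '' s, ENNReal.ofReal (1 / p.2 ^ 3) := by
  have he := isOpenEmbedding_toProd.measurableEmbedding
  have hm : Measurable fun p : ℂ × ℝ ↦ ENNReal.ofReal (1 / p.2 ^ 3) := by fun_prop
  rw [volume_eq, withDensity_apply _ hs]
  change ∫⁻ z in s, (fun p : ℂ × ℝ ↦ ENNReal.ofReal (1 / p.2 ^ 3)) (toProd z) ∂_ = _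
  rw [← lintegral_map hm he.measurable, he.restrict_comap, he.map_comap, 
    Measure.restrict_restrict he.measurableSet_range,
    Set.inter_eq_self_of_subset_right (Set.image_subset_range _ _)]

instance : SigmaFinite (volume : Measure UpperHalfSpace) := by
  have : IsFiniteMeasureOnCompacts ((volume : Measure (ℂ × ℝ)).comap toProd) :=
    .comap' _ isOpenEmbedding_toProd.continuous isOpenEmbedding_toProd.measurableEmbedding
  have : LocallyCompactSpace UpperHalfSpace := isOpenEmbedding_toProd.locallyCompactSpace
  rw [volume_eq]
  have : SigmaFinite ((volume : Measure (ℂ × ℝ)).comap toProd) := inferInstance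
  exact SigmaFinite.withDensity_ofReal _

/-- A smooth self-map of the upper half-space preserves volumes if its Jacobian determinant
is `(y' / y) ^ 3`. -/
theorem volume_smul_of_det {g : SL(2, ℂ)} {F : ℂ × ℝ → ℂ × ℝ} {L : ℂ × ℝ → ℂ × ℝ →L[ℝ] ℂ × ℝ}
    (hF : ∀ z : UpperHalfSpace, F z.toProd = (g • z).toProd)
    (hL : ∀ z : UpperHalfSpace, HasFDerivAt F (L z.toProd) z.toProd)
    (hdet : ∀ z : UpperHalfSpace, |(L z.toProd).det| = ((g • z).y / z.y) ^ 3)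
    (s : Set UpperHalfSpace) (hs : MeasurableSet s) : volume (g • s) = volume s := by
  have he := isOpenEmbedding_toProd.measurableEmbedding
  have hgs : MeasurableSet (g • s) := hs.const_smul g
  rw [volume_apply s hs, volume_apply _ hgs]
  have himg : toProd '' (g • s) = F '' (toProd '' s) := by
    rw [← Set.image_smul, Set.image_image, Set.image_image]
    exact Set.image_congr fun z _ ↦ (hF z).symm
  have hinj : Set.InjOn F (toProd '' s) := by
    rintro _ ⟨z, -, rfl⟩ _ ⟨w, -, rfl⟩ h
    rw [hF, hF] at h
    exact congrArg toProd (MulAction.injective g (Subtype.ext h))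
  have : (volume : Measure (ℂ × ℝ)).IsAddHaarMeasure := Measure.prod.instIsAddHaarMeasure _ _
  rw [himg, lintegral_image_eq_lintegral_abs_det_fderiv_mul (volume : Measure (ℂ × ℝ))
    (he.measurableSet_image.2 hs) (Set.forall_mem_image.2 fun z _ ↦ (hL z).hasFDerivWithinAt) hinj]
  refine setLIntegral_congr_fun (he.measurableSet_image.2 hs) ?_
  rintro _ ⟨z, -, rfl⟩
  have h1 : (F z.toProd).2 = (g • z).y := by rw [hF]; rfl
  have h2 : z.toProd.2 = z.y := rfl
  have := z.y_pos
  have := (g • z).y_pos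
  -- The Jacobian `(y' / y)³` times the density `1 / y'³` at the image is the density `1 / y³` at
  -- the source.
  simp only [hdet, h1, h2]
  rw [← ENNReal.ofReal_mul (by positivity)]
  congr 1
  field_simp

/-- Used for the two involutions that make up the derivative of the inversion, up to scale. -/
theorem abs_det_eq_one_of_sq {E : Type*} [AddCommGroup E] [Module ℝ E]
    {f : E →ₗ[ℝ] E} (hf : f ∘ₗ f = LinearMap.id) : |LinearMap.det f| = 1 := by
  have h : LinearMap.det f * LinearMap.det f = 1 := by
    rw [← LinearMap.det_comp, hf, LinearMap.det_id]
  rcases mul_self_eq_one_iff.1 h with h | h <;> simp [h]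

/-- The linear map `(x, y) ↦ (-conj x, y)`. -/
def negConj : ℂ × ℝ →L[ℝ] ℂ × ℝ :=
  (-(Complex.conjCLE : ℂ →L[ℝ] ℂ)).prodMap (ContinuousLinearMap.id ℝ ℝ)

/-- The functional `h ↦ 2 ⟨p, h⟩`. -/
def twoInner (p : ℂ × ℝ) : ℂ × ℝ →L[ℝ] ℝ :=
  (2 * p.1.re) • (Complex.reCLM.comp (.fst ℝ ℂ ℝ)) + (2 * p.1.im) • (Complex.imCLM.comp (.fst ℝ ℂ ℝ))
    + (2 * p.2) • .snd ℝ ℂ ℝ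

theorem twoInner_apply (p h : ℂ × ℝ) :
    twoInner p h = 2 * p.1.re * h.1.re + 2 * p.1.im * h.1.im + 2 * p.2 * h.2 := by
  simp [twoInner]

theorem hasFDerivAt_sq (p : ℂ × ℝ) :
    HasFDerivAt (fun p : ℂ × ℝ ↦ p.1.re ^ 2 + p.1.im ^ 2 + p.2 ^ 2) (twoInner p) p := by
  have h1 := (Complex.reCLM.comp (.fst ℝ ℂ ℝ)).hasFDerivAt (x := p)
  have h2 := (Complex.imCLM.comp (.fst ℝ ℂ ℝ)).hasFDerivAt (x := p)
  have h3 := (ContinuousLinearMap.snd ℝ ℂ ℝ).hasFDerivAt (x := p)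
  convert! ((h1.pow 2).add (h2.pow 2)).add (h3.pow 2) using 1
  ext h <;> simp [twoInner]

/-- The matrix `(0, -1; 1, 0)`. -/
def inversion : SL(2, ℂ) := ⟨!![0, -1; 1, 0], by simp⟩

/-- The inversion is `p ↦ T p / |p|²` with `T = negConj`. Its derivative at `p` is `|p|⁻² T ∘ R`,
where `R` is the reflection `h ↦ h - 2 ⟨p, h⟩ p / |p|²`. Both `T` and `R` are involutions of a
three-dimensional space, so the determinant is `±|p|⁻⁶`, while `y' / y = |p|⁻²`. -/
theorem volume_inversion_smul (s : Set UpperHalfSpace) (hs : MeasurableSet s) :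
    volume (inversion • s) = volume s := by
  have hP : ∀ z : UpperHalfSpace, normSqDenom 1 0 z = z.toProd.1.re ^ 2 + z.toProd.1.im ^ 2 + z.toProd.2 ^ 2 :=
    fun z ↦ by
      simp only [normSqDenom, Complex.normSq_apply, x_eq, y_eq]
      simp
      ring
  let n : ℂ × ℝ → ℝ := fun p ↦ p.1.re ^ 2 + p.1.im ^ 2 + p.2 ^ 2
  have hn : ∀ z : UpperHalfSpace, 0 < n z.toProd := fun z ↦ by
    have : 0 < z.toProd.2 := z.2
    positivity
  refine volume_smul_of_det (F := fun p ↦ (n p)⁻¹ • negConj p)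
    (L := fun p ↦ (n p)⁻¹ • negConj + (-((n p) ^ 2)⁻¹ • twoInner p).smulRight (negConj p))
    (fun z ↦ ?_) (fun z ↦ ?_) (fun z ↦ ?_) s hs
  · refine Prod.ext ?_ ?_
    · change _ = UpperHalfSpace.x (_ • z)
      rw [smul_x]
      simp [inversion, hP, negConj, n, x_eq]
      ring
    · change _ = UpperHalfSpace.y (_ • z)
      rw [smul_y]
      simp [inversion, hP, negConj, n, y_eq]
      ring
  · exact (((hasFDerivAt_inv (hn z).ne').comp z.toProd (hasFDerivAt_sq z.toProd)).fun_smul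
      negConj.hasFDerivAt).congr_fderiv (by
        ext <;> simp [n] <;> exact Or.inl (mul_comm _ _))
  · have hn' := hn z
    set p := z.toProd
    have hy : (inversion • z).y / z.y = (n p)⁻¹ := by
      have := z.y_pos
      rw [smul_y]
      simp [inversion, hP, n, p]
      field_simp
    rw [hy]
    let R : ℂ × ℝ →ₗ[ℝ] ℂ × ℝ := LinearMap.id - ((n p)⁻¹ • (twoInner p).toLinearMap).smulRight p
    have hR : R ∘ₗ R = LinearMap.id := by
      have hpp : twoInner p p = 2 * n p := by rw [twoInner_apply]; simp only [n]; ring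
      refine LinearMap.ext fun h ↦ ?_
      simp only [R, LinearMap.comp_apply, LinearMap.sub_apply, LinearMap.id_apply,
        LinearMap.smulRight_apply, LinearMap.smul_apply, ContinuousLinearMap.coe_coe, map_sub,
        map_smul, hpp, smul_eq_mul]
      have : (n p)⁻¹ * (2 * n p) = 2 := by field_simp
      rw [this]
      module
    have hT : negConj.toLinearMap ∘ₗ negConj.toLinearMap = LinearMap.id := by
      refine LinearMap.ext fun h ↦ ?_
      simp [negConj]
    have hLR : (((n p)⁻¹ • negConj + (-((n p) ^ 2)⁻¹ • twoInner p).smulRight (negConj p) :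
        ℂ × ℝ →L[ℝ] ℂ × ℝ) : ℂ × ℝ →ₗ[ℝ] ℂ × ℝ) = (n p)⁻¹ • (negConj.toLinearMap ∘ₗ R) := by
      refine LinearMap.ext fun h ↦ ?_
      change (n p)⁻¹ • negConj h + (-((n p) ^ 2)⁻¹ • twoInner p h) • negConj p =
        (n p)⁻¹ • negConj (h - ((n p)⁻¹ • twoInner p h) • p)
      rw [map_sub, map_smul, smul_sub, smul_smul, smul_eq_mul, smul_eq_mul, sub_eq_add_neg,
        ← neg_smul]
      congr 2
      ring_nf
    rw [ContinuousLinearMap.det, hLR, LinearMap.det_smul, LinearMap.det_comp, abs_mul, abs_mul,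
      abs_det_eq_one_of_sq hR, abs_det_eq_one_of_sq hT, abs_of_pos (by positivity)]
    simp

/-- Here the action is the affine map `(x, y) ↦ (a² x + a b, |a|² y)`, with determinant `|a|⁴ · |a|²
= (y' / y)³`. -/
theorem volume_upper_smul (g : SL(2, ℂ)) (hg : g 1 0 = 0) (s : Set UpperHalfSpace)
    (hs : MeasurableSet s) : volume (g • s) = volume s := by
  have hdet := g.det_coe
  rw [Matrix.det_fin_two, hg, mul_zero, sub_zero] at hdet
  have ha : g 0 0 ≠ 0 := left_ne_zero_of_mul_eq_one hdet
  have hd : g 1 1 = (g 0 0)⁻¹ := eq_inv_of_mul_eq_one_right hdet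
  have hP : ∀ z : UpperHalfSpace, normSqDenom (g 1 0) (g 1 1) z = (Complex.normSq (g 0 0))⁻¹ :=
    fun z ↦ by simp [normSqDenom, hg, hd]
  refine volume_smul_of_det (F := fun p ↦ ((g 0 0 ^ 2) * p.1 + g 0 0 * g 0 1,
    Complex.normSq (g 0 0) * p.2))
    (L := fun p ↦ ((g 0 0 ^ 2) • ContinuousLinearMap.id ℝ ℂ).prodMap
      (Complex.normSq (g 0 0) • ContinuousLinearMap.id ℝ ℝ))
    (fun z ↦ ?_) (fun z ↦ ?_) (fun z ↦ ?_) s hs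
  · refine Prod.ext ?_ ?_
    · change _ = UpperHalfSpace.x (_ • z)
      rw [smul_x, hP, hg, hd]
      have : conj (g 0 0) ≠ 0 := by simpa using ha
      simp [x_eq, Complex.normSq_eq_conj_mul_self]
      field_simp
    · change _ = UpperHalfSpace.y (_ • z)
      rw [smul_y, hP]
      simp [y_eq, mul_comm]
  · refine HasFDerivAt.prodMk ?_ ?_
    · convert! ((((g 0 0 ^ 2) • ContinuousLinearMap.id ℝ ℂ).comp
        (.fst ℝ ℂ ℝ)).hasFDerivAt (x := z.toProd)).add_const (g 0 0 * g 0 1) using 1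
    · exact ((Complex.normSq (g 0 0) • ContinuousLinearMap.id ℝ ℝ).comp
        (.snd ℝ ℂ ℝ)).hasFDerivAt
  · rw [smul_y, hP, ContinuousLinearMap.det, ContinuousLinearMap.coe_prodMap, LinearMap.det_prodMap]
    -- Multiplication by `w`, as a real-linear map of the plane, has determinant the norm `|w|²`.
    have h1 : LinearMap.det ((g 0 0 ^ 2) • ContinuousLinearMap.id ℝ ℂ : ℂ →L[ℝ] ℂ).toLinearMap =
        Complex.normSq (g 0 0 ^ 2) := by
      rw [← Algebra.norm_complex_apply]
      rfl
    have h2 : LinearMap.det (Complex.normSq (g 0 0) • ContinuousLinearMap.id ℝ ℝ :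
        ℝ →L[ℝ] ℝ).toLinearMap = Complex.normSq (g 0 0) := by
      simp
    rw [h1, h2, map_pow, abs_of_nonneg (by have := Complex.normSq_nonneg (g 0 0); positivity)]
    have := z.y_pos
    field_simp

/-- Bruhat decomposition: a matrix with nonzero lower left entry is upper triangular times inversion
times upper triangular. -/
theorem volume_smul (g : SL(2, ℂ)) (s : Set UpperHalfSpace) (hs : MeasurableSet s) :
    volume (g • s) = volume s := by
  by_cases hc : g 1 0 = 0
  · exact volume_upper_smul g hc s hs
  have hdet := g.det_coe
  rw [Matrix.det_fin_two] at hdet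
  let u₁ : SL(2, ℂ) := ⟨!![1, g 0 0 / g 1 0; 0, 1], by simp⟩
  let u₂ : SL(2, ℂ) := ⟨!![g 1 0, g 1 1; 0, (g 1 0)⁻¹], by simp [hc]⟩
  have hg : g = u₁ * inversion * u₂ := by
    refine Subtype.ext ?_
    change g.1 = (!![1, g 0 0 / g 1 0; 0, 1] * !![0, -1; 1, 0]) * !![g 1 0, g 1 1; 0, (g 1 0)⁻¹]
    rw [Matrix.mul_fin_two, Matrix.mul_fin_two, Matrix.eta_fin_two g.1]
    congr 4
    · simp; field_simp
    · simp; field_simp; linear_combination -hdet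
    · simp
    · simp
  rw [hg, mul_smul, mul_smul, volume_upper_smul u₁ rfl _ ((hs.const_smul u₂).const_smul _),
    volume_inversion_smul _ (hs.const_smul u₂), volume_upper_smul u₂ rfl s hs]

instance : SMulInvariantMeasure SL(2, ℂ) UpperHalfSpace volume :=
  ((smulInvariantMeasure_tfae _ _).out 2 0).mp volume_smul

end UpperHalfSpace

namespace HilbertModular.Space

variable {K : Type*} [Field K] [NumberField K]

open scoped Classical in
theorem measurePreserving_smul (g : SL(2, K)) :
    MeasurePreserving (fun z : Space K ↦ g • z) := by
  refine MeasurePreserving.prod (μa := volume) (μb := volume)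
    (f := fun z : {v : InfinitePlace K // v.IsReal} → ℍ ↦ fun v ↦
      (Matrix.SpecialLinearGroup.map (embedding_of_isReal v.2) g : GL (Fin 2) ℝ) • z v)
    (g := fun z : {v : InfinitePlace K // v.IsComplex} → UpperHalfSpace ↦ fun v ↦
      Matrix.SpecialLinearGroup.map v.1.embedding g • z v) ?_ ?_
  · exact volume_preserving_pi fun v ↦ MeasureTheory.measurePreserving_smul _ volume
  · exact volume_preserving_pi fun v ↦ MeasureTheory.measurePreserving_smul _ volume

instance : SMulInvariantMeasure PSL(2, K) (Space K) volume where
  measure_preimage_smul γ s hs := by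
    induction γ using QuotientGroup.induction_on with
    | H g => exact (measurePreserving_smul g).measure_preimage hs.nullMeasurableSet

instance : SMulInvariantMeasure (modularGroup K) (Space K) volume where
  measure_preimage_smul γ _ hs :=
    SMulInvariantMeasure.measure_preimage_smul (μ := (volume : Measure (Space K))) γ.1 hs

end HilbertModular.Space

/-! ### Fixed points of nontrivial elements form null sets. -/

namespace UpperHalfPlane

/-- Fixed points are roots of `c z² + (d - a) z - b`, which is not the zero polynomial for a
nonscalar matrix. -/
theorem volume_fixedPoints_eq_zero (g : SL(2, ℝ)) (hg : g 0 1 ≠ 0 ∨ g 1 0 ≠ 0 ∨ g 0 0 ≠ g 1 1) :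
    volume {z : ℍ | (g : GL (Fin 2) ℝ) • z = z} = 0 := by
  rw [volume_def]
  refine withDensity_absolutelyContinuous _ _ ?_
  rw [measurableEmbedding_coe.comap_apply]
  let p : Polynomial ℂ := Polynomial.C (g 1 0 : ℂ) * Polynomial.X ^ 2 +
    Polynomial.C (g 1 1 - g 0 0 : ℂ) * Polynomial.X + Polynomial.C (-g 0 1 : ℂ)
  have hp : p ≠ 0 := by
    intro h
    have h0 := congrArg (fun q ↦ q.coeff 0) h
    have h1 := congrArg (fun q ↦ q.coeff 1) h
    have h2 := congrArg (fun q ↦ q.coeff 2) h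
    simp [p, Polynomial.coeff_X, Polynomial.coeff_C] at h0 h1 h2
    rcases hg with hg | hg | hg
    · exact hg h0
    · exact hg h2
    · exact hg (by exact_mod_cast (sub_eq_zero.1 h1).symm)
  refine measure_mono_null (t := {z | p.IsRoot z}) ?_
    ((Polynomial.finite_setOfPred_isRoot hp).measure_zero _)
  rintro _ ⟨z, hz, rfl⟩
  have h : ((g • z : ℍ) : ℂ) = z := congrArg _ hz
  have hd := UpperHalfPlane.denom_ne_zero (g : GL (Fin 2) ℝ) z
  rw [UpperHalfPlane.coe_specialLinearGroup_apply] at h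
  simp only [Algebra.algebraMap_self, RingHom.id_apply] at h
  rw [div_eq_iff (by simpa [UpperHalfPlane.denom] using hd)] at h
  simp [p]
  linear_combination -h

end UpperHalfPlane

namespace UpperHalfSpace

/-- If `c = 0`, all fixed points lie on one vertical line. If `c ≠ 0`, comparing heights puts them
on the isometric sphere `|c x + d|² + |c|² y² = 1`, which meets each vertical line in at most two
points. -/
theorem volume_fixedPoints_eq_zero (g : SL(2, ℂ)) (hg : g 0 1 ≠ 0 ∨ g 1 0 ≠ 0 ∨ g 0 0 ≠ g 1 1) :
    volume {z : UpperHalfSpace | g • z = z} = 0 := by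
  rw [volume_eq]
  refine withDensity_absolutelyContinuous _ _ ?_
  rw [isOpenEmbedding_toProd.measurableEmbedding.comap_apply]
  by_cases hc : g 1 0 = 0
  · have hdet := g.det_coe
    rw [Matrix.det_fin_two, hc, mul_zero, sub_zero] at hdet
    have ha : g 0 0 ≠ 0 := left_ne_zero_of_mul_eq_one hdet
    have hd : g 1 1 = (g 0 0)⁻¹ := eq_inv_of_mul_eq_one_right hdet
    have hx : ∀ z : UpperHalfSpace, (g • z).x = g 0 0 ^ 2 * z.x + g 0 0 * g 0 1 := fun z ↦ by
      have : conj (g 0 0) ≠ 0 := by simpa using ha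
      rw [smul_x]
      simp [normSqDenom, hc, hd, Complex.normSq_eq_conj_mul_self]
      field_simp
    refine measure_mono_null (t := {g 0 0 * g 0 1 / (1 - g 0 0 ^ 2)} ×ˢ Set.univ) ?_ ?_
    · rintro _ ⟨z, hz, rfl⟩
      have h := hx z
      rw [show g • z = z from hz] at h
      have h1 : 1 - g 0 0 ^ 2 ≠ 0 := by
        intro h1
        have hb : g 0 1 = 0 := by
          have : g 0 0 * g 0 1 = 0 := by linear_combination -h + z.x * h1
          exact (mul_eq_zero.1 this).resolve_left ha
        rcases hg with hg | hg | hg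
        · exact hg hb
        · exact hg hc
        · refine hg ?_
          rw [hd]
          field_simp
          linear_combination -h1
      refine ⟨?_, trivial⟩
      change z.x = _
      field_simp
      linear_combination h
    · rw [Measure.volume_eq_prod, Measure.prod_prod]
      simp
  · let S : Set (ℂ × ℝ) := {p | Complex.normSq (g 1 0 * p.1 + g 1 1) +
      Complex.normSq (g 1 0) * p.2 ^ 2 = 1}
    have hS : MeasurableSet S := by
      refine (isClosed_eq ?_ continuous_const).measurableSet
      have := Complex.continuous_normSq
      fun_prop
    refine measure_mono_null (t := S) ?_ ?_
    · rintro _ ⟨z, hz, rfl⟩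
      have h := smul_y g z
      rw [show g • z = z from hz, eq_div_iff (normSqDenom_pos (row_ne_zero g) z).ne'] at h
      exact mul_left_cancel₀ z.y_pos.ne' (h.trans (mul_one _).symm)
    · rw [Measure.volume_eq_prod, Measure.measure_prod_null hS]
      refine Filter.Eventually.of_forall fun x ↦ ?_
      let t := (1 - Complex.normSq (g 1 0 * x + g 1 1)) / Complex.normSq (g 1 0)
      have hc' : Complex.normSq (g 1 0) ≠ 0 := by simpa using hc
      refine measure_mono_null (t := {√t, -√t}) (fun y hy ↦ ?_) ((Set.toFinite _).measure_zero _)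
      have hy : Complex.normSq (g 1 0 * x + g 1 1) + Complex.normSq (g 1 0) * y ^ 2 = 1 := hy
      have : y ^ 2 = t := by
        simp only [t]
        field_simp
        linear_combination hy
      rw [← this, Real.sqrt_sq_eq_abs]
      rcases abs_choice y with h | h <;> rw [h] <;> simp

end UpperHalfSpace

namespace HilbertModular.Space

variable {K : Type*} [Field K] [NumberField K]

theorem mem_center_of_entries {g : SL(2, K)} (h01 : g 0 1 = 0) (h10 : g 1 0 = 0)
    (h : g 0 0 = g 1 1) : g ∈ Subgroup.center SL(2, K) := by
  have hdet := g.det_coe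
  rw [Matrix.det_fin_two, h10, mul_zero, sub_zero, ← h] at hdet
  refine Matrix.SpecialLinearGroup.mem_center_iff.2 ⟨g 0 0, ?_, ?_⟩
  · simpa [sq] using hdet
  · ext i j
    fin_cases i <;> fin_cases j <;> simp [h01, h10, h]

-- One place suffices: embeddings are injective, so the matrix stays nonscalar there, and the fixed
-- set projects into a null set of that factor.
open scoped Classical in
theorem volume_fixedPoints_eq_zero {γ : PSL(2, K)} (hγ : γ ≠ 1) :
    volume {z : Space K | γ • z = z} = 0 := by
  induction γ using QuotientGroup.induction_on with
  | H g =>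
  have hg : g 0 1 ≠ 0 ∨ g 1 0 ≠ 0 ∨ g 0 0 ≠ g 1 1 := by
    by_contra! h
    exact hγ ((QuotientGroup.eq_one_iff g).2 (mem_center_of_entries h.1 h.2.1 h.2.2))
  obtain ⟨v⟩ : Nonempty (InfinitePlace K) := inferInstance
  by_cases hv : v.IsReal
  · have h0 := UpperHalfPlane.volume_fixedPoints_eq_zero
      (Matrix.SpecialLinearGroup.map (embedding_of_isReal hv) g)
      (by simpa [(embedding_of_isReal hv).injective.eq_iff] using hg)
    have h1 : (volume : Measure ({v : InfinitePlace K // v.IsReal} → ℍ)) _ = 0 :=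
      (Measure.quasiMeasurePreserving_eval _
        (⟨v, hv⟩ : {v : InfinitePlace K // v.IsReal})).preimage_null h0
    have h2 := (Measure.quasiMeasurePreserving_fst (ν := (volume : Measure
      ({v : InfinitePlace K // v.IsComplex} → UpperHalfSpace)))).preimage_null h1
    refine measure_mono_null (fun z hz ↦ ?_) h2
    exact congrFun (congrArg Prod.fst (show g • z = z from hz)) ⟨v, hv⟩
  · replace hv := not_isReal_iff_isComplex.1 hv
    have h0 := UpperHalfSpace.volume_fixedPoints_eq_zero
      (Matrix.SpecialLinearGroup.map v.embedding g)
      (by simpa [v.embedding.injective.eq_iff] using hg)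
    have h1 : (volume : Measure ({v : InfinitePlace K // v.IsComplex} → UpperHalfSpace)) _ = 0 :=
      (Measure.quasiMeasurePreserving_eval _
        (⟨v, hv⟩ : {v : InfinitePlace K // v.IsComplex})).preimage_null h0
    have h2 := (Measure.quasiMeasurePreserving_snd (μ := (volume : Measure
      ({v : InfinitePlace K // v.IsReal} → ℍ)))).preimage_null h1
    refine measure_mono_null (fun z hz ↦ ?_) h2
    exact congrFun (congrArg Prod.snd (show g • z = z from hz)) ⟨v, hv⟩

end HilbertModular.Space

/-! ### Measurable sets of orbit representatives. -/

section FundamentalDomain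

variable {G α : Type*} [Group G] [Countable G] [MulAction G α] [MeasurableSpace α]
  [MeasurableSpace.CountablySeparated α] [MeasurableConstSMul G α]

/-- If every orbit of a countable group meets each sublevel set of a measurable function in
finitely many translates, then there is a measurable set of representatives of the orbits. -/
theorem exists_measurableSet_representatives {n : α → ℕ} (hn : Measurable n)
    (hfin : ∀ x t, {g : G | n (g • x) ≤ t}.Finite) :
    ∃ F : Set α, MeasurableSet F ∧ (∀ x, ∃ g : G, g • x ∈ F) ∧
      ∀ x ∈ F, ∀ g : G, g • x ∈ F → g • x = x := by
  obtain ⟨φ₁, hφ₁, hφ₁'⟩ := MeasurableSpace.measurable_injection_nat_bool_of_countablySeparated α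
  obtain ⟨φ₂, hφ₂⟩ := exists_measurableEmbedding_real (ℕ → Bool)
  let φ := φ₂ ∘ φ₁
  have hφ : Measurable φ := hφ₂.measurable.comp hφ₁
  have hφ' : Function.Injective φ := hφ₂.injective.comp hφ₁'
  -- The representatives minimize `(n, φ)` lexicographically on their orbit. Only finitely many
  -- group elements compete, so a minimum exists. As `φ` is injective, two minimizers in one orbit
  -- coincide as points, though the group element relating them may be a nontrivial stabilizer.
  refine ⟨⋂ g : G, {x | n x < n (g • x) ∨ (n x = n (g • x) ∧ φ x ≤ φ (g • x))},
    .iInter fun g ↦ ?_, fun x ↦ ?_, fun x hx g hg ↦ ?_⟩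
  · have h1 : Measurable fun x ↦ n (g • x) := hn.comp (measurable_const_smul g)
    have h2 : Measurable fun x ↦ φ (g • x) := hφ.comp (measurable_const_smul g)
    exact (measurableSet_lt hn h1).union ((measurableSet_eq_fun hn h1).inter
      (measurableSet_le hφ h2))
  · obtain ⟨g, hg, hmin⟩ := Set.exists_min_image {g : G | n (g • x) ≤ n x}
      (fun g ↦ toLex (n (g • x), φ (g • x))) (hfin x (n x)) ⟨1, by simp⟩
    refine ⟨g, Set.mem_iInter.2 fun k ↦ ?_⟩
    simp only [Set.mem_ofPred_eq, smul_smul]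
    rcases le_or_gt (n ((k * g) • x)) (n x) with h | h
    · have := hmin (k * g) h
      rwa [Prod.Lex.toLex_le_toLex] at this
    · exact Or.inl (lt_of_le_of_lt hg h)
  · have h1 := Set.mem_iInter.1 hx g
    have h2 := Set.mem_iInter.1 hg g⁻¹
    simp only [Set.mem_ofPred_eq, inv_smul_smul] at h1 h2
    refine hφ' (le_antisymm ?_ ?_)
    · rcases h2 with h2 | h2
      · rcases h1 with h1 | h1 <;> omega
      · exact h2.2
    · rcases h1 with h1 | h1
      · rcases h2 with h2 | h2 <;> omega
      · exact h1.2

end FundamentalDomain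

/-! ### Proper discontinuity, the fundamental domain and the orbifold measure. -/

namespace HilbertModular

variable {K : Type*} [Field K] [NumberField K]

namespace Space

/-- A proper function on the product of the upper half-planes and half-spaces. -/
def size (z : Space K) : ℝ := ∑ v, (yAt v z + (yAt v z)⁻¹ + ‖xAt v z‖)

theorem continuous_size : Continuous (size : Space K → ℝ) := by
  unfold size
  refine continuous_finsetSum _ fun v _ ↦ ?_
  exact ((continuous_yAt v).add ((continuous_yAt v).inv₀ fun z ↦ (yAt_pos v z).ne')).add
    (continuous_xAt v).norm

theorem size_nonneg (z : Space K) : 0 ≤ size z :=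
  Finset.sum_nonneg fun v _ ↦ by have := yAt_pos v z; positivity

theorem le_size (v : InfinitePlace K) (z : Space K) :
    yAt v z + (yAt v z)⁻¹ + ‖xAt v z‖ ≤ size z :=
  Finset.single_le_sum (f := fun v ↦ yAt v z + (yAt v z)⁻¹ + ‖xAt v z‖)
    (fun v _ ↦ by have := yAt_pos v z; positivity) (Finset.mem_univ v)

theorem yAt_le_size (v : InfinitePlace K) (z : Space K) : yAt v z ≤ size z := by
  have := le_size v z
  have := yAt_pos v z
  have := inv_pos.2 (yAt_pos v z)
  have := norm_nonneg (xAt v z)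
  linarith

theorem inv_yAt_le_size (v : InfinitePlace K) (z : Space K) : (yAt v z)⁻¹ ≤ size z := by
  have := le_size v z
  have := yAt_pos v z
  have := norm_nonneg (xAt v z)
  linarith

theorem norm_xAt_le_size (v : InfinitePlace K) (z : Space K) : ‖xAt v z‖ ≤ size z := by
  have := le_size v z
  have := yAt_pos v z
  have := inv_pos.2 (yAt_pos v z)
  linarith

/-- From `|c| y ≤ √T` and `1 / y ≤ t` follows the bound for `c`; then `|d| ≤ |c x + d| + |c| |x|`.
-/
theorem norm_le_of_denomAt_le {c d : K} {v : InfinitePlace K} {z : Space K} {T t : ℝ}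
    (hT : denomAt c d v z ≤ T) (ht : size z ≤ t) :
    v c ≤ √T * t ∧ v d ≤ √T * (1 + t ^ 2) := by
  have hy := yAt_pos v z
  have h0 : 0 ≤ t := (size_nonneg z).trans ht
  have h1 : Complex.normSq (v.embedding c * xAt v z + v.embedding d) ≤ T := by
    have := mul_nonneg (Complex.normSq_nonneg (v.embedding c)) (sq_nonneg (yAt v z))
    unfold denomAt at hT
    linarith
  have h2 : Complex.normSq (v.embedding c) * yAt v z ^ 2 ≤ T := by
    have := Complex.normSq_nonneg (v.embedding c * xAt v z + v.embedding d)
    unfold denomAt at hT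
    linarith
  rw [Complex.normSq_eq_norm_sq] at h1 h2
  rw [norm_embedding_eq] at h2
  have h3 : v c * yAt v z ≤ √T := Real.le_sqrt_of_sq_le (by rw [mul_pow]; exact h2)
  have h4 : ‖v.embedding c * xAt v z + v.embedding d‖ ≤ √T := Real.le_sqrt_of_sq_le h1
  have h5 : v c ≤ √T * t := by
    calc v c = v c * yAt v z * (yAt v z)⁻¹ := by field_simp
      _ ≤ √T * t := mul_le_mul h3 ((inv_yAt_le_size v z).trans ht) (by positivity) (by positivity)
  refine ⟨h5, ?_⟩
  have h6 : v d ≤ ‖v.embedding c * xAt v z + v.embedding d‖ + v c * ‖xAt v z‖ := by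
    rw [← norm_embedding_eq v d, ← norm_embedding_eq v c, ← norm_mul]
    have := norm_sub_le (v.embedding c * xAt v z + v.embedding d) (v.embedding c * xAt v z)
    rwa [add_sub_cancel_left] at this
  have h7 : v c * ‖xAt v z‖ ≤ √T * t * t :=
    mul_le_mul h5 ((norm_xAt_le_size v z).trans ht) (norm_nonneg _) (by positivity)
  linarith

/-- The denominator is the ratio of the vertical coordinates of `z` and `g z`, both of which are
controlled by `size`. -/
theorem denomAt_row_one_le (g : SL(2, K)) (v : InfinitePlace K) {z : Space K} {t : ℝ}
    (hz : size z ≤ t) (hgz : size (g • z) ≤ t) : denomAt (g 1 0) (g 1 1) v z ≤ t ^ 2 := by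
  have hP := denomAt_pos (row_ne_zero g 1) v z
  have hy := yAt_pos v z
  have h0 : 0 ≤ t := (size_nonneg z).trans hz
  have h1 := inv_yAt_le_size v (g • z)
  rw [yAt_smul, inv_div] at h1
  have h2 := (yAt_le_size v z).trans hz
  calc denomAt (g 1 0) (g 1 1) v z = denomAt (g 1 0) (g 1 1) v z / yAt v z * yAt v z := by
        field_simp
    _ ≤ t * t := mul_le_mul (h1.trans hgz) h2 hy.le h0
    _ = t ^ 2 := by ring

theorem denomAt_row_zero_le (g : SL(2, K)) (v : InfinitePlace K) {z : Space K} {t : ℝ}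
    (hz : size z ≤ t) (hgz : size (g • z) ≤ t) :
    denomAt (g 0 0) (g 0 1) v z ≤ 2 * t ^ 4 := by
  -- The cocycle relation for the row `(1, 0)` reads `|a z + b|² = |g z|² |c z + d|²`.
  have h := denomAt_smul 1 0 g v z
  simp only [one_mul, zero_mul, add_zero] at h
  rw [← h]
  have h0 : 0 ≤ t := (size_nonneg z).trans hz
  have h1 : denomAt 1 0 v (g • z) ≤ 2 * t ^ 2 := by
    have h2 := pow_le_pow_left₀ (norm_nonneg _) ((norm_xAt_le_size v (g • z)).trans hgz) 2
    have h3 := pow_le_pow_left₀ (yAt_pos v _).le ((yAt_le_size v (g • z)).trans hgz) 2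
    simp only [denomAt, map_one, one_mul, map_zero, add_zero, Complex.normSq_eq_norm_sq, norm_one,
      one_pow]
    linarith
  calc _ ≤ 2 * t ^ 2 * t ^ 2 := mul_le_mul h1 (denomAt_row_one_le g v hz hgz)
        (denomAt_pos (row_ne_zero g 1) v z).le (by positivity)
    _ = 2 * t ^ 4 := by ring

/-- The entries are algebraic integers whose conjugates are all bounded in terms of `t`, and there
are only finitely many such numbers. The factor `1 + t + t²` in `B` covers both entries of a row. -/
theorem finite_integral_smul (t : ℝ) : {g : SL(2, K) | (∀ i j, IsIntegral ℤ (g i j)) ∧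
    ∃ z : Space K, size z ≤ t ∧ size (g • z) ≤ t}.Finite := by
  let B := √(2 * t ^ 4 + t ^ 2) * (1 + t + t ^ 2)
  have hS : {x : K | IsIntegral ℤ x ∧ ∀ φ : K →+* ℂ, ‖φ x‖ ≤ B}.Finite :=
    Embeddings.finite_of_norm_le K ℂ B
  have hfin := (Set.Finite.pi' fun _ : Fin 2 ↦ Set.Finite.pi' fun _ : Fin 2 ↦ hS)
  refine Set.Finite.of_finite_image (f := fun g : SL(2, K) ↦ (g.1 : Fin 2 → Fin 2 → K))
    (hfin.subset ?_) (Subtype.val_injective.injOn)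
  rintro _ ⟨g, ⟨hg, z, hz, hgz⟩, rfl⟩ i j
  refine ⟨hg i j, fun φ ↦ ?_⟩
  have h0 : 0 ≤ t := (size_nonneg z).trans hz
  have hrow : ∀ i, denomAt (g i 0) (g i 1) (mk φ) z ≤ 2 * t ^ 4 + t ^ 2 := fun i ↦ by
    fin_cases i
    · exact (denomAt_row_zero_le g _ hz hgz).trans (by linarith [sq_nonneg t])
    · exact (denomAt_row_one_le g _ hz hgz).trans (by nlinarith [sq_nonneg (t ^ 2)])
  have hb := norm_le_of_denomAt_le (hrow i) hz
  rw [← InfinitePlace.apply φ]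
  have hs := Real.sqrt_nonneg (2 * t ^ 4 + t ^ 2)
  fin_cases j
  · exact hb.1.trans (mul_le_mul_of_nonneg_left (by nlinarith) hs)
  · exact hb.2.trans (mul_le_mul_of_nonneg_left (by nlinarith) hs)

/-- Proper discontinuity. It yields the orbit representatives and also bounds the overlap of
translates in the proof of convergence. -/
theorem finite_smul (t : ℝ) :
    {γ : modularGroup K | ∃ z : Space K, size z ≤ t ∧ size (γ • z) ≤ t}.Finite := by
  have h := (finite_integral_smul (K := K) t).image (fun g : SL(2, K) ↦ (g : PSL(2, K)))
  refine Set.Finite.of_finite_image (f := Subtype.val) (h.subset ?_) Subtype.val_injective.injOn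
  rintro _ ⟨⟨_, g, rfl⟩, ⟨z, hz, hgz⟩, rfl⟩
  refine ⟨Matrix.SpecialLinearGroup.map (algebraMap (𝓞 K) K) g, ⟨fun i j ↦ ?_, z, hz, hgz⟩, rfl⟩
  simpa using RingOfIntegers.isIntegral_coe (g i j)

end Space

instance : Countable (𝓞 K) := by
  have := Module.Free.chooseBasis ℤ (𝓞 K)
  exact this.equivFun.toEquiv.countable_iff.2 inferInstance

instance : Countable (modularGroup K) := by
  have : Countable SL(2, 𝓞 K) := by
    have : Countable (Matrix (Fin 2) (Fin 2) (𝓞 K)) :=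
      inferInstanceAs (Countable (Fin 2 → Fin 2 → 𝓞 K))
    exact Subtype.val_injective.countable
  exact (MonoidHom.rangeRestrict_surjective _).countable

instance : ContinuousConstSMul (modularGroup K) (Space K) where
  continuous_const_smul γ := continuous_const_smul γ.1

theorem exists_measurableSet_representatives_modularGroup : ∃ F : Set (Space K), MeasurableSet F ∧
    (∀ z, ∃ γ : modularGroup K, γ • z ∈ F) ∧
      ∀ z ∈ F, ∀ γ : modularGroup K, γ • z ∈ F → γ • z = z := by
  refine exists_measurableSet_representatives (n := fun z : Space K ↦ ⌈Space.size z⌉₊)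
    (Space.continuous_size.measurable.nat_ceil) fun z t ↦ ?_
  refine (Space.finite_smul (K := K) (max t (Space.size z))).subset fun γ hγ ↦
    ⟨z, le_max_right _ _, le_max_of_le_left (Nat.ceil_le.1 hγ)⟩

variable (K) in
/-- A measurable set of representatives of the orbits of the Hilbert modular group. -/
def fundamentalSet : Set (Space K) :=
  (exists_measurableSet_representatives_modularGroup (K := K)).choose

theorem measurableSet_fundamentalSet : MeasurableSet (fundamentalSet K) :=
  (exists_measurableSet_representatives_modularGroup (K := K)).choose_spec.1

theorem exists_smul_mem_fundamentalSet (z : Space K) :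
    ∃ γ : modularGroup K, γ • z ∈ fundamentalSet K :=
  (exists_measurableSet_representatives_modularGroup (K := K)).choose_spec.2.1 z

theorem smul_eq_of_mem_fundamentalSet {z : Space K} (hz : z ∈ fundamentalSet K)
    {γ : modularGroup K} (hγ : γ • z ∈ fundamentalSet K) : γ • z = z :=
  (exists_measurableSet_representatives_modularGroup (K := K)).choose_spec.2.2 z hz γ hγ

theorem toOrbifold_eq_iff {z w : Space K} :
    toOrbifold z = toOrbifold w ↔ ∃ γ : modularGroup K, γ • w = z := by
  rw [toOrbifold, toOrbifold, Quotient.eq]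
  rfl

theorem toOrbifold_smul (γ : modularGroup K) (z : Space K) : toOrbifold (γ • z) = toOrbifold z :=
  toOrbifold_eq_iff.2 ⟨γ, rfl⟩

theorem measurable_toOrbifold : Measurable (toOrbifold : Space K → Orbifold K) :=
  measurable_quotient_mk''

/-- A point common to the set and a translate by `γ ≠ 1` is fixed by `γ`, so the overlaps are null.
-/
theorem isFundamentalDomain_fundamentalSet :
    IsFundamentalDomain (modularGroup K) (fundamentalSet K) volume := by
  refine .mk'' measurableSet_fundamentalSet.nullMeasurableSet
    (Filter.Eventually.of_forall exists_smul_mem_fundamentalSet) (fun γ hγ ↦ ?_)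
    fun γ ↦ (measurePreserving_smul γ volume).quasiMeasurePreserving
  refine measure_mono_null (fun z hz ↦ ?_)
    (Space.volume_fixedPoints_eq_zero (γ := (γ : PSL(2, K))⁻¹) (by simpa using hγ))
  obtain ⟨⟨w, hw, rfl⟩, hz⟩ := hz
  have hz : γ • w ∈ fundamentalSet K := hz
  have := smul_eq_of_mem_fundamentalSet hw hz
  change (γ⁻¹ : modularGroup K) • (γ • w) = γ • w
  rw [this, inv_smul_eq_iff, this]

/-- A measurable set `F` that injects into the quotient is cut into countably many pieces, each
carried into `fundamentalSet K` by one group element. The moved pieces remain disjoint, so by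
invariance `F` contributes no more than the fundamental set, which is itself one of the competitors.
-/
theorem orbifoldVolume_eq : orbifoldVolume K =
    ((volume : Measure (Space K)).restrict (fundamentalSet K)).map toOrbifold := by
  refine le_antisymm (iSup_le fun F ↦ iSup₂_le fun hF hinj ↦ ?_) ?_
  · refine Measure.le_iff.2 fun B hB ↦ ?_
    have hB' := measurable_toOrbifold hB
    rw [Measure.map_apply measurable_toOrbifold hB, Measure.map_apply measurable_toOrbifold hB,
      Measure.restrict_apply hB', Measure.restrict_apply hB']
    set P : Set (Space K) := toOrbifold ⁻¹' B
    obtain ⟨e, he⟩ := exists_surjective_nat (modularGroup K)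
    let S : ℕ → Set (Space K) := fun i ↦ (P ∩ F) ∩ {z | e i • z ∈ fundamentalSet K}
    have hS : ∀ i, MeasurableSet (S i) := fun i ↦
      (hB'.inter hF).inter (measurable_const_smul (e i) measurableSet_fundamentalSet)
    have hcover : P ∩ F = ⋃ i, disjointed S i := by
      rw [iUnion_disjointed, ← Set.inter_iUnion]
      refine (Set.inter_eq_left.2 fun z _ ↦ ?_).symm
      obtain ⟨γ, hγ⟩ := exists_smul_mem_fundamentalSet z
      obtain ⟨i, rfl⟩ := he γ
      exact Set.mem_iUnion.2 ⟨i, hγ⟩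
    have hD : ∀ i, MeasurableSet (disjointed S i) := fun i ↦ .disjointed hS i
    have hDS : ∀ i, disjointed S i ⊆ S i := disjointed_subset S
    calc volume (P ∩ F) ≤ ∑' i, volume (disjointed S i) := by
          rw [hcover]; exact measure_iUnion_le _
      _ = ∑' i, volume ((fun z ↦ (e i)⁻¹ • z) ⁻¹' disjointed S i) := by
          refine tsum_congr fun i ↦ ?_
          rw [measure_preimage_smul]
      _ = volume (⋃ i, (fun z ↦ (e i)⁻¹ • z) ⁻¹' disjointed S i) := by
          refine (measure_iUnion (fun i j hij ↦ ?_)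
            fun i ↦ measurable_const_smul _ (hD i)).symm
          refine Set.disjoint_left.2 fun z hzi hzj ↦ ?_
          -- Two points of `F` in one orbit are equal, so an overlap after moving would put one
          -- point into two disjoint pieces.
          have h : (e i)⁻¹ • z = (e j)⁻¹ • z := by
            refine hinj (hDS i hzi).1.2 (hDS j hzj).1.2 ?_
            rw [toOrbifold_smul, toOrbifold_smul]
          have hzj : (e j)⁻¹ • z ∈ disjointed S j := hzj
          rw [← h] at hzj
          exact Set.disjoint_left.1 (disjoint_disjointed S hij) hzi hzj
      _ ≤ volume (P ∩ fundamentalSet K) := by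
          refine measure_mono (Set.iUnion_subset fun i z hz ↦ ?_)
          have h := hDS i hz
          refine ⟨?_, by simpa using h.2⟩
          have h1 : toOrbifold ((e i)⁻¹ • z) ∈ B := h.1.1
          rwa [toOrbifold_smul] at h1
  · refine le_iSup_of_le (fundamentalSet K) (le_iSup₂_of_le measurableSet_fundamentalSet ?_ le_rfl)
    intro z hz w hw h
    obtain ⟨γ, rfl⟩ := toOrbifold_eq_iff.1 h
    exact smul_eq_of_mem_fundamentalSet hw hz

end HilbertModular

/-! ### Product measures and logarithmic coordinates. -/

namespace MeasureTheory

section Pi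

variable {ι : Type*} [Fintype ι] {X : ι → Type*} [∀ i, MeasurableSpace (X i)]
  (μ : ∀ i, Measure (X i)) [∀ i, SigmaFinite (μ i)]

/-- The free constant `c` makes the induction close: the integral over a new coordinate is absorbed
into it. -/
theorem lmarginal_const_mul_prod [DecidableEq ι] {f : ∀ i, X i → ENNReal}
    (hf : ∀ i, Measurable (f i)) (s : Finset ι) (c : ENNReal) (x : ∀ i, X i) :
    lmarginal μ s (fun x ↦ c * ∏ i ∈ s, f i (x i)) x = c * ∏ i ∈ s, ∫⁻ y, f i y ∂μ i := by
  induction s using Finset.induction_on generalizing c with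
  | empty => simp
  | insert i s hi ih =>
    rw [lmarginal_insert' _ _ hi, Finset.prod_insert hi, ← mul_assoc, ← ih]
    · congr 1
      funext x
      rw [← lintegral_const_mul _ (hf i), ← lintegral_mul_const _ ((hf i).const_mul _)]
      refine lintegral_congr fun y ↦ ?_
      rw [Finset.prod_insert hi, Function.update_self, ← mul_assoc]
      congr 1
      refine Finset.prod_congr rfl fun j hj ↦ ?_
      rw [Function.update_of_ne (by rintro rfl; exact hi hj)]
    · fun_prop

theorem lintegral_fintype_prod_eq_prod {f : ∀ i, X i → ENNReal} (hf : ∀ i, Measurable (f i)) :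
    ∫⁻ x, ∏ i, f i (x i) ∂Measure.pi μ = ∏ i, ∫⁻ y, f i y ∂μ i := by
  classical
  by_cases h : Nonempty (∀ i, X i)
  · obtain ⟨x⟩ := h
    have := lmarginal_const_mul_prod μ hf Finset.univ 1 x
    simp only [one_mul] at this
    rw [← this, lintegral_eq_lmarginal_univ x]
  · have h' := not_nonempty_iff.1 h
    obtain ⟨i, hi⟩ : ∃ i, IsEmpty (X i) := by
      by_contra! hne
      exact h ⟨fun i ↦ (hne i).some⟩
    rw [Finset.prod_eq_zero (Finset.mem_univ i)]
    · simp
    · simp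

theorem pi_withDensity {f : ∀ i, X i → ENNReal} (hf : ∀ i, Measurable (f i))
    [∀ i, SigmaFinite ((μ i).withDensity (f i))] :
    Measure.pi (fun i ↦ (μ i).withDensity (f i)) =
      (Measure.pi μ).withDensity fun x ↦ ∏ i, f i (x i) := by
  refine Measure.pi_eq fun s hs ↦ ?_
  rw [withDensity_apply _ (MeasurableSet.univ_pi hs), Measure.restrict_pi_pi,
    lintegral_fintype_prod_eq_prod _ hf]
  exact Finset.prod_congr rfl fun i _ ↦ (withDensity_apply _ (hs i)).symm

end Pi

/-- Exchanging the two inner factors of a product of four spaces preserves product measures. -/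
theorem measurePreserving_prodProdProdComm {α β γ δ : Type*} [MeasurableSpace α]
    [MeasurableSpace β] [MeasurableSpace γ] [MeasurableSpace δ] (μa : Measure α) (μb : Measure β)
    (μc : Measure γ) (μd : Measure δ) [SigmaFinite μa] [SigmaFinite μb] [SigmaFinite μc]
    [SigmaFinite μd] :
    MeasurePreserving (fun p : (α × β) × (γ × δ) ↦ ((p.1.1, p.2.1), (p.1.2, p.2.2)))
      ((μa.prod μb).prod (μc.prod μd)) ((μa.prod μc).prod (μb.prod μd)) := by
  have h1 := measurePreserving_prodAssoc μa μb (μc.prod μd)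
  have h2 := (measurePreserving_prodAssoc μb μc μd).symm
  have h3 : MeasurePreserving Prod.swap (μb.prod μc) (μc.prod μb) :=
    Measure.measurePreserving_swap
  have h4 := measurePreserving_prodAssoc μc μb μd
  have h5 := (measurePreserving_prodAssoc μa μc (μb.prod μd)).symm
  exact h5.comp ((MeasurePreserving.prod (.id μa)
    (h4.comp ((h3.prod (.id μd)).comp h2))).comp h1)

/-- The push-forward of `exp (-k t) dt` under `exp` is `1 / y ^ (k + 1) dy` on the half-line. -/
theorem map_exp_withDensity (k : ℕ) :
    ((volume : Measure ℝ).withDensity fun t ↦ ENNReal.ofReal (Real.exp (-(k * t)))).map Real.exp =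
      (volume.restrict (Set.Ioi 0)).withDensity fun y ↦ ENNReal.ofReal (1 / y ^ (k + 1)) := by
  refine Measure.ext fun s hs ↦ ?_
  have hs' := Real.measurable_exp hs
  have himg : Real.exp '' (Real.exp ⁻¹' s) = s ∩ Set.Ioi 0 := by
    rw [Set.image_preimage_eq_inter_range, Real.range_exp]
  rw [Measure.map_apply Real.measurable_exp hs, withDensity_apply _ hs', withDensity_apply _ hs,
    Measure.restrict_restrict hs, ← himg,
    lintegral_image_eq_lintegral_abs_deriv_mul hs'
      (fun t _ ↦ (Real.hasDerivAt_exp t).hasDerivWithinAt) Real.exp_injective.injOn]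
  refine lintegral_congr fun t ↦ ?_
  rw [← ENNReal.ofReal_mul (abs_nonneg _), abs_of_pos (Real.exp_pos t), Real.exp_neg,
    ← Real.exp_nat_mul,
    show ((k + 1 : ℕ) : ℝ) * t = k * t + t by push_cast; ring, Real.exp_add]
  congr 1
  have := Real.exp_pos t
  field_simp

/-- Logarithmic coordinates on a half-space. -/
theorem eq_map_of_apply_eq_lintegral {E H : Type*} [MeasurableSpace E] [MeasurableSpace H]
    {μ : Measure E} [SigmaFinite μ] {ν : Measure H} {c : H → E × ℝ} (hc : MeasurableEmbedding c)
    (hpos : ∀ z, 0 < (c z).2) (k : ℕ)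
    (hν : ∀ s, MeasurableSet s → ν s =
      ∫⁻ p in c '' s, ENNReal.ofReal (1 / p.2 ^ (k + 1)) ∂μ.prod volume)
    {φ : E × ℝ → H} (hφ : ∀ p, c (φ p) = (p.1, Real.exp p.2)) :
    MeasurePreserving φ (μ.prod ((volume : Measure ℝ).withDensity
      fun t ↦ ENNReal.ofReal (Real.exp (-(k * t))))) ν := by
  have hm : Measurable φ := by
    refine hc.measurable_comp_iff.1 ?_
    simp only [Function.comp_def, hφ]
    fun_prop
  refine ⟨hm, Measure.ext fun s hs ↦ ?_⟩
  set w := (volume : Measure ℝ).withDensity fun t ↦ ENNReal.ofReal (Real.exp (-(k * t)))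
  have hsf : SigmaFinite w := SigmaFinite.withDensity_ofReal _
  have hcs := hc.measurableSet_image.2 hs
  have hpre : φ ⁻¹' s = Prod.map id Real.exp ⁻¹' (c '' s) := by
    ext p
    simp only [Set.mem_preimage, Prod.map, id, ← hφ, hc.injective.mem_set_image]
  have hf : Measurable fun y : ℝ ↦ ENNReal.ofReal (1 / y ^ (k + 1)) := by fun_prop
  have hsub : c '' s ⊆ Set.univ ×ˢ Set.Ioi 0 := by
    rintro _ ⟨z, -, rfl⟩
    exact ⟨trivial, hpos z⟩
  have : SigmaFinite ((volume.restrict (Set.Ioi 0)).withDensity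
      fun y : ℝ ↦ ENNReal.ofReal (1 / y ^ (k + 1))) := SigmaFinite.withDensity_ofReal _
  rw [Measure.map_apply hm hs, hpre, ← Measure.map_apply (by fun_prop) hcs,
    ← Measure.map_prod_map _ _ measurable_id Real.measurable_exp, map_exp_withDensity,
    Measure.map_id, prod_withDensity_right hf, withDensity_apply _ hcs, hν s hs]
  have hr : μ.prod (volume.restrict (Set.Ioi (0 : ℝ))) =
      (μ.prod volume).restrict (Set.univ ×ˢ Set.Ioi 0) := by
    rw [← Measure.prod_restrict, Measure.restrict_univ]
  rw [hr, Measure.restrict_restrict hcs, Set.inter_eq_self_of_subset_left hsub]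

/-- The coordinate map of a basis multiplies the volume by that of the fundamental domain. -/
theorem map_basis_equivFun_symm {ι E : Type*} [Fintype ι] [NormedAddCommGroup E] [NormedSpace ℝ E]
    [FiniteDimensional ℝ E] [MeasurableSpace E] [BorelSpace E] (μ : Measure E)
    [μ.IsAddHaarMeasure] (b : Module.Basis ι ℝ E) :
    μ = μ (ZSpan.fundamentalDomain b) •
      (volume : Measure (ι → ℝ)).map (b.equivFun.symm : (ι → ℝ) → E) := by
  let e : (ι → ℝ) ≃L[ℝ] E := b.equivFun.symm.toContinuousLinearEquiv
  have he : (e : (ι → ℝ) → E) = b.equivFun.symm := rfl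
  have : ((volume : Measure (ι → ℝ)).map e).IsAddHaarMeasure := e.isAddHaarMeasure_map volume
  -- Haar measures are proportional. The factor is read off on the fundamental domain, which
  -- corresponds to the unit cube and so has image measure one.
  have h := Measure.isAddLeftInvariant_eq_smul μ ((volume : Measure (ι → ℝ)).map e)
  have hF : ((volume : Measure (ι → ℝ)).map e) (ZSpan.fundamentalDomain b) = 1 := by
    rw [Measure.map_apply e.continuous.measurable (ZSpan.fundamentalDomain_measurableSet b)]
    have : e ⁻¹' ZSpan.fundamentalDomain b = Set.univ.pi fun _ ↦ Set.Ico (0 : ℝ) 1 := by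
      ext x
      simp only [Set.mem_preimage, ZSpan.mem_fundamentalDomain, Set.mem_univ_pi, he]
      refine forall_congr' fun i ↦ ?_
      rw [← b.equivFun_apply, LinearEquiv.apply_symm_apply]
    rw [this, Real.volume_pi_Ico]
    simp
  rw [← he]
  have h' := congrArg (fun ν ↦ ν (ZSpan.fundamentalDomain b)) h
  simp only [Measure.smul_apply, hF] at h'
  rw [h', smul_assoc, one_smul]
  exact h

end MeasureTheory

namespace MeasureTheory

/-- Restricting functions to a subtype and to its complement preserves product measures. -/
theorem measurePreserving_pi_restrict_prod {ι : Type*} [Fintype ι] {p q : ι → Prop}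
    [Fintype {i // p i}] [Fintype {i // q i}] (hpq : ∀ i, ¬p i ↔ q i) (μ : ι → Measure ℝ)
    [∀ i, SigmaFinite (μ i)] :
    MeasurePreserving (fun (t : ι → ℝ) ↦
        ((fun i ↦ t i.1, fun i ↦ t i.1) : ({i // p i} → ℝ) × ({i // q i} → ℝ)))
      (Measure.pi μ)
      ((Measure.pi fun i : {i // p i} ↦ μ i.1).prod (Measure.pi fun i : {i // q i} ↦ μ i.1)) := by
  classical
  let S : ({i // p i} → ℝ) × ({i // q i} → ℝ) → ι → ℝ := fun t i ↦
    if h : p i then t.1 ⟨i, h⟩ else t.2 ⟨i, (hpq i).1 h⟩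
  have hS : Measurable S := by
    refine measurable_pi_lambda _ fun i ↦ ?_
    by_cases h : p i
    · simp only [S, h, dite_true]; fun_prop
    · simp only [S, h, dite_false]; fun_prop
  have hmap : Measure.pi μ = ((Measure.pi fun i : {i // p i} ↦ μ i.1).prod
      (Measure.pi fun i : {i // q i} ↦ μ i.1)).map S := by
    refine Measure.pi_eq (μ := μ) fun s hs ↦ ?_
    rw [Measure.map_apply hS (MeasurableSet.univ_pi hs)]
    have : S ⁻¹' Set.univ.pi s = (Set.univ.pi fun i : {i // p i} ↦ s i.1) ×ˢ
        (Set.univ.pi fun i : {i // q i} ↦ s i.1) := by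
      ext t
      simp only [Set.mem_preimage, Set.mem_univ_pi, Set.mem_prod, S]
      refine ⟨fun h ↦ ⟨fun i ↦ by simpa [i.2] using h i.1,
        fun i ↦ by simpa [(hpq _).2 i.2] using h i.1⟩, fun h i ↦ ?_⟩
      by_cases hi : p i
      · simpa [hi] using h.1 ⟨i, hi⟩
      · simpa [hi] using h.2 ⟨i, (hpq i).1 hi⟩
    rw [this, Measure.prod_prod, Measure.pi_pi, Measure.pi_pi,
      ← Fintype.prod_subtype_mul_prod_subtype p fun i ↦ μ i (s i)]
    congr 1
    · exact Finset.prod_congr (by ext; simp) fun _ _ ↦ rfl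
    · exact Fintype.prod_equiv (Equiv.subtypeEquivRight fun i ↦ (hpq i).symm) _ _ fun _ ↦ rfl
  refine ⟨by fun_prop, ?_⟩
  rw [hmap, Measure.map_map (by fun_prop) hS]
  convert! Measure.map_id
  ext t i
  · simp [S, i.2]
  · simp [S, (hpq _).2 i.2]

/-- Separating one coordinate preserves the volume. -/
theorem volume_preserving_pi_of_equiv {ι κ : Type*} [Fintype ι] [Fintype κ] [DecidableEq ι] (i₀ : ι)
    (e : {i // i ≠ i₀} ≃ κ) :
    MeasurePreserving (fun (p : (κ → ℝ) × ℝ) (i : ι) ↦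
      if h : i = i₀ then p.2 else p.1 (e ⟨i, h⟩)) := by
  have hm : Measurable fun (p : (κ → ℝ) × ℝ) (i : ι) ↦
      if h : i = i₀ then p.2 else p.1 (e ⟨i, h⟩) := by
    refine measurable_pi_lambda _ fun i ↦ ?_
    by_cases h : i = i₀
    · simp only [h, dite_true]; fun_prop
    · simp only [h, dite_false]; fun_prop
  refine ⟨hm, (Measure.pi_eq fun s hs ↦ ?_).symm⟩
  rw [Measure.map_apply hm (MeasurableSet.univ_pi hs)]
  have : (fun (p : (κ → ℝ) × ℝ) (i : ι) ↦ if h : i = i₀ then p.2 else p.1 (e ⟨i, h⟩)) ⁻¹'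
      Set.univ.pi s = (Set.univ.pi fun k ↦ s (e.symm k)) ×ˢ s i₀ := by
    ext p
    simp only [Set.mem_preimage, Set.mem_univ_pi, Set.mem_prod]
    refine ⟨fun h ↦ ⟨fun k ↦ by simpa [(e.symm k).2] using h (e.symm k).1, by simpa using h i₀⟩,
      fun h i ↦ ?_⟩
    by_cases hi : i = i₀
    · subst hi; simpa using h.2
    · simpa [hi] using h.1 (e ⟨i, hi⟩)
  rw [this, Measure.volume_eq_prod, Measure.prod_prod, volume_pi, Measure.pi_pi,
    ← Fintype.prod_subtype_mul_prod_subtype (fun i ↦ i ≠ i₀) fun i ↦ volume (s i)]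
  congr 1
  · exact Fintype.prod_equiv e.symm _ _ fun _ ↦ rfl
  · have : Unique {i // ¬i ≠ i₀} := ⟨⟨⟨i₀, by simp⟩⟩, fun i ↦ Subtype.ext (by simpa using i.2)⟩
    rw [Fintype.prod_unique,
      show ((default : {i // ¬i ≠ i₀}) : ι) = i₀ from not_not.1 (default : {i // ¬i ≠ i₀}).2]

end MeasureTheory

namespace UpperHalfPlane

/-- The real and imaginary parts of a point of the upper half-plane. -/
def toProd (z : ℍ) : ℝ × ℝ := Complex.measurableEquivRealProd z

theorem measurableEmbedding_toProd : MeasurableEmbedding toProd :=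
  Complex.measurableEquivRealProd.measurableEmbedding.comp measurableEmbedding_coe

theorem volume_apply (s : Set ℍ) :
    volume s = ∫⁻ p in toProd '' s, ENNReal.ofReal (1 / p.2 ^ (1 + 1)) := by
  rw [volume_eq_lintegral]
  have h := Complex.volume_preserving_equiv_real_prod.setLIntegral_comp_preimage_emb
    Complex.measurableEquivRealProd.measurableEmbedding
    (fun p : ℝ × ℝ ↦ ENNReal.ofReal (1 / p.2 ^ (1 + 1))) (toProd '' s)
  rw [← h]
  have : Complex.measurableEquivRealProd ⁻¹' (toProd '' s) = ((↑) : ℍ → ℂ) '' s := by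
    change _ ⁻¹' ((fun z : ℍ ↦ Complex.measurableEquivRealProd z) '' s) = _
    rw [← Set.image_image, Set.preimage_image_eq _ Complex.measurableEquivRealProd.injective]
  rw [this]
  refine lintegral_congr fun z ↦ ?_
  rw [← ENNReal.ofReal_coe_nnreal]
  congr 1
  simp [Complex.measurableEquivRealProd_apply]

/-- The point `x + i exp t`. -/
def ofLog (p : ℝ × ℝ) : ℍ := ⟨⟨p.1, Real.exp p.2⟩, Real.exp_pos _⟩

theorem measurePreserving_ofLog : MeasurePreserving ofLog
    (volume.prod ((volume : Measure ℝ).withDensity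
      fun t ↦ ENNReal.ofReal (Real.exp (-((1 : ℕ) * t))))) volume :=
  eq_map_of_apply_eq_lintegral measurableEmbedding_toProd (fun z ↦ z.im_pos) 1
    (fun s _ ↦ volume_apply s) fun _ ↦ rfl

end UpperHalfPlane

namespace UpperHalfSpace

/-- The point `x + exp t j`. -/
def ofLog (p : ℂ × ℝ) : UpperHalfSpace := ⟨(p.1, Real.exp p.2), Real.exp_pos _⟩

theorem measurePreserving_ofLog : MeasurePreserving ofLog
    (volume.prod ((volume : Measure ℝ).withDensity
      fun t ↦ ENNReal.ofReal (Real.exp (-((2 : ℕ) * t))))) volume :=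
  eq_map_of_apply_eq_lintegral isOpenEmbedding_toProd.measurableEmbedding (fun z ↦ z.y_pos) 2
    volume_apply fun _ ↦ rfl

end UpperHalfSpace

namespace HilbertModular.Space

variable {K : Type*} [Field K] [NumberField K]

open mixedEmbedding

/-- The point with horizontal coordinates `x` and vertical coordinates `exp t`. -/
def ofLog (p : mixedSpace K × (InfinitePlace K → ℝ)) : Space K :=
  (fun v ↦ UpperHalfPlane.ofLog (p.1.1 v, p.2 v.1),
    fun v ↦ UpperHalfSpace.ofLog (p.1.2 v, p.2 v.1))

-- With `y = e^t` the densities `dy / y²` and `dy / y³` become `e^(-t) dt` and `e^(-2t) dt`, so the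
-- exponent at each place is its multiplicity. The rest regroups factors: horizontal coordinates on
-- one side, logarithms over all places on the other.
open scoped Classical in
theorem measurePreserving_ofLog : MeasurePreserving (ofLog (K := K))
    (volume.prod ((volume : Measure (InfinitePlace K → ℝ)).withDensity
      fun t ↦ ENNReal.ofReal (Real.exp (-∑ v, v.mult * t v)))) volume := by
  let w : InfinitePlace K → Measure ℝ := fun v ↦ (volume : Measure ℝ).withDensity
    fun t ↦ ENNReal.ofReal (Real.exp (-(v.mult * t)))
  have hsf : ∀ v, SigmaFinite (w v) := fun v ↦ SigmaFinite.withDensity_ofReal _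
  have hpi : (volume : Measure (InfinitePlace K → ℝ)).withDensity
      (fun t ↦ ENNReal.ofReal (Real.exp (-∑ v, v.mult * t v))) = Measure.pi w := by
    rw [pi_withDensity _ fun v ↦ by fun_prop]
    congr 1
    funext t
    rw [← ENNReal.ofReal_prod_of_nonneg fun v _ ↦ (Real.exp_pos _).le, ← Real.exp_sum,
      Finset.sum_neg_distrib]
  have hR := measurePreserving_pi (ι := {v : InfinitePlace K // v.IsReal})
    (fun v ↦ (volume : Measure ℝ).prod (w v.1)) (fun _ ↦ (volume : Measure ℍ))
    (f := fun _ ↦ UpperHalfPlane.ofLog) fun v ↦ by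
      simpa [w, mult_isReal] using UpperHalfPlane.measurePreserving_ofLog
  have hC := measurePreserving_pi (ι := {v : InfinitePlace K // v.IsComplex})
    (fun v ↦ (volume : Measure ℂ).prod (w v.1)) (fun _ ↦ (volume : Measure UpperHalfSpace))
    (f := fun _ ↦ UpperHalfSpace.ofLog) fun v ↦ by
      simpa [w, mult_isComplex] using UpperHalfSpace.measurePreserving_ofLog
  have hR' := hR.comp (measurePreserving_arrowProdEquivProdArrow ℝ ℝ
    {v : InfinitePlace K // v.IsReal} (fun _ ↦ volume) fun v ↦ w v.1).symm
  have hC' := hC.comp (measurePreserving_arrowProdEquivProdArrow ℂ ℝ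
    {v : InfinitePlace K // v.IsComplex} (fun _ ↦ volume) fun v ↦ w v.1).symm
  have hU := measurePreserving_pi_restrict_prod
    (p := fun v : InfinitePlace K ↦ v.IsReal)
    (q := fun v ↦ v.IsComplex) (fun v ↦ not_isReal_iff_isComplex) w
  rw [hpi]
  exact ((hR'.prod hC').comp (measurePreserving_prodProdProdComm _ _ _ _)).comp
    ((MeasurePreserving.id _).prod hU)

end HilbertModular.Space

/-! ### The Jacobian of the coordinates at the cusp. -/

namespace HilbertModular

variable {K : Type*} [Field K] [NumberField K]

open mixedEmbedding Units

theorem idealOf_ne_zero (A : SL(2, K)) : idealOf (A 0 0) (A 1 0) ≠ 0 := by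
  intro h
  have := absNorm_idealOf_pos A
  simp [h] at this

open scoped Classical in
/-- The volume of the mixed space in the coordinates of a `ℤ`-basis of a fractional ideal. -/
theorem volume_mixedSpace_eq_smul_map (I : (FractionalIdeal (𝓞 K)⁰ K)ˣ) {ι : Type*} [Fintype ι]
    (α : Module.Basis ι ℤ (I : FractionalIdeal (𝓞 K)⁰ K)) :
    (volume : Measure (mixedSpace K)) = ENNReal.ofReal
      (FractionalIdeal.absNorm (I : FractionalIdeal (𝓞 K)⁰ K) * 2⁻¹ ^ nrComplexPlaces K *
        √|discr K|) •
      (volume : Measure (ι → ℝ)).map fun X ↦ ∑ j, X j • mixedEmbedding K (α j : K) := by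
  let φ := (mixedEmbedding K).toIntAlgHom.toLinearMap ∘ₗ
    ((I : Submodule (𝓞 K) K).subtype.restrictScalars ℤ)
  have hφ : Function.Injective φ :=
    (mixedEmbedding_injective K).comp Subtype.val_injective
  let b : Module.Basis ι ℤ (idealLattice K I) := α.map (LinearEquiv.ofInjective φ hφ)
  let b' := b.ofZLatticeBasis ℝ
  have hb' : ∀ j, b' j = mixedEmbedding K (α j : K) := fun j ↦
    Module.Basis.ofZLatticeBasis_apply ..
  have hX : (b'.equivFun.symm : (ι → ℝ) → mixedSpace K) =
      fun X ↦ ∑ j, X j • mixedEmbedding K (α j : K) := by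
    funext X
    simp [Module.Basis.equivFun_symm_apply, hb']
  have h := map_basis_equivFun_symm (volume : Measure (mixedSpace K)) b'
  rw [hX] at h
  rw [← covolume_idealLattice,
    ZLattice.covolume_eq_measure_fundamentalDomain _ _ (ZLattice.isAddFundamentalDomain b volume),
    measureReal_def, ENNReal.ofReal_toReal (ZSpan.fundamentalDomain_isBounded _).measure_lt_top.ne]
  exact h

/-- The ratio of the two is the index of the subgroup generated by the family and the roots of
unity, which is one here. -/
theorem regOfFamily_eq_regulator {ε : Fin (Units.rank K) → (𝓞 K)ˣ} (hε : IsFundamentalSystem ε) :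
    regOfFamily ε = regulator K := by
  have h : Subgroup.closure (Set.range ε) ⊔ torsion K = ⊤ := by
    refine eq_top_iff.2 fun u _ ↦ ?_
    obtain ⟨p, hp, -⟩ := hε u
    rw [hp, mul_comm]
    refine Subgroup.mul_mem_sup (Subgroup.prod_mem _ fun k _ ↦ ?_) p.1.2
    exact Subgroup.zpow_mem _ (Subgroup.subset_closure (Set.mem_range_self k)) _
  have := regOfFamily_div_regulator ε
  rw [h, Subgroup.index_top, Nat.cast_one, div_eq_one_iff_eq (regulator_ne_zero K)] at this
  exact this

open scoped Classical in
/-- The matrix expressing the logarithms of the vertical coordinates in terms of the exponents of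
the fundamental units and the logarithm of the height. -/
def logMatrix (ε : Fin (Units.rank K) → (𝓞 K)ˣ) : Matrix (InfinitePlace K) (InfinitePlace K) ℝ :=
  Matrix.of fun v i ↦ if h : i = dirichletUnitTheorem.w₀ then 1 / (Module.finrank ℚ K : ℝ)
    else 2 * Real.log (v (ε ((equivFinRank K).symm ⟨i, h⟩) : K))

-- Up to diagonal scaling and transposition this is the matrix with entries `m_v log |ε_k|_v` and
-- one extra row of multiplicities `m_v`, whose determinant is `±n R`. Dividing by the `m_v` gives
-- `2^(-r₂)`, the exponents `2 Y_k` give `2^(r - 1)`, and the entries `1 / n` cancel `n`.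
open scoped Classical in
theorem abs_det_logMatrix {ε : Fin (Units.rank K) → (𝓞 K)ˣ} (hε : IsFundamentalSystem ε) :
    |(logMatrix ε).det| = 2 ^ Units.rank K * 2⁻¹ ^ nrComplexPlaces K * regulator K := by
  set w₀ : InfinitePlace K := dirichletUnitTheorem.w₀
  have hn : (Module.finrank ℚ K : ℝ) ≠ 0 := by exact_mod_cast Module.finrank_pos.ne'
  have h := finrank_mul_regOfFamily_eq_det ε w₀ (equivFinRank K).symm
  set M' := Matrix.of (fun i w : InfinitePlace K ↦
    if h : i = w₀ then (w.mult : ℝ) else w.mult * (w (ε ((equivFinRank K).symm ⟨i, h⟩))).log)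
  have hM : logMatrix ε = Matrix.diagonal (fun v : InfinitePlace K ↦ (v.mult : ℝ)⁻¹) * M'.transpose *
      Matrix.diagonal fun i ↦ if i = w₀ then 1 / (Module.finrank ℚ K : ℝ) else 2 := by
    ext v i
    have hv : (v.mult : ℝ) ≠ 0 := mult_coe_ne_zero
    rw [Matrix.mul_diagonal, Matrix.diagonal_mul]
    by_cases hi : i = w₀
    · have hi' : i = dirichletUnitTheorem.w₀ := hi
      simp only [logMatrix, M', Matrix.of_apply, Matrix.transpose_apply, dif_pos hi, dif_pos hi',
        if_pos hi]
      field_simp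
    · have hi' : ¬i = dirichletUnitTheorem.w₀ := hi
      simp only [logMatrix, M', Matrix.of_apply, Matrix.transpose_apply, dif_neg hi, dif_neg hi',
        if_neg hi]
      field_simp
  have h1 : ∏ v : InfinitePlace K, (v.mult : ℝ)⁻¹ = 2⁻¹ ^ nrComplexPlaces K := by
    rw [prod_eq_prod_mul_prod]
    simp [mult_isReal, mult_isComplex, nrComplexPlaces]
  have h2 : ∏ i : InfinitePlace K, (if i = w₀ then 1 / (Module.finrank ℚ K : ℝ) else 2) =
      1 / (Module.finrank ℚ K : ℝ) * 2 ^ Units.rank K := by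
    rw [← Finset.mul_prod_erase _ _ (Finset.mem_univ w₀), if_pos rfl]
    congr 1
    rw [Finset.prod_congr rfl fun i hi ↦ if_neg (Finset.ne_of_mem_erase hi), Finset.prod_const,
      Finset.card_erase_of_mem (Finset.mem_univ _), Finset.card_univ]
    rfl
  rw [hM, Matrix.det_mul, Matrix.det_mul, Matrix.det_diagonal, Matrix.det_diagonal,
    Matrix.det_transpose, h1, h2, abs_mul, abs_mul, ← h, regOfFamily_eq_regulator hε,
    abs_of_nonneg (by positivity), abs_of_nonneg (by positivity)]
  field_simp

theorem log_localY (A : SL(2, K)) (ε : Fin (Units.rank K) → (𝓞 K)ˣ) (Y : Fin (Units.rank K) → ℝ)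
    (τ : ℝ) (v : InfinitePlace K) :
    Real.log (localY A ε Y (Real.exp τ) v) =
      (τ - 2 * Real.log ((idealOf (A 0 0) (A 1 0)).absNorm : ℝ)) / Module.finrank ℚ K +
        ∑ k, 2 * Y k * Real.log (v (ε k : K)) := by
  have hN := absNorm_idealOf_pos A
  have hv : ∀ k, 0 < v (ε k : K) := fun k ↦ InfinitePlace.pos_iff.2 (Units.coe_ne_zero _)
  rw [localY, Real.log_mul (by positivity)
    (Finset.prod_pos fun k _ ↦ Real.rpow_pos_of_pos (hv k) _).ne', Real.log_rpow (by positivity),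
    Real.log_div (Real.exp_pos _).ne' (by positivity), Real.log_exp, Real.log_pow,
    Real.log_prod fun k _ ↦ (Real.rpow_pos_of_pos (hv k) _).ne']
  congr 1
  · push_cast; ring
  · exact Finset.sum_congr rfl fun k _ ↦ Real.log_rpow (hv k) _

/-- Units have norm `±1`, so their contributions sum to zero and only `log (q / N(𝔞)²)` is left.
This turns the hyperbolic density into a function of the height alone. -/
theorem sum_mult_mul_log_localY (A : SL(2, K)) (ε : Fin (Units.rank K) → (𝓞 K)ˣ)
    (Y : Fin (Units.rank K) → ℝ) (τ : ℝ) :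
    ∑ v : InfinitePlace K, v.mult * Real.log (localY A ε Y (Real.exp τ) v) =
      τ - 2 * Real.log ((idealOf (A 0 0) (A 1 0)).absNorm : ℝ) := by
  have hn : (Module.finrank ℚ K : ℝ) ≠ 0 := by exact_mod_cast Module.finrank_pos.ne'
  simp only [log_localY, mul_add, Finset.sum_add_distrib, ← Finset.sum_mul]
  rw [← Nat.cast_sum, sum_mult_eq, mul_div_cancel₀ _ hn]
  simp only [Finset.mul_sum]
  rw [Finset.sum_comm, Finset.sum_eq_zero, add_zero]
  intro k _
  have := sum_mult_mul_log (ε k)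
  calc _ = 2 * Y k * ∑ v : InfinitePlace K, v.mult * Real.log (v (ε k : K)) := by
        rw [Finset.mul_sum]; exact Finset.sum_congr rfl fun v _ ↦ by ring
    _ = 0 := by rw [this, mul_zero]

open scoped Classical in
/-- The exponents of the fundamental units and the logarithm of the height, indexed by places. -/
def placeCoord (p : (Fin (Units.rank K) → ℝ) × ℝ) (i : InfinitePlace K) : ℝ :=
  if h : i = dirichletUnitTheorem.w₀ then p.2 else p.1 ((equivFinRank K).symm ⟨i, h⟩)

-- The logarithms depend affinely on `(Y, τ)`. The distinguished place `w₀`, which indexes no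
-- fundamental unit, provides the slot for `τ`, so the linear part is a square matrix.
open scoped Classical in
theorem log_localY_eq_comp (A : SL(2, K)) (ε : Fin (Units.rank K) → (𝓞 K)ˣ) :
    (fun (p : (Fin (Units.rank K) → ℝ) × ℝ) (v : InfinitePlace K) ↦
      Real.log (localY A ε p.1 (Real.exp p.2) v)) =
      (fun t ↦ t + fun _ ↦ -(2 * Real.log ((idealOf (A 0 0) (A 1 0)).absNorm : ℝ)) /
        Module.finrank ℚ K) ∘ Matrix.toLin' (logMatrix ε) ∘ placeCoord := by
  funext p v
  simp only [Function.comp_apply, Pi.add_apply, Matrix.toLin'_apply, Matrix.mulVec, dotProduct,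
    placeCoord]
  rw [log_localY, ← Finset.add_sum_erase _ _ (Finset.mem_univ dirichletUnitTheorem.w₀)]
  simp only [logMatrix, Matrix.of_apply, dite_true]
  have hs : ∑ i ∈ Finset.univ.erase (dirichletUnitTheorem.w₀ : InfinitePlace K),
      ((if h : i = dirichletUnitTheorem.w₀ then 1 / (Module.finrank ℚ K : ℝ)
        else 2 * Real.log (v (ε ((equivFinRank K).symm ⟨i, h⟩) : K))) *
      (if h : i = dirichletUnitTheorem.w₀ then p.2 else p.1 ((equivFinRank K).symm ⟨i, h⟩))) =
      ∑ k, 2 * p.1 k * Real.log (v (ε k : K)) := by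
    rw [← (equivFinRank K).symm.sum_comp,
      Finset.sum_subtype (p := fun i ↦ i ≠ dirichletUnitTheorem.w₀) _ (by simp)]
    refine Finset.sum_congr rfl fun i _ ↦ ?_
    rw [dif_neg i.2, dif_neg i.2]
    ring
  rw [hs]
  ring

open scoped Classical in
theorem det_logMatrix_ne_zero {ε : Fin (Units.rank K) → (𝓞 K)ˣ} (hε : IsFundamentalSystem ε) :
    (logMatrix ε).det ≠ 0 := by
  have := regulator_pos K
  rw [← abs_pos, abs_det_logMatrix hε]
  positivity

theorem placeCoord_bijective : Function.Bijective (placeCoord (K := K)) := by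
  classical
  constructor
  · intro p q h
    refine Prod.ext (funext fun k ↦ ?_) ?_
    · have := congrFun h (equivFinRank K k)
      rw [placeCoord, placeCoord, dif_neg (equivFinRank K k).2, dif_neg (equivFinRank K k).2] at this
      simpa using this
    · simpa [placeCoord] using congrFun h dirichletUnitTheorem.w₀
  · intro t
    refine ⟨(fun k ↦ t (equivFinRank K k), t dirichletUnitTheorem.w₀), funext fun i ↦ ?_⟩
    by_cases h : i = dirichletUnitTheorem.w₀
    · simp [placeCoord, h]
    · simp [placeCoord, h]

theorem log_localY_bijective (A : SL(2, K)) {ε : Fin (Units.rank K) → (𝓞 K)ˣ}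
    (hε : IsFundamentalSystem ε) :
    Function.Bijective fun (p : (Fin (Units.rank K) → ℝ) × ℝ) (v : InfinitePlace K) ↦
      Real.log (localY A ε p.1 (Real.exp p.2) v) := by
  classical
  rw [log_localY_eq_comp]
  refine (AddGroup.addRight_bijective _).comp (Function.Bijective.comp ?_ placeCoord_bijective)
  have hu : IsUnit (logMatrix ε) :=
    (Matrix.isUnit_iff_isUnit_det _).2 (det_logMatrix_ne_zero hε).isUnit
  exact ⟨Matrix.mulVec_injective_iff_isUnit.2 hu, Matrix.mulVec_surjective_iff_isUnit.2 hu⟩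

theorem volume_eq_smul_map_log_localY (A : SL(2, K)) {ε : Fin (Units.rank K) → (𝓞 K)ˣ}
    (hε : IsFundamentalSystem ε) :
    Measurable (fun (p : (Fin (Units.rank K) → ℝ) × ℝ) (v : InfinitePlace K) ↦
        Real.log (localY A ε p.1 (Real.exp p.2) v)) ∧
    (volume : Measure (InfinitePlace K → ℝ)) =
      ENNReal.ofReal (2 ^ Units.rank K * 2⁻¹ ^ nrComplexPlaces K * regulator K) •
      (volume : Measure ((Fin (Units.rank K) → ℝ) × ℝ)).map
        fun p v ↦ Real.log (localY A ε p.1 (Real.exp p.2) v) := by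
  classical
  have hdet := det_logMatrix_ne_zero hε
  let b : InfinitePlace K → ℝ := fun _ ↦
    -(2 * Real.log ((idealOf (A 0 0) (A 1 0)).absNorm : ℝ)) / Module.finrank ℚ K
  have hQ : MeasurePreserving (placeCoord (K := K)) volume volume := volume_preserving_pi_of_equiv (dirichletUnitTheorem.w₀ : InfinitePlace K)
    (equivFinRank K).symm
  have hL := Real.map_matrix_volume_pi_eq_smul_volume_pi hdet
  have hLm : Measurable (Matrix.toLin' (logMatrix ε)) :=
    (LinearMap.continuous_of_finiteDimensional _).measurable
  have hb := measurePreserving_add_right (volume : Measure (InfinitePlace K → ℝ)) b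
  have hT : (fun (p : (Fin (Units.rank K) → ℝ) × ℝ) (v : InfinitePlace K) ↦
      Real.log (localY A ε p.1 (Real.exp p.2) v)) =
      (fun t ↦ t + b) ∘ Matrix.toLin' (logMatrix ε) ∘ placeCoord := log_localY_eq_comp A ε
  refine ⟨?_, ?_⟩
  · rw [hT]
    exact hb.measurable.comp (hLm.comp hQ.measurable)
  · rw [hT, ← Measure.map_map hb.measurable (hLm.comp hQ.measurable),
      ← Measure.map_map hLm hQ.measurable, hQ.map_eq, hL, Measure.map_smul, hb.map_eq, smul_smul,
      ← abs_det_logMatrix hε, ← ENNReal.ofReal_mul (abs_nonneg _), ← abs_mul, mul_inv_cancel₀ hdet]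
    simp

end HilbertModular

theorem MeasureTheory.map_withDensity_comp {α β : Type*} [MeasurableSpace α] [MeasurableSpace β]
    (μ : Measure α) {T : α → β} (hT : Measurable T) {d : β → ENNReal} (hd : Measurable d) :
    (μ.map T).withDensity d = (μ.withDensity (d ∘ T)).map T := by
  refine Measure.ext fun s hs ↦ ?_
  rw [withDensity_apply _ hs, Measure.map_apply hT hs, withDensity_apply _ (hT hs),
    setLIntegral_map hs hd hT]
  rfl

namespace HilbertModular

variable {K : Type*} [Field K] [NumberField K]

open mixedEmbedding Units

/-- The point `z⋆` with local coordinates `X`, `Y` and `q = exp τ`. -/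
def starMap (A : SL(2, K)) (α : Fin (Module.finrank ℚ K) → K) (ε : Fin (Units.rank K) → (𝓞 K)ˣ)
    (p : ((Fin (Module.finrank ℚ K) → ℝ) × (Fin (Units.rank K) → ℝ)) × ℝ) : Space K :=
  starPoint A α ε p.1.1 p.1.2 (Real.exp p.2) (Real.exp_pos p.2)

theorem starMap_eq_ofLog (A : SL(2, K)) (α : Fin (Module.finrank ℚ K) → K)
    (ε : Fin (Units.rank K) → (𝓞 K)ˣ)
    (p : ((Fin (Module.finrank ℚ K) → ℝ) × (Fin (Units.rank K) → ℝ)) × ℝ) :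
    starMap A α ε p = Space.ofLog (∑ j, p.1.1 j • mixedEmbedding K (α j),
      fun v ↦ Real.log (localY A ε p.1.2 (Real.exp p.2) v)) := by
  refine Prod.ext (funext fun v ↦ ?_) (funext fun v ↦ ?_)
  · refine UpperHalfPlane.ext (Complex.ext ?_ ?_)
    · simp [starMap, starPoint, Space.ofLog, UpperHalfPlane.ofLog, Prod.fst_sum]
    · exact (Real.exp_log (localY_pos A ε _ (Real.exp_pos _) _)).symm
  · refine UpperHalfSpace.ext' ?_ ?_
    · simp [starMap, starPoint, Space.ofLog, UpperHalfSpace.ofLog, Prod.snd_sum, UpperHalfSpace.x]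
    · exact (Real.exp_log (localY_pos A ε _ (Real.exp_pos _) _)).symm

variable (K) in
/-- The Jacobian of the local coordinates. -/
def jacobian : ℝ :=
  2 ^ Units.rank K * 2⁻¹ ^ nrComplexPlaces K * regulator K * (2⁻¹ ^ nrComplexPlaces K * √|discr K|)

theorem jacobian_pos : 0 < jacobian K := by
  have := regulator_pos K
  have : 0 < √|(discr K : ℝ)| := by
    rw [Real.sqrt_pos, abs_pos]
    exact_mod_cast discr_ne_zero K
  unfold jacobian
  positivity

/-- The measure `exp (-τ) dτ`. -/
def heightMeasure : Measure ℝ := volume.withDensity fun τ ↦ ENNReal.ofReal (Real.exp (-τ))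

instance : SigmaFinite heightMeasure := SigmaFinite.withDensity_ofReal _

/-- The `X` coordinates contribute the covolume `N(𝔞)⁻² 2^(-r₂) √D` of `𝔞⁻²`, and the coordinates
`(Y, τ)` the determinant of `logMatrix`. The density is `N(𝔞)² e^(-τ)`, so the powers of `N(𝔞)`
cancel. -/
theorem measurePreserving_starMap (A : SL(2, K))
    (α : Module.Basis (Fin (Module.finrank ℚ K)) ℤ
      (((idealOf (A 0 0) (A 1 0)) ^ 2)⁻¹ : FractionalIdeal (𝓞 K)⁰ K))
    {ε : Fin (Units.rank K) → (𝓞 K)ˣ} (hε : IsFundamentalSystem ε) :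
    MeasurePreserving (starMap A (fun j ↦ (α j : K)) ε)
      (ENNReal.ofReal (jacobian K) • volume.prod heightMeasure) volume := by
  classical
  have hN := absNorm_idealOf_pos A
  set N : ℝ := ((idealOf (A 0 0) (A 1 0)).absNorm : ℝ) with hNdef
  have hI : ((idealOf (A 0 0) (A 1 0)) ^ 2)⁻¹ ≠ 0 := inv_ne_zero (pow_ne_zero 2 (idealOf_ne_zero A))
  have hX := volume_mixedSpace_eq_smul_map (Units.mk0 _ hI) α
  obtain ⟨hTm, hT⟩ := volume_eq_smul_map_log_localY A hε
  set TX : (Fin (Module.finrank ℚ K) → ℝ) → mixedSpace K :=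
    fun X ↦ ∑ j, X j • mixedEmbedding K (α j : K) with hTX
  set TY : (Fin (Units.rank K) → ℝ) × ℝ → InfinitePlace K → ℝ :=
    fun p v ↦ Real.log (localY A ε p.1 (Real.exp p.2) v) with hTY
  have hTXm : Measurable TX := by
    refine Continuous.measurable ?_
    fun_prop
  set d : (InfinitePlace K → ℝ) → ENNReal :=
    fun t ↦ ENNReal.ofReal (Real.exp (-∑ v, v.mult * t v)) with hd
  have hdm : Measurable d := by fun_prop
  have hdT : d ∘ TY = ENNReal.ofReal (N ^ 2) •
      fun p : (Fin (Units.rank K) → ℝ) × ℝ ↦ ENNReal.ofReal (Real.exp (-p.2)) := by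
    funext p
    simp only [Function.comp_apply, hd, hTY, Pi.smul_apply, _root_.smul_eq_mul]
    rw [sum_mult_mul_log_localY, ← ENNReal.ofReal_mul (by positivity), neg_sub, sub_eq_add_neg,
      Real.exp_add, two_mul, Real.exp_add, Real.exp_log hN, sq]
  have hW : (volume : Measure (InfinitePlace K → ℝ)).withDensity d =
      ENNReal.ofReal (2 ^ Units.rank K * 2⁻¹ ^ nrComplexPlaces K * regulator K * N ^ 2) •
        (volume.prod heightMeasure).map TY := by
    have h1 : (volume : Measure ((Fin (Units.rank K) → ℝ) × ℝ)).withDensity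
        (fun p ↦ ENNReal.ofReal (Real.exp (-p.2))) = volume.prod heightMeasure :=
      (prod_withDensity_right (μ := volume) (ν := volume)
        (g := fun τ : ℝ ↦ ENNReal.ofReal (Real.exp (-τ))) (by fun_prop)).symm
    rw [hT, withDensity_smul_measure, map_withDensity_comp _ hTm hdm, hdT,
      withDensity_smul _ (by fun_prop), h1, Measure.map_smul, smul_smul,
      ← ENNReal.ofReal_mul (by have := regulator_pos K; positivity)]
  have hL := Space.measurePreserving_ofLog (K := K)
  have hassoc := measurePreserving_prodAssoc (volume : Measure (Fin (Module.finrank ℚ K) → ℝ))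
    (volume : Measure (Fin (Units.rank K) → ℝ)) heightMeasure
  have hcomp : starMap A (fun j ↦ (α j : K)) ε = Space.ofLog ∘ Prod.map TX TY ∘
      (MeasurableEquiv.prodAssoc : ((Fin (Module.finrank ℚ K) → ℝ) ×
        (Fin (Units.rank K) → ℝ)) × ℝ ≃ᵐ _) :=
    funext fun p ↦ starMap_eq_ofLog A _ ε p
  have hconst : jacobian K = (FractionalIdeal.absNorm ((Units.mk0 _ hI :
      (FractionalIdeal (𝓞 K)⁰ K)ˣ) : FractionalIdeal (𝓞 K)⁰ K) * 2⁻¹ ^ nrComplexPlaces K *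
        √|discr K|) * (2 ^ Units.rank K * 2⁻¹ ^ nrComplexPlaces K * regulator K * N ^ 2) := by
    have : (FractionalIdeal.absNorm ((Units.mk0 _ hI :
      (FractionalIdeal (𝓞 K)⁰ K)ˣ) : FractionalIdeal (𝓞 K)⁰ K) : ℝ) = (N ^ 2)⁻¹ := by
      rw [Units.val_mk0, map_inv₀, map_pow]
      push_cast
      rfl
    rw [this, jacobian]
    field_simp
  have hpm := hTXm.prodMap hTm
  refine ⟨?_, ?_⟩
  · rw [hcomp]
    exact hL.measurable.comp (hpm.comp hassoc.measurable)
  · rw [hcomp, ← Measure.map_map hL.measurable (hpm.comp hassoc.measurable),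
      ← Measure.map_map hpm hassoc.measurable]
    conv_rhs => rw [← hL.map_eq]
    congr 1
    rw [Measure.map_smul, Measure.map_smul]
    change _ • Measure.map _ (Measure.map _ ((volume.prod volume).prod heightMeasure)) = _
    rw [hassoc.map_eq, ← Measure.map_prod_map _ _ hTXm hTm, hW, hX, Measure.prod_smul_left,
      Measure.prod_smul_right, smul_smul, hconst,
      ENNReal.ofReal_mul (mul_nonneg (mul_nonneg
        (Rat.cast_nonneg.2 (FractionalIdeal.absNorm_nonneg _)) (by positivity)) (by positivity))]
    rfl

end HilbertModular

/-! ### The stabilizer of the cusp. -/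

namespace HilbertModular

variable {K : Type*} [Field K] [NumberField K]

/-- The matrix of `z ↦ u ^ 2 z + b`. -/
def upperMatrix (u : (𝓞 K)ˣ) (b : K) : SL(2, K) :=
  ⟨!![(u : K), (u : K)⁻¹ * b; 0, (u : K)⁻¹], by
    rw [Matrix.det_fin_two_of, mul_zero, sub_zero, mul_inv_cancel₀ (Units.coe_ne_zero u)]⟩

theorem upperMatrix_neg (u : (𝓞 K)ˣ) (b : K) : upperMatrix (-u) b = -upperMatrix u b := by
  ext i j
  fin_cases i <;> fin_cases j
  · change ((-u : (𝓞 K)ˣ) : K) = -(u : K)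
    simp
  · change ((-u : (𝓞 K)ˣ) : K)⁻¹ * b = -((u : K)⁻¹ * b)
    simp [inv_neg]
  · exact neg_zero.symm
  · change ((-u : (𝓞 K)ˣ) : K)⁻¹ = -(u : K)⁻¹
    simp [inv_neg]

theorem map_upperMatrix_apply {L : Type*} [Field L] (φ : K →+* L) (u : (𝓞 K)ˣ) (b : K) :
    Matrix.SpecialLinearGroup.map φ (upperMatrix u b) 0 0 = φ (u : K) ∧
    Matrix.SpecialLinearGroup.map φ (upperMatrix u b) 0 1 = (φ (u : K))⁻¹ * φ b ∧
    Matrix.SpecialLinearGroup.map φ (upperMatrix u b) 1 0 = 0 ∧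
    Matrix.SpecialLinearGroup.map φ (upperMatrix u b) 1 1 = (φ (u : K))⁻¹ := by
  refine ⟨rfl, ?_, map_zero φ, map_inv₀ φ _⟩
  rw [← map_inv₀, ← map_mul]
  rfl

theorem xAt_upperMatrix_smul (u : (𝓞 K)ˣ) (b : K) (v : InfinitePlace K) (z : Space K) :
    Space.xAt v (upperMatrix u b • z) =
      v.embedding (u : K) ^ 2 * Space.xAt v z + v.embedding b := by
  have hu : (u : K) ≠ 0 := Units.coe_ne_zero u
  by_cases h : v.IsReal
  · rw [Space.xAt_real h, Space.xAt_real h]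
    have hu' := (map_ne_zero (embedding_of_isReal h)).2 hu
    have h1 : ((upperMatrix u b • z).1 ⟨v, h⟩ : ℂ) =
        (embedding_of_isReal h (u : K) : ℂ) ^ 2 * z.1 ⟨v, h⟩ + (embedding_of_isReal h b : ℂ) := by
      change ((Matrix.SpecialLinearGroup.map (embedding_of_isReal h) (upperMatrix u b) •
        z.1 ⟨v, h⟩ : ℍ) : ℂ) = _
      rw [UpperHalfPlane.coe_specialLinearGroup_apply]
      have hu2 : (embedding_of_isReal h (u : K) : ℂ) ≠ 0 := by exact_mod_cast hu'
      obtain ⟨h00, h01, h10, h11⟩ := map_upperMatrix_apply (embedding_of_isReal h) u b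
      rw [h00, h01, h10, h11]
      simp only [Algebra.algebraMap_self, RingHom.id_apply, Complex.ofReal_mul, Complex.ofReal_inv,
        Complex.ofReal_zero, zero_mul, zero_add]
      field_simp
    have h2 := congrArg Complex.re h1
    rw [← Complex.ofReal_pow, Complex.add_re, Complex.re_ofReal_mul, Complex.ofReal_re] at h2
    rw [← embedding_of_isReal_apply h, ← embedding_of_isReal_apply h]
    exact_mod_cast h2
  · replace h := not_isReal_iff_isComplex.1 h
    rw [Space.xAt_complex h, Space.xAt_complex h]
    have hu' : v.embedding (u : K) ≠ 0 := (map_ne_zero _).2 hu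
    have hu2 : conj (v.embedding (u : K)) ≠ 0 := (map_ne_zero _).2 hu'
    change (Matrix.SpecialLinearGroup.map v.embedding (upperMatrix u b) • z.2 ⟨v, h⟩).x = _
    rw [UpperHalfSpace.smul_x, UpperHalfSpace.normSqDenom_coe]
    obtain ⟨h00, h01, h10, h11⟩ := map_upperMatrix_apply v.embedding u b
    rw [h00, h01, h10, h11]
    simp only [map_zero, map_mul, map_inv₀, zero_mul, zero_add, mul_zero, add_zero]
    field_simp

theorem yAt_upperMatrix_smul (u : (𝓞 K)ˣ) (b : K) (v : InfinitePlace K) (z : Space K) :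
    Space.yAt v (upperMatrix u b • z) = v (u : K) ^ 2 * Space.yAt v z := by
  have h : Space.denomAt (upperMatrix u b 1 0) (upperMatrix u b 1 1) v z = (v (u : K) ^ 2)⁻¹ := by
    change Space.denomAt 0 (u : K)⁻¹ v z = _
    simp [Space.denomAt, Complex.normSq_eq_norm_sq, norm_embedding_eq]
  rw [Space.yAt_smul, h, div_inv_eq_mul, mul_comm]

theorem exists_map_eq {G : SL(2, K)} (h : ∀ i j, G i j ∈ (algebraMap (𝓞 K) K).range) :
    ∃ g : SL(2, 𝓞 K), Matrix.SpecialLinearGroup.map (algebraMap (𝓞 K) K) g = G := by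
  choose g hg using h
  refine ⟨⟨Matrix.of g, ?_⟩, ?_⟩
  · apply RingOfIntegers.coe_injective
    have := G.det_coe
    rw [Matrix.det_fin_two] at this
    rw [Matrix.det_fin_two]
    simp only [Matrix.of_apply, map_sub, map_mul, map_one, hg]
    exact this
  · ext i j
    exact hg i j

section Cusp

variable {A : SL(2, K)} {lam : ℙ K (Fin 2 → K)}

theorem left_mem_idealOf (ρ σ : K) : ρ ∈ idealOf ρ σ :=
  (FractionalIdeal.spanSingleton_le_iff_mem (S := (𝓞 K)⁰)).1 le_sup_left

theorem right_mem_idealOf (ρ σ : K) : σ ∈ idealOf ρ σ :=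
  (FractionalIdeal.spanSingleton_le_iff_mem (S := (𝓞 K)⁰)).1 le_sup_right

theorem mul_mem_range {I J : FractionalIdeal (𝓞 K)⁰ K} (hIJ : I * J = 1) {x y : K} (hx : x ∈ I)
    (hy : y ∈ J) : x * y ∈ (algebraMap (𝓞 K) K).range := by
  have := FractionalIdeal.mul_mem_mul hx hy
  rw [hIJ, FractionalIdeal.mem_one_iff] at this
  exact this

theorem mul_mem_of_mem_range {I : FractionalIdeal (𝓞 K)⁰ K} {x y : K}
    (hx : x ∈ (algebraMap (𝓞 K) K).range) (hy : y ∈ I) : x * y ∈ I := by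
  obtain ⟨a, rfl⟩ := hx
  rw [← Algebra.smul_def]
  exact Submodule.smul_mem (I : Submodule (𝓞 K) K) a hy

/-- The first column of `A` lies in `𝔞` and the second in `𝔞⁻¹`. -/
theorem IsAssociated.products_mem (hA : IsAssociated A lam) (i j : Fin 2) :
    A i 0 * A j 1 ∈ (algebraMap (𝓞 K) K).range := by
  have hI := mul_inv_cancel₀ (idealOf_ne_zero A)
  refine mul_mem_range hI ?_ ?_
  · fin_cases i
    · exact left_mem_idealOf _ _
    · exact right_mem_idealOf _ _
  · fin_cases j
    · exact hA.xi_mem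
    · exact hA.eta_mem

theorem unit_mem_range (u : (𝓞 K)ˣ) : (u : K) ∈ (algebraMap (𝓞 K) K).range := ⟨u, rfl⟩

theorem unit_inv_mem_range (u : (𝓞 K)ˣ) : (u : K)⁻¹ ∈ (algebraMap (𝓞 K) K).range :=
  ⟨(u⁻¹ : (𝓞 K)ˣ), by simp⟩

theorem SL2_mul_apply (g h : SL(2, K)) (i j : Fin 2) :
    (g * h) i j = g i 0 * h 0 j + g i 1 * h 1 j := by
  simp [Matrix.SpecialLinearGroup.coe_mul, Matrix.mul_apply, Fin.sum_univ_two]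

/-- Every entry is a combination, with coefficients `±u` and `±u⁻¹`, of products from `𝔞 𝔞⁻¹` and
from `𝔞² 𝔞⁻²`. Thus the translations by `𝔞⁻²` come from the modular group. -/
theorem conj_upperMatrix_mem_range (hA : IsAssociated A lam) (u : (𝓞 K)ˣ) {b : K}
    (hb : b ∈ ((idealOf (A 0 0) (A 1 0)) ^ 2)⁻¹) (i j : Fin 2) :
    (A * upperMatrix u b * A⁻¹) i j ∈ (algebraMap (𝓞 K) K).range := by
  have hp := hA.products_mem
  have hb' : ∀ i j, A i 0 * A j 0 * b ∈ (algebraMap (𝓞 K) K).range := fun i j ↦ by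
    have hm : ∀ i, A i 0 ∈ idealOf (A 0 0) (A 1 0) := fun i ↦ by
      fin_cases i
      · exact left_mem_idealOf _ _
      · exact right_mem_idealOf _ _
    have := FractionalIdeal.mul_mem_mul (hm i) (hm j)
    rw [← sq] at this
    exact mul_mem_range (mul_inv_cancel₀ (pow_ne_zero 2 (idealOf_ne_zero A))) this hb
  have hu := unit_mem_range u
  have hu' := unit_inv_mem_range u
  have e : ∀ i, (A * upperMatrix u b) i 0 = A i 0 * u ∧
      (A * upperMatrix u b) i 1 = A i 0 * ((u : K)⁻¹ * b) + A i 1 * (u : K)⁻¹ := fun i ↦ by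
    rw [SL2_mul_apply, SL2_mul_apply]
    simp [upperMatrix]
  rw [SL2_mul_apply, (e i).1, (e i).2, Matrix.SpecialLinearGroup.SL2_inv_expl]
  fin_cases j
  · have : (A i 0 * A 1 1) * u - (A i 0 * A 1 0 * b) * (u : K)⁻¹ - (A 1 0 * A i 1) * (u : K)⁻¹ ∈
        (algebraMap (𝓞 K) K).range :=
      sub_mem (sub_mem (mul_mem (hp _ _) hu) (mul_mem (hb' _ _) hu')) (mul_mem (hp _ _) hu')
    convert! this using 1
    simp
    ring
  · have : -(A i 0 * A 0 1) * u + (A i 0 * A 0 0 * b) * (u : K)⁻¹ + (A 0 0 * A i 1) * (u : K)⁻¹ ∈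
        (algebraMap (𝓞 K) K).range :=
      add_mem (add_mem (mul_mem (neg_mem (hp _ _)) hu) (mul_mem (hb' _ _) hu'))
        (mul_mem (hp _ _) hu')
    convert! this using 1
    simp
    ring

theorem smul_infty_eq_iff (B : SL(2, K)) :
    B • Projectivization.mk K ![(1 : K), 0] (by simp) = Projectivization.mk K ![(1 : K), 0]
      (by simp) ↔ B 1 0 = 0 := by
  have e : ∀ i, (B • ![(1 : K), 0]) i = B i 0 := fun i ↦ by
    change (B.1.mulVec ![(1 : K), 0]) i = _
    simp [Matrix.mulVec, dotProduct, Fin.sum_univ_two]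
  rw [Projectivization.smul_mk, Projectivization.mk_eq_mk_iff']
  constructor
  · rintro ⟨a, ha⟩
    have := congrFun ha 1
    rw [e] at this
    simpa using this.symm
  · intro h
    refine ⟨B 0 0, ?_⟩
    funext i
    rw [e]
    fin_cases i
    · simp
    · simpa using h.symm

theorem smul_cusp_eq_iff (hA : IsAssociated A lam) (G : SL(2, K)) :
    G • lam = lam ↔ (A⁻¹ * G * A) 1 0 = 0 := by
  rw [← smul_infty_eq_iff, ← hA.smul_infty, mul_smul, mul_smul, inv_smul_eq_iff]

theorem exists_stabilizer_eq (hA : IsAssociated A lam) (u : (𝓞 K)ˣ) {b : K}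
    (hb : b ∈ ((idealOf (A 0 0) (A 1 0)) ^ 2)⁻¹) :
    ∃ δ ∈ MulAction.stabilizer (modularGroup K) lam,
      (δ : PSL(2, K)) = ((A * upperMatrix u b * A⁻¹ : SL(2, K)) : PSL(2, K)) := by
  obtain ⟨g, hg⟩ := exists_map_eq (conj_upperMatrix_mem_range hA u hb)
  refine ⟨⟨_, g, rfl⟩, ?_, congrArg _ hg⟩
  change Matrix.SpecialLinearGroup.map (algebraMap (𝓞 K) K) g • lam = lam
  rw [smul_cusp_eq_iff hA, hg]
  rw [show A⁻¹ * (A * upperMatrix u b * A⁻¹) * A = upperMatrix u b by group]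
  rfl

/-- Converse of `exists_stabilizer_eq`. The conjugate `B = A⁻¹ G A` is upper triangular. Its
diagonal entries are integral with product one, hence inverse units, and its corner is a combination
of products of two elements of `𝔞⁻¹`. -/
theorem stabilizer_eq_conj (hA : IsAssociated A lam) {δ : modularGroup K}
    (hδ : δ ∈ MulAction.stabilizer (modularGroup K) lam) :
    ∃ (u : (𝓞 K)ˣ) (b : K), b ∈ ((idealOf (A 0 0) (A 1 0)) ^ 2)⁻¹ ∧
      (δ : PSL(2, K)) = ((A * upperMatrix u b * A⁻¹ : SL(2, K)) : PSL(2, K)) := by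
  obtain ⟨_, g, rfl⟩ := δ
  set G := Matrix.SpecialLinearGroup.map (algebraMap (𝓞 K) K) g with hG
  have hδ : G • lam = lam := hδ
  rw [smul_cusp_eq_iff hA] at hδ
  set B := A⁻¹ * G * A with hB
  have hdet := B.det_coe
  rw [Matrix.det_fin_two, hδ, mul_zero, sub_zero] at hdet
  have hp := hA.products_mem
  have hg : ∀ i j, G i j ∈ (algebraMap (𝓞 K) K).range := fun i j ↦ ⟨g i j, rfl⟩
  have e0 : ∀ j, B 0 j = A 1 1 * (G 0 0 * A 0 j + G 0 1 * A 1 j) -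
      A 0 1 * (G 1 0 * A 0 j + G 1 1 * A 1 j) := fun j ↦ by
    rw [hB, mul_assoc, SL2_mul_apply, SL2_mul_apply, SL2_mul_apply,
      Matrix.SpecialLinearGroup.SL2_inv_expl]
    simp
    ring
  have e1 : B 1 1 = A 0 0 * (G 1 0 * A 0 1 + G 1 1 * A 1 1) -
      A 1 0 * (G 0 0 * A 0 1 + G 0 1 * A 1 1) := by
    rw [hB, mul_assoc, SL2_mul_apply, SL2_mul_apply, SL2_mul_apply,
      Matrix.SpecialLinearGroup.SL2_inv_expl]
    simp
    ring
  have h00 : B 0 0 ∈ (algebraMap (𝓞 K) K).range := by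
    have : G 0 0 * (A 0 0 * A 1 1) + G 0 1 * (A 1 0 * A 1 1) - G 1 0 * (A 0 0 * A 0 1) -
        G 1 1 * (A 1 0 * A 0 1) ∈ (algebraMap (𝓞 K) K).range :=
      sub_mem (sub_mem (add_mem (mul_mem (hg _ _) (hp _ _)) (mul_mem (hg _ _) (hp _ _)))
        (mul_mem (hg _ _) (hp _ _))) (mul_mem (hg _ _) (hp _ _))
    rw [e0]
    convert this using 1
    ring
  have h11 : B 1 1 ∈ (algebraMap (𝓞 K) K).range := by
    have : G 1 0 * (A 0 0 * A 0 1) + G 1 1 * (A 0 0 * A 1 1) - G 0 0 * (A 1 0 * A 0 1) -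
        G 0 1 * (A 1 0 * A 1 1) ∈ (algebraMap (𝓞 K) K).range :=
      sub_mem (sub_mem (add_mem (mul_mem (hg _ _) (hp _ _)) (mul_mem (hg _ _) (hp _ _)))
        (mul_mem (hg _ _) (hp _ _))) (mul_mem (hg _ _) (hp _ _))
    rw [e1]
    convert this using 1
    ring
  have h01 : B 0 1 ∈ ((idealOf (A 0 0) (A 1 0)) ^ 2)⁻¹ := by
    have hm : ∀ i j, A i 1 * A j 1 ∈ ((idealOf (A 0 0) (A 1 0)) ^ 2)⁻¹ := fun i j ↦ by
      have hi : ∀ i, A i 1 ∈ (idealOf (A 0 0) (A 1 0))⁻¹ := fun i ↦ by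
        fin_cases i
        · exact hA.xi_mem
        · exact hA.eta_mem
      have := FractionalIdeal.mul_mem_mul (hi i) (hi j)
      rwa [← sq, inv_pow] at this
    have : G 0 0 * (A 0 1 * A 1 1) + G 0 1 * (A 1 1 * A 1 1) - G 1 0 * (A 0 1 * A 0 1) -
        G 1 1 * (A 1 1 * A 0 1) ∈ ((idealOf (A 0 0) (A 1 0)) ^ 2)⁻¹ := by
      have h := fun i j k l ↦ mul_mem_of_mem_range (hg k l) (hm i j)
      exact Submodule.sub_mem _ (Submodule.sub_mem _ (Submodule.add_mem _ (h _ _ _ _) (h _ _ _ _))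
        (h _ _ _ _)) (h _ _ _ _)
    rw [e0]
    convert this using 1
    ring
  obtain ⟨a, ha⟩ := h00
  obtain ⟨d, hd⟩ := h11
  have had : a * d = 1 := RingOfIntegers.coe_injective (by
    rw [map_mul, ha, hd, hdet, map_one])
  -- The corner of `upperMatrix u b` is `u⁻¹ b`, so `b` is the corner of `B` multiplied by `u = B 0
  -- 0`.
  refine ⟨⟨a, d, had, by rw [mul_comm, had]⟩, B 0 0 * B 0 1,
    mul_mem_of_mem_range ⟨a, ha⟩ h01, ?_⟩
  have hB' : upperMatrix ⟨a, d, had, by rw [mul_comm, had]⟩ (B 0 0 * B 0 1) = B := by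
    have h0 : B 0 0 ≠ 0 := left_ne_zero_of_mul_eq_one hdet
    ext i j
    fin_cases i <;> fin_cases j
    · exact ha
    · change (algebraMap (𝓞 K) K a)⁻¹ * (B 0 0 * B 0 1) = B 0 1
      rw [ha, inv_mul_cancel_left₀ h0]
    · exact hδ.symm
    · change (algebraMap (𝓞 K) K a)⁻¹ = B 1 1
      rw [ha, inv_eq_of_mul_eq_one_right hdet]
  rw [hB', hB]
  change (G : PSL(2, K)) = _
  congr 1
  group

theorem mk_eq_mk_iff {g h : SL(2, K)} : (g : PSL(2, K)) = (h : PSL(2, K)) ↔ h = g ∨ h = -g := by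
  rw [QuotientGroup.eq]
  constructor
  · intro hc
    obtain ⟨r, hr, hgr⟩ := Matrix.SpecialLinearGroup.mem_center_iff.1 hc
    have hr2 : r = 1 ∨ r = -1 := by
      simpa using hr
    rcases hr2 with rfl | rfl
    · left
      have : g⁻¹ * h = 1 := Subtype.ext (by rw [← hgr]; simp)
      exact (inv_mul_eq_one.1 this).symm
    · right
      have : g⁻¹ * h = -1 := Subtype.ext (by
        rw [← hgr]; ext i j; fin_cases i <;> fin_cases j <;> simp)
      rw [inv_mul_eq_iff_eq_mul.1 this, mul_neg, mul_one]
  · rintro (rfl | rfl)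
    · simp
    · refine Space.mem_center_of_entries ?_ ?_ ?_ <;> simp

/-- Only the sign is lost in `PSL(2, K)`, and the parametrization by `z ↦ u² z + b` makes `b`
insensitive to it. This sign is the source of the `2` in `ω / 2`. -/
theorem mk_conj_upperMatrix_eq_iff {u w : (𝓞 K)ˣ} {b c : K} :
    ((A * upperMatrix u b * A⁻¹ : SL(2, K)) : PSL(2, K)) =
      ((A * upperMatrix w c * A⁻¹ : SL(2, K)) : PSL(2, K)) ↔ (w = u ∨ w = -u) ∧ b = c := by
  have hne : ∀ u : (𝓞 K)ˣ, (u : K) ≠ 0 := fun u ↦ Units.coe_ne_zero u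
  have hinj : ∀ u w : (𝓞 K)ˣ, (u : K) = w → u = w := fun u w h ↦
    Units.ext (RingOfIntegers.coe_injective h)
  have h1 : ∀ u w : (𝓞 K)ˣ, ∀ b c, upperMatrix w c = upperMatrix u b ↔ w = u ∧ b = c := by
    intro u w b c
    constructor
    · intro h
      have h00 : (w : K) = u := congrFun (congrFun (congrArg Subtype.val h) 0) 0
      have h01 : (w : K)⁻¹ * c = (u : K)⁻¹ * b := congrFun (congrFun (congrArg Subtype.val h) 0) 1
      rw [h00] at h01
      exact ⟨hinj _ _ h00, (mul_left_cancel₀ (inv_ne_zero (hne u)) h01).symm⟩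
    · rintro ⟨rfl, rfl⟩
      rfl
  rw [mk_eq_mk_iff, mul_left_inj, mul_right_inj, ← neg_mul, ← mul_neg, mul_left_inj, mul_right_inj,
    ← upperMatrix_neg, h1, h1, or_and_right]

end Cusp

end HilbertModular

/-! ### Counting the translates of a point in the box at the cusp. -/

/-- The image of a map which identifies each point with exactly one other point. -/
theorem Set.two_mul_ncard_range {T D : Type*} [Finite T] (φ : T → D) (n : T → T)
    (hn : ∀ t, n t ≠ t) (h : ∀ t t', φ t = φ t' ↔ t' = t ∨ t' = n t) :
    2 * (Set.range φ).ncard = Nat.card T := by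
  classical
  have := Fintype.ofFinite T
  have hc : (Set.range φ).ncard = (Finset.univ.image φ).card := by
    rw [← Set.ncard_coe_finset, Finset.coe_image, Finset.coe_univ, Set.image_univ]
  rw [hc, Nat.card_eq_fintype_card, ← Finset.card_univ,
    Finset.card_eq_sum_card_image φ Finset.univ, mul_comm, ← _root_.smul_eq_mul,
    ← Finset.sum_const]
  refine Finset.sum_congr rfl fun b hb ↦ ?_
  obtain ⟨t, -, rfl⟩ := Finset.mem_image.1 hb
  have : Finset.univ.filter (fun a ↦ φ a = φ t) = {t, n t} := by
    ext a
    rw [Finset.mem_filter, eq_comm (a := φ a), h]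
    simp
  rw [this, Finset.card_pair (hn t).symm]

theorem existsUnique_add_int_mem_Ico (x : ℝ) :
    ∃! n : ℤ, x + n ∈ Set.Ico (-(1 / 2) : ℝ) (1 / 2) := by
  have := existsUnique_add_zsmul_mem_Ico (one_pos (α := ℝ)) x (-(1 / 2))
  norm_num at this ⊢
  exact this

namespace HilbertModular

variable {K : Type*} [Field K] [NumberField K]

open mixedEmbedding

theorem Space.ofLog_bijective : Function.Bijective (Space.ofLog (K := K)) := by
  constructor
  · intro p q h
    have hR : ∀ v, (p.1.1 v = q.1.1 v) ∧ p.2 v.1 = q.2 v.1 := fun v ↦ by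
      have h1 := congrFun (congrArg Prod.fst h) v
      have h2 : Real.exp (p.2 v.1) = Real.exp (q.2 v.1) := congrArg UpperHalfPlane.im h1
      exact ⟨congrArg UpperHalfPlane.re h1, Real.exp_injective h2⟩
    have hC : ∀ v, (p.1.2 v = q.1.2 v) ∧ p.2 v.1 = q.2 v.1 := fun v ↦ by
      have h1 := congrFun (congrArg Prod.snd h) v
      have h2 : Real.exp (p.2 v.1) = Real.exp (q.2 v.1) := congrArg UpperHalfSpace.y h1
      exact ⟨congrArg UpperHalfSpace.x h1, Real.exp_injective h2⟩
    refine Prod.ext (Prod.ext (funext fun v ↦ (hR v).1) (funext fun v ↦ (hC v).1))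
      (funext fun v ↦ ?_)
    by_cases hv : v.IsReal
    · exact (hR ⟨v, hv⟩).2
    · exact (hC ⟨v, not_isReal_iff_isComplex.1 hv⟩).2
  · intro z
    refine ⟨((fun v ↦ (z.1 v).re, fun v ↦ (z.2 v).x), fun v ↦ Real.log (Space.yAt v z)), ?_⟩
    refine Prod.ext (funext fun v ↦ UpperHalfPlane.ext (Complex.ext rfl ?_))
      (funext fun v ↦ UpperHalfSpace.ext' rfl ?_)
    · exact (Real.exp_log (Space.yAt_pos v.1 z)).trans (Space.yAt_real v.2 z)
    · exact (Real.exp_log (Space.yAt_pos v.1 z)).trans (Space.yAt_complex v.2 z)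

open scoped Classical in
theorem exists_basis_mixedSpace (I : (FractionalIdeal (𝓞 K)⁰ K)ˣ) {ι : Type*} [Fintype ι]
    (α : Module.Basis ι ℤ (I : FractionalIdeal (𝓞 K)⁰ K)) :
    ∃ b : Module.Basis ι ℝ (mixedSpace K), ∀ j, b j = mixedEmbedding K (α j : K) := by
  let φ := (mixedEmbedding K).toIntAlgHom.toLinearMap ∘ₗ
    ((I : Submodule (𝓞 K) K).subtype.restrictScalars ℤ)
  have hφ : Function.Injective φ :=
    (mixedEmbedding_injective K).comp Subtype.val_injective
  let b : Module.Basis ι ℤ (idealLattice K I) := α.map (LinearEquiv.ofInjective φ hφ)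
  let b' := b.ofZLatticeBasis ℝ
  have hb' : ∀ j, b' j = mixedEmbedding K (α j : K) := fun j ↦
    Module.Basis.ofZLatticeBasis_apply ..
  exact ⟨b', hb'⟩

variable {A : SL(2, K)} {lam : ℙ K (Fin 2 → K)}
  (α : Module.Basis (Fin (Module.finrank ℚ K)) ℤ
    (((idealOf (A 0 0) (A 1 0)) ^ 2)⁻¹ : FractionalIdeal (𝓞 K)⁰ K))
  {ε : Fin (Units.rank K) → (𝓞 K)ˣ}

theorem sum_smul_mixedEmbedding_bijective :
    Function.Bijective fun X : Fin (Module.finrank ℚ K) → ℝ ↦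
      ∑ j, X j • mixedEmbedding K (α j : K) := by
  have hI : ((idealOf (A 0 0) (A 1 0)) ^ 2)⁻¹ ≠ 0 := inv_ne_zero (pow_ne_zero 2 (idealOf_ne_zero A))
  obtain ⟨b, hb⟩ := exists_basis_mixedSpace (Units.mk0 _ hI) α
  convert! b.equivFun.symm.bijective using 1
  funext X
  rw [Module.Basis.equivFun_symm_apply]
  exact Finset.sum_congr rfl fun j _ ↦ congrArg (X j • ·) (hb j).symm

theorem starMap_bijective (hε : IsFundamentalSystem ε) :
    Function.Bijective (starMap A (fun j ↦ (α j : K)) ε) := by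
  have h : starMap A (fun j ↦ (α j : K)) ε = Space.ofLog ∘
      Prod.map (fun X ↦ ∑ j, X j • mixedEmbedding K (α j : K)) (fun p v ↦
        Real.log (localY A ε p.1 (Real.exp p.2) v)) ∘ (Equiv.prodAssoc _ _ _) :=
    funext fun p ↦ starMap_eq_ofLog A _ ε p
  rw [h]
  exact Space.ofLog_bijective.comp (((sum_smul_mixedEmbedding_bijective α).prodMap
    (log_localY_bijective A hε)).comp (Equiv.bijective _))

theorem xAt_starMap (A : SL(2, K)) (α : Fin (Module.finrank ℚ K) → K)
    (ε : Fin (Units.rank K) → (𝓞 K)ˣ)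
    (p : ((Fin (Module.finrank ℚ K) → ℝ) × (Fin (Units.rank K) → ℝ)) × ℝ) (v : InfinitePlace K) :
    Space.xAt v (starMap A α ε p) = ∑ j, p.1.1 j * v.embedding (α j) := by
  by_cases h : v.IsReal
  · rw [Space.xAt_real h]
    change ((∑ j, p.1.1 j * embedding_of_isReal h (α j) : ℝ) : ℂ) = _
    push_cast
    simp only [embedding_of_isReal_apply]
  · rw [Space.xAt_complex (not_isReal_iff_isComplex.1 h)]
    rfl

theorem yAt_starMap (A : SL(2, K)) (α : Fin (Module.finrank ℚ K) → K)
    (ε : Fin (Units.rank K) → (𝓞 K)ˣ)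
    (p : ((Fin (Module.finrank ℚ K) → ℝ) × (Fin (Units.rank K) → ℝ)) × ℝ) (v : InfinitePlace K) :
    Space.yAt v (starMap A α ε p) = localY A ε p.1.2 (Real.exp p.2) v := by
  by_cases h : v.IsReal
  · rw [Space.yAt_real h]
    rfl
  · rw [Space.yAt_complex (not_isReal_iff_isComplex.1 h)]
    rfl

/-- The exponent `2 Y_k` matches the factor `|u|²` by which `z ↦ u² z + b` scales `y`; roots of
unity have absolute value one everywhere. -/
theorem localY_add_int (A : SL(2, K)) (ε : Fin (Units.rank K) → (𝓞 K)ˣ)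
    (Y : Fin (Units.rank K) → ℝ) (q : ℝ) (v : InfinitePlace K) (ζ : Units.torsion K)
    (e : Fin (Units.rank K) → ℤ) :
    localY A ε (fun k ↦ Y k + e k) q v =
      v ((ζ * ∏ k, ε k ^ e k : (𝓞 K)ˣ) : K) ^ 2 * localY A ε Y q v := by
  have hv : ∀ k, 0 < v (ε k : K) := fun k ↦ InfinitePlace.pos_iff.2 (Units.coe_ne_zero _)
  have h1 : v ((ζ * ∏ k, ε k ^ e k : (𝓞 K)ˣ) : K) = ∏ k, v (ε k : K) ^ e k := by
    have := Units.mem_torsion K |>.1 ζ.2 v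
    rw [Units.coe_mul, map_mul, this, one_mul]
    rw [Units.coe_prod, map_prod, map_prod]
    exact Finset.prod_congr rfl fun k _ ↦ by rw [Units.coe_zpow, map_zpow₀]
  rw [h1, localY, localY, mul_left_comm, ← Finset.prod_pow, ← Finset.prod_mul_distrib]
  congr 1
  refine Finset.prod_congr rfl fun k _ ↦ ?_
  rw [mul_add, Real.rpow_add (hv k), mul_comm]
  congr 1
  rw [mul_comm, Real.rpow_mul (hv k).le, Real.rpow_intCast]
  exact_mod_cast rfl

theorem upperMatrix_smul_starMap (A : SL(2, K)) (α : Fin (Module.finrank ℚ K) → K)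
    (ε : Fin (Units.rank K) → (𝓞 K)ˣ) {X X' : Fin (Module.finrank ℚ K) → ℝ}
    (Y : Fin (Units.rank K) → ℝ) (τ : ℝ) (ζ : Units.torsion K) (e : Fin (Units.rank K) → ℤ) {b : K}
    (hX : ∀ v : InfinitePlace K, ∑ j, X' j * v.embedding (α j) =
      v.embedding ((ζ * ∏ k, ε k ^ e k : (𝓞 K)ˣ) : K) ^ 2 * ∑ j, X j * v.embedding (α j) +
        v.embedding b) :
    upperMatrix ((ζ : (𝓞 K)ˣ) * ∏ k, ε k ^ e k) b • starMap A α ε ((X, Y), τ) =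
      starMap A α ε ((X', fun k ↦ Y k + e k), τ) := by
  refine Space.ext_coord (fun v ↦ ?_) fun v ↦ ?_
  · rw [xAt_upperMatrix_smul, xAt_starMap, xAt_starMap]
    exact (hX v).symm
  · rw [yAt_upperMatrix_smul, yAt_starMap, yAt_starMap]
    exact (localY_add_int A ε Y _ v ζ e).symm

end HilbertModular

namespace HilbertModular

variable {K : Type*} [Field K] [NumberField K] {A : SL(2, K)} {lam : ℙ K (Fin 2 → K)}
  (α : Module.Basis (Fin (Module.finrank ℚ K)) ℤ
    (((idealOf (A 0 0) (A 1 0)) ^ 2)⁻¹ : FractionalIdeal (𝓞 K)⁰ K))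
  {ε : Fin (Units.rank K) → (𝓞 K)ˣ}

variable (K) in
/-- The box of the points with `X` and `Y` between `-1 / 2` and `1 / 2`. -/
def coordBox : Set (((Fin (Module.finrank ℚ K) → ℝ) × (Fin (Units.rank K) → ℝ)) × ℝ) :=
  {p | (∀ j, p.1.1 j ∈ Set.Ico (-(1 / 2) : ℝ) (1 / 2)) ∧
    ∀ k, p.1.2 k ∈ Set.Ico (-(1 / 2) : ℝ) (1 / 2)}

/-- The points `A z⋆` with the local coordinates `X` and `Y` between `-1 / 2` and `1 / 2`. -/
def cuspBox (A : SL(2, K)) (α : Fin (Module.finrank ℚ K) → K)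
    (ε : Fin (Units.rank K) → (𝓞 K)ˣ) : Set (Space K) :=
  (fun p ↦ A • starMap A α ε p) '' coordBox K

theorem smul_starMap_mem_cuspBox_iff (hε : IsFundamentalSystem ε)
    (p : ((Fin (Module.finrank ℚ K) → ℝ) × (Fin (Units.rank K) → ℝ)) × ℝ) :
    A • starMap A (fun j ↦ (α j : K)) ε p ∈ cuspBox A (fun j ↦ (α j : K)) ε ↔ p ∈ coordBox K := by
  have : Function.Injective fun p ↦ A • starMap A (fun j ↦ (α j : K)) ε p :=
    (MulAction.injective A).comp (starMap_bijective α hε).1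
  exact this.mem_set_image

/-- The horizontal action does not involve `y`, so `X'` depends only on `X` and the unit, while `b`
adds its integral coordinates in the basis `α`. -/
theorem exists_upperMatrix_smul_starMap (hε : IsFundamentalSystem ε) (ζ : Units.torsion K)
    (e : Fin (Units.rank K) → ℤ) (X : Fin (Module.finrank ℚ K) → ℝ) :
    ∃ X' : Fin (Module.finrank ℚ K) → ℝ,
      ∀ (Y : Fin (Units.rank K) → ℝ) (τ : ℝ)
        (b : ((((idealOf (A 0 0) (A 1 0)) ^ 2)⁻¹ : FractionalIdeal (𝓞 K)⁰ K) : Submodule (𝓞 K) K)),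
      upperMatrix ((ζ : (𝓞 K)ˣ) * ∏ k, ε k ^ e k) (b : K) •
        starMap A (fun j ↦ (α j : K)) ε ((X, Y), τ) =
      starMap A (fun j ↦ (α j : K)) ε
        ((fun j ↦ X' j + α.repr b j, fun k ↦ Y k + e k), τ) := by
  set u : (𝓞 K)ˣ := (ζ : (𝓞 K)ˣ) * ∏ k, ε k ^ e k with hu
  -- `X'` is read off from the image of one auxiliary point over `X`, with `Y = 0`, `τ = 0` and `b =
  -- 0`.
  obtain ⟨p, hp⟩ := (starMap_bijective α hε).2
    (upperMatrix u 0 • starMap A (fun j ↦ (α j : K)) ε ((X, 0), 0))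
  refine ⟨p.1.1, fun Y τ b ↦ upperMatrix_smul_starMap A _ ε Y τ ζ e fun v ↦ ?_⟩
  have h1 := congrArg (Space.xAt v) hp
  rw [xAt_starMap, xAt_upperMatrix_smul, xAt_starMap, map_zero, add_zero] at h1
  have h2 : (b : K) = ∑ j, (α.repr b j) • (α j : K) := by
    conv_lhs => rw [← α.sum_repr b]
    rw [AddSubmonoidClass.coe_finsetSum]
    rfl
  have h3 : v.embedding (b : K) = ∑ j, ((α.repr b j : ℝ) : ℂ) * v.embedding (α j : K) := by
    rw [h2, map_sum]
    refine Finset.sum_congr rfl fun j _ ↦ ?_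
    rw [map_zsmul, zsmul_eq_mul]
    norm_cast
  rw [h3, ← hu, ← h1, ← Finset.sum_add_distrib]
  refine Finset.sum_congr rfl fun j _ ↦ ?_
  push_cast
  ring

/-- The condition on `Y` determines the exponents `e₀` of the unit. For each root of unity `ζ` the
condition on `X` then determines `b`, by uniqueness of integral translates into half-open intervals.
The resulting map from roots of unity to stabilizer elements identifies exactly `ζ` and `-ζ`. -/
theorem finite_stabilizer_smul_mem_cuspBox (hA : IsAssociated A lam) (hε : IsFundamentalSystem ε)
    (z : Space K) :
    {δ : MulAction.stabilizer (modularGroup K) lam |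
      (δ : modularGroup K) • z ∈ cuspBox A (fun j ↦ (α j : K)) ε}.Finite ∧
    2 * {δ : MulAction.stabilizer (modularGroup K) lam |
      (δ : modularGroup K) • z ∈ cuspBox A (fun j ↦ (α j : K)) ε}.ncard = Units.torsionOrder K := by
  obtain ⟨⟨⟨X, Y⟩, τ⟩, hp⟩ := (starMap_bijective α hε).2 (A⁻¹ • z)
  have hz : ∀ (δ : modularGroup K) (u : (𝓞 K)ˣ) (b : K),
      (δ : PSL(2, K)) = ((A * upperMatrix u b * A⁻¹ : SL(2, K)) : PSL(2, K)) →
      δ • z = A • (upperMatrix u b • starMap A (fun j ↦ (α j : K)) ε ((X, Y), τ)) := by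
    intro δ u b h
    change (δ : PSL(2, K)) • z = _
    rw [h, Space.mk_smul, hp, mul_smul, mul_smul]
  choose e₀ he₀ he₀' using fun k ↦ existsUnique_add_int_mem_Ico (Y k)
  choose X' hX' using fun (ζ : Units.torsion K) (e : Fin (Units.rank K) → ℤ) ↦
    exists_upperMatrix_smul_starMap α hε ζ e X
  have hmem : ∀ (ζ : Units.torsion K) (e : Fin (Units.rank K) → ℤ)
      (b : ((((idealOf (A 0 0) (A 1 0)) ^ 2)⁻¹ : FractionalIdeal (𝓞 K)⁰ K) : Submodule (𝓞 K) K)),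
      A • (upperMatrix ((ζ : (𝓞 K)ˣ) * ∏ k, ε k ^ e k) (b : K) •
        starMap A (fun j ↦ (α j : K)) ε ((X, Y), τ)) ∈ cuspBox A (fun j ↦ (α j : K)) ε ↔
      (∀ j, X' ζ e j + α.repr b j ∈ Set.Ico (-(1 / 2) : ℝ) (1 / 2)) ∧ e = e₀ := by
    intro ζ e b
    rw [hX', smul_starMap_mem_cuspBox_iff α hε]
    refine and_congr_right fun _ ↦ ⟨fun h ↦ funext fun k ↦ he₀' k _ (h k), ?_⟩
    rintro rfl
    exact he₀
  have huniq : ∀ ζ : Units.torsion K, ∃!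
      b : ((((idealOf (A 0 0) (A 1 0)) ^ 2)⁻¹ : FractionalIdeal (𝓞 K)⁰ K) : Submodule (𝓞 K) K),
      ∀ j, X' ζ e₀ j + α.repr b j ∈ Set.Ico (-(1 / 2) : ℝ) (1 / 2) := by
    intro ζ
    choose m hm hm' using fun j ↦ existsUnique_add_int_mem_Ico (X' ζ e₀ j)
    refine ⟨α.equivFun.symm m, fun j ↦ ?_, fun b hb ↦ ?_⟩
    · have : α.repr (α.equivFun.symm m) j = m j := by
        rw [← α.equivFun_apply, LinearEquiv.apply_symm_apply]
      rw [this]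
      exact hm j
    · rw [LinearEquiv.eq_symm_apply]
      exact funext fun j ↦ hm' j _ (hb j)
  choose b hb hb' using huniq
  choose φ hφ hφ' using fun ζ : Units.torsion K ↦
    exists_stabilizer_eq hA ((ζ : (𝓞 K)ˣ) * ∏ k, ε k ^ e₀ k) (b ζ).2
  have hinj : ∀ ζ ζ' : Units.torsion K,
      (ζ' : (𝓞 K)ˣ) * ∏ k, ε k ^ e₀ k = (ζ : (𝓞 K)ˣ) * ∏ k, ε k ^ e₀ k ↔ ζ' = ζ := fun ζ ζ' ↦ by
    rw [mul_left_inj, Subtype.coe_inj]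
  have hneg : (-1 : (𝓞 K)ˣ) ∈ Units.torsion K := by
    rw [Units.mem_torsion]
    intro w
    simp [← norm_embedding_eq]
  let n : Units.torsion K → Units.torsion K := fun ζ ↦ ⟨-1, hneg⟩ * ζ
  have hn : ∀ ζ, ((n ζ : (𝓞 K)ˣ)) * ∏ k, ε k ^ e₀ k = -((ζ : (𝓞 K)ˣ) * ∏ k, ε k ^ e₀ k) := fun ζ ↦ by
    simp [n]
  -- Changing the sign of the unit does not change the transformation, so uniqueness of the
  -- translation gives the same `b`.
  have hnb : ∀ ζ, b (n ζ) = b ζ := by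
    intro ζ
    refine hb' ζ _ ?_
    have h := (hmem (n ζ) e₀ (b (n ζ))).2 ⟨hb _, rfl⟩
    rw [hn, upperMatrix_neg] at h
    have hneg : ∀ (g : SL(2, K)) (w : Space K), -g • w = g • w := fun g w ↦ by
      rw [← Space.mk_smul, ← Space.mk_smul,
        ← (mk_eq_mk_iff.2 (Or.inr rfl) : (g : PSL(2, K)) = (-g : SL(2, K)))]
    rw [hneg] at h
    exact ((hmem ζ e₀ _).1 h).1
  have hne : ∀ ζ, n ζ ≠ ζ := by
    intro ζ h
    have h1 := hn ζ
    rw [h] at h1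
    have h2 : (1 : (𝓞 K)ˣ) = -1 := by
      rw [← neg_one_mul, eq_comm, mul_eq_right] at h1
      exact h1.symm
    have h3 : (1 : K) = -1 := by
      have := congrArg (fun u : (𝓞 K)ˣ ↦ (u : K)) h2
      simpa using this
    norm_num at h3
  have hrange : {δ : MulAction.stabilizer (modularGroup K) lam |
      (δ : modularGroup K) • z ∈ cuspBox A (fun j ↦ (α j : K)) ε} =
      Set.range fun ζ ↦ (⟨φ ζ, hφ ζ⟩ : MulAction.stabilizer (modularGroup K) lam) := by
    ext δ
    constructor
    · intro h
      obtain ⟨u, c, hc, hδ⟩ := stabilizer_eq_conj hA δ.2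
      obtain ⟨⟨ζ, e⟩, hu, -⟩ := hε u
      have h : (δ : modularGroup K) • z ∈ cuspBox A (fun j ↦ (α j : K)) ε := h
      rw [hz δ u c hδ, hu] at h
      obtain ⟨h1, rfl⟩ := (hmem ζ e ⟨c, hc⟩).1 h
      have h2 := hb' ζ _ h1
      refine ⟨ζ, Subtype.ext (Subtype.ext ?_)⟩
      change (φ ζ : PSL(2, K)) = δ
      rw [hφ', hδ, ← h2, hu]
    · rintro ⟨ζ, rfl⟩
      change φ ζ • z ∈ cuspBox A (fun j ↦ (α j : K)) ε
      rw [hz _ _ _ (hφ' ζ)]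
      exact (hmem ζ e₀ (b ζ)).2 ⟨hb ζ, rfl⟩
  have hfin : Finite (Units.torsion K) := inferInstance
  rw [hrange]
  refine ⟨Set.finite_range _, ?_⟩
  rw [Set.two_mul_ncard_range _ n hne]
  · rfl
  · intro ζ ζ'
    have h1 : (⟨φ ζ, hφ ζ⟩ : MulAction.stabilizer (modularGroup K) lam) = ⟨φ ζ', hφ ζ'⟩ ↔
        (φ ζ : PSL(2, K)) = φ ζ' := by
      rw [Subtype.mk.injEq, Subtype.coe_inj]
    rw [h1, hφ', hφ', mk_conj_upperMatrix_eq_iff, hinj, ← hn, hinj]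
    constructor
    · exact fun h ↦ h.1
    · intro h
      refine ⟨h, ?_⟩
      rcases h with rfl | rfl
      · rfl
      · rw [hnb]

end HilbertModular

/-! ### Bounds for heights, uniform in the cusp. -/

namespace HilbertModular

variable {K : Type*} [Field K] [NumberField K]

/-- The principal ideal `(x)` is `I J` with `J` a nonzero integral ideal, whose norm is at least
one. -/
theorem absNorm_le_abs_norm {I : FractionalIdeal (𝓞 K)⁰ K} {x : K} (hx : x ∈ I) (hx0 : x ≠ 0) :
    I.absNorm ≤ |Algebra.norm ℚ x| := by
  have hs : FractionalIdeal.spanSingleton (𝓞 K)⁰ x ≤ I :=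
    FractionalIdeal.spanSingleton_le_iff_mem.2 hx
  have hI : I ≠ 0 := by
    rintro rfl
    exact hx0 ((FractionalIdeal.mem_zero_iff _).1 hx)
  have h1 : I⁻¹ * FractionalIdeal.spanSingleton (𝓞 K)⁰ x ≤ 1 := by
    rw [← inv_mul_cancel₀ hI]
    gcongr
  obtain ⟨J, hJ⟩ := FractionalIdeal.le_one_iff_exists_coeIdeal.1 h1
  have h2 : FractionalIdeal.spanSingleton (𝓞 K)⁰ x = I * J := by
    rw [hJ, mul_inv_cancel_left₀ hI]
  have hJ0 : J ≠ ⊥ := by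
    rintro rfl
    rw [FractionalIdeal.coeIdeal_bot, mul_zero, FractionalIdeal.spanSingleton_eq_zero_iff] at h2
    exact hx0 h2
  rw [← FractionalIdeal.absNorm_span_singleton (𝓞 K), h2, map_mul, FractionalIdeal.coeIdeal_absNorm]
  have h3 : (1 : ℚ) ≤ Ideal.absNorm J := by
    exact_mod_cast Nat.one_le_iff_ne_zero.2 (Ideal.absNorm_eq_zero_iff.not.2 hJ0)
  exact le_mul_of_one_le_right (FractionalIdeal.absNorm_nonneg _) h3

theorem heightAux_pos {w : Fin 2 → K} (hw : w ≠ 0) (z : Space K) : 0 < heightAux w z := by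
  have h : w 0 ≠ 0 ∨ w 1 ≠ 0 := by
    by_contra! h
    exact hw (funext fun i ↦ by fin_cases i <;> simp [h])
  have h1 := Space.normY_pos z
  have h2 : 0 < normSqDenom (-w 1) (w 0) z :=
    Space.normSqDenom_pos (by rw [neg_ne_zero]; exact h.symm) z
  have h3 : (0 : ℝ) < (idealOf (w 0) (w 1)).absNorm := by
    rw [Rat.cast_pos]
    refine (FractionalIdeal.absNorm_nonneg _).lt_of_ne' ?_
    rw [Ne, FractionalIdeal.absNorm_eq_zero_iff]
    intro h0
    have m0 := left_mem_idealOf (w 0) (w 1)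
    have m1 := right_mem_idealOf (w 0) (w 1)
    rw [h0] at m0 m1
    rw [FractionalIdeal.mem_zero_iff] at m0 m1
    tauto
  unfold heightAux
  positivity

theorem height_pos (lam : ℙ K (Fin 2 → K)) (z : Space K) : 0 < height lam z := by
  induction lam using Projectivization.ind with | _ w hw => exact heightAux_pos hw z

theorem continuous_height (lam : ℙ K (Fin 2 → K)) : Continuous (height lam) := by
  induction lam using Projectivization.ind with | _ w hw =>
  change Continuous (heightAux w)
  have h : w 0 ≠ 0 ∨ w 1 ≠ 0 := by
    by_contra! h
    exact hw (funext fun i ↦ by fin_cases i <;> simp [h])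
  unfold heightAux
  refine Continuous.div (by fun_prop) (by fun_prop) fun z ↦
    (Space.normSqDenom_pos (by rw [neg_ne_zero]; exact h.symm) z).ne'

theorem prod_normSq_pow (x : K) :
    ∏ v : InfinitePlace K, Complex.normSq (v.embedding x) ^ v.mult =
      (Algebra.norm ℚ x : ℝ) ^ 2 := by
  rw [← sq_abs, ← Rat.cast_abs, ← prod_eq_abs_norm, ← Finset.prod_pow]
  refine Finset.prod_congr rfl fun v _ ↦ ?_
  rw [Complex.normSq_eq_norm_sq, norm_embedding_eq, ← pow_mul, ← pow_mul, mul_comm]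

/-- The heights at all cusps are bounded in terms of `N(y)`. -/
theorem height_le (lam : ℙ K (Fin 2 → K)) (z : Space K) :
    height lam z ≤ max (normY z) (normY z)⁻¹ := by
  induction lam using Projectivization.ind with | _ w hw =>
  change heightAux w z ≤ _
  have hy := Space.normY_pos z
  set N : ℝ := ((idealOf (w 0) (w 1)).absNorm : ℝ) with hN
  have hN0 : 0 ≤ N := Rat.cast_nonneg.2 (FractionalIdeal.absNorm_nonneg _)
  have key : ∀ x ∈ idealOf (w 0) (w 1), x ≠ 0 → N ^ 2 ≤ (Algebra.norm ℚ x : ℝ) ^ 2 := by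
    intro x hx hx0
    rw [← sq_abs (Algebra.norm ℚ x : ℝ)]
    have := absNorm_le_abs_norm hx hx0
    gcongr
    rw [← Rat.cast_abs]
    exact Rat.cast_le.2 this
  have hnorm : ∀ x : K, x ≠ 0 → 0 < (Algebra.norm ℚ x : ℝ) ^ 2 := fun x hx ↦ by
    have : (Algebra.norm ℚ x : ℝ) ≠ 0 := by
      simpa [Algebra.norm_eq_zero_iff] using hx
    positivity
  rw [heightAux, Space.normSqDenom_eq]
  -- At the cusp `∞` the denominator is `N(ρ)² ≥ N(𝔞)²`. At any other cusp, keeping only the terms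
  -- `|σ|² y²` shows that it is at least `N(σ)² N(y)² ≥ N(𝔞)² N(y)²`.
  by_cases h1 : w 1 = 0
  · have h0 : w 0 ≠ 0 := fun h0 ↦ hw (funext fun i ↦ by fin_cases i <;> simp [h0, h1])
    refine le_max_of_le_left ?_
    have hd : ∏ v : InfinitePlace K, Space.denomAt (-w 1) (w 0) v z ^ v.mult =
        (Algebra.norm ℚ (w 0) : ℝ) ^ 2 := by
      rw [← prod_normSq_pow]
      simp [Space.denomAt, h1]
    rw [hd, div_le_iff₀ (hnorm _ h0), mul_comm]
    exact mul_le_mul_of_nonneg_left (key _ (left_mem_idealOf _ _) h0) hy.le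
  · refine le_max_of_le_right ?_
    have hd : (Algebra.norm ℚ (w 1) : ℝ) ^ 2 * normY z ^ 2 ≤
        ∏ v : InfinitePlace K, Space.denomAt (-w 1) (w 0) v z ^ v.mult := by
      rw [← prod_normSq_pow, Space.normY_eq, ← Finset.prod_pow, ← Finset.prod_mul_distrib]
      refine Finset.prod_le_prod (fun v _ ↦ ?_) fun v _ ↦ ?_
      · have := Complex.normSq_nonneg (v.embedding (w 1))
        positivity
      · rw [← pow_mul, mul_comm v.mult, pow_mul, ← mul_pow]
        have h2 := Complex.normSq_nonneg (v.embedding (w 1))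
        gcongr
        rw [Space.denomAt, map_neg, Complex.normSq_neg]
        exact le_add_of_nonneg_left (Complex.normSq_nonneg _)
    have h3 := hnorm _ h1
    calc _ ≤ N ^ 2 * normY z / ((Algebra.norm ℚ (w 1) : ℝ) ^ 2 * normY z ^ 2) := by gcongr
      _ ≤ (Algebra.norm ℚ (w 1) : ℝ) ^ 2 * normY z /
          ((Algebra.norm ℚ (w 1) : ℝ) ^ 2 * normY z ^ 2) := by
        have := key _ (right_mem_idealOf _ _) h1
        gcongr
      _ = (normY z)⁻¹ := by
        rw [mul_div_mul_left _ _ h3.ne', sq, div_mul_cancel_left₀ hy.ne']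

/-- Moving `x` by at most `2 t` costs a factor `2` and a term `8 t² |c|²`; the vertical part costs
`t² |c|²` more. Since `1 ≤ t² y²` at `z`, the sum `9 t² |c|²` is at most `9 t⁴ |c|² y²`. The
constant does not depend on `c` and `d`. -/
theorem Space.denomAt_le_mul (c d : K) (v : InfinitePlace K) {z w : Space K} {t : ℝ}
    (hz : size z ≤ t) (hw : size w ≤ t) :
    denomAt c d v w ≤ (2 + 9 * t ^ 4) * denomAt c d v z := by
  have ht : 0 ≤ t := (size_nonneg z).trans hz
  have hyz := yAt_pos v z
  have hyw := yAt_pos v w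
  have h1 : (yAt v z)⁻¹ ≤ t := (inv_yAt_le_size v z).trans hz
  have h2 : yAt v w ≤ t := (yAt_le_size v w).trans hw
  have h3 : ‖xAt v w - xAt v z‖ ≤ 2 * t := by
    have := norm_sub_le (xAt v w) (xAt v z)
    have := (norm_xAt_le_size v w).trans hw
    have := (norm_xAt_le_size v z).trans hz
    linarith
  set C := v.embedding c
  set D := v.embedding d
  have h4 : Complex.normSq (C * xAt v w + D) ≤
      2 * Complex.normSq (C * xAt v z + D) + 2 * (Complex.normSq C * (2 * t) ^ 2) := by
    have e : C * xAt v w + D = (C * xAt v z + D) + C * (xAt v w - xAt v z) := by ring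
    simp only [Complex.normSq_eq_norm_sq]
    have h5 : ‖C * xAt v w + D‖ ≤ ‖C * xAt v z + D‖ + ‖C‖ * (2 * t) := by
      rw [e]
      refine (norm_add_le _ _).trans ?_
      rw [norm_mul]
      gcongr
    calc ‖C * xAt v w + D‖ ^ 2 ≤ (‖C * xAt v z + D‖ + ‖C‖ * (2 * t)) ^ 2 := by gcongr
      _ ≤ _ := by nlinarith [sq_nonneg (‖C * xAt v z + D‖ - ‖C‖ * (2 * t))]
  have h6 : 1 ≤ t ^ 2 * yAt v z ^ 2 := by
    rw [← mul_pow]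
    refine one_le_pow₀ ?_
    rwa [inv_le_iff_one_le_mul₀ hyz] at h1
  have hC := Complex.normSq_nonneg C
  have hE := Complex.normSq_nonneg (C * xAt v z + D)
  have h7 : Complex.normSq C * yAt v w ^ 2 ≤ Complex.normSq C * t ^ 2 := by gcongr
  have h8 : Complex.normSq C * (9 * t ^ 2) * 1 ≤
      Complex.normSq C * (9 * t ^ 2) * (t ^ 2 * yAt v z ^ 2) := by gcongr
  have h9 : 0 ≤ Complex.normSq C * yAt v z ^ 2 := by positivity
  have h10 : 0 ≤ 9 * t ^ 4 * Complex.normSq (C * xAt v z + D) := by positivity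
  change Complex.normSq (C * xAt v w + D) + Complex.normSq C * yAt v w ^ 2 ≤
    (2 + 9 * t ^ 4) * (Complex.normSq (C * xAt v z + D) + Complex.normSq C * yAt v z ^ 2)
  nlinarith

theorem Space.normY_le_of_size_le {z : Space K} {t : ℝ} (hz : size z ≤ t) :
    normY z ≤ t ^ Module.finrank ℚ K := by
  rw [normY_eq, ← sum_mult_eq, ← Finset.prod_pow_eq_pow_sum]
  refine Finset.prod_le_prod (fun v _ ↦ (pow_pos (yAt_pos v z) _).le) fun v _ ↦ ?_
  have := yAt_pos v z
  gcongr
  exact (yAt_le_size v z).trans hz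

theorem Space.inv_normY_le_of_size_le {z : Space K} {t : ℝ} (hz : size z ≤ t) :
    (normY z)⁻¹ ≤ t ^ Module.finrank ℚ K := by
  rw [normY_eq, ← sum_mult_eq, ← Finset.prod_pow_eq_pow_sum, ← Finset.prod_inv_distrib]
  refine Finset.prod_le_prod (fun v _ ↦ (inv_pos.2 (pow_pos (yAt_pos v z) _)).le) fun v _ ↦ ?_
  have := yAt_pos v z
  rw [← inv_pow]
  gcongr
  exact (inv_yAt_le_size v z).trans hz

theorem height_le_of_size_le (lam : ℙ K (Fin 2 → K)) {z : Space K} {t : ℝ}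
    (hz : Space.size z ≤ t) : height lam z ≤ t ^ Module.finrank ℚ K :=
  (height_le lam z).trans (max_le (Space.normY_le_of_size_le hz) (Space.inv_normY_le_of_size_le hz))

/-- On a bounded set, the values of the height at two points are comparable, uniformly in the
cusp. -/
theorem exists_height_le_mul (t : ℝ) : ∃ C : ℝ, 0 < C ∧ ∀ (lam : ℙ K (Fin 2 → K)) (z w : Space K),
    Space.size z ≤ t → Space.size w ≤ t → height lam z ≤ C * height lam w := by
  set n := Module.finrank ℚ K
  refine ⟨(2 + 9 * t ^ 4) ^ n * ((t ^ 2) ^ n + 1), by positivity, fun lam z w hz hw ↦ ?_⟩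
  induction lam using Projectivization.ind with | _ p hp =>
  change heightAux p z ≤ _ * heightAux p w
  have h : -p 1 ≠ 0 ∨ p 0 ≠ 0 := by
    by_contra! h
    exact hp (funext fun i ↦ by fin_cases i <;> simp [h.2, neg_eq_zero.1 h.1])
  have hdz := Space.normSqDenom_pos h z
  have hdw := Space.normSqDenom_pos h w
  have hyz := Space.normY_pos z
  have hyw := Space.normY_pos w
  have h1 : normSqDenom (-p 1) (p 0) w ≤ (2 + 9 * t ^ 4) ^ n * normSqDenom (-p 1) (p 0) z := by
    rw [Space.normSqDenom_eq, Space.normSqDenom_eq, show n = _ from (sum_mult_eq (K := K)).symm,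
      ← Finset.prod_pow_eq_pow_sum, ← Finset.prod_mul_distrib]
    refine Finset.prod_le_prod (fun v _ ↦ (pow_pos (Space.denomAt_pos h v w) _).le) fun v _ ↦ ?_
    rw [← mul_pow]
    have := Space.denomAt_pos h v w
    gcongr
    exact Space.denomAt_le_mul _ _ v hz hw
  have h2 : normY z ≤ ((t ^ 2) ^ n + 1) * normY w := by
    have e1 := Space.normY_le_of_size_le hz
    have e2 := Space.inv_normY_le_of_size_le hw
    have e3 : normY z * (normY w)⁻¹ ≤ (t ^ 2) ^ n := by
      rw [sq, mul_pow]
      gcongr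
      exact hyz.le.trans e1
    rw [← div_eq_mul_inv, div_le_iff₀ hyw] at e3
    linarith
  unfold heightAux
  set N : ℝ := ((idealOf (p 0) (p 1)).absNorm : ℝ)
  rw [mul_div_assoc', div_le_div_iff₀ hdz hdw]
  have hN0 : 0 ≤ N := Rat.cast_nonneg.2 (FractionalIdeal.absNorm_nonneg _)
  calc N ^ 2 * normY z * normSqDenom (-p 1) (p 0) w ≤
      N ^ 2 * (((t ^ 2) ^ n + 1) * normY w) *
        ((2 + 9 * t ^ 4) ^ n * normSqDenom (-p 1) (p 0) z) := by gcongr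
    _ = _ := by ring

end HilbertModular

/-! ### Unfolding sums over cosets. -/

/-- A group is the product of a subgroup and the set of its right cosets. -/
def rightCosetEquiv {G : Type*} [Group G] (H : Subgroup G) :
    G ≃ Quotient (QuotientGroup.rightRel H) × H where
  toFun g := (Quotient.mk _ g, ⟨g * (Quotient.mk (QuotientGroup.rightRel H) g).out⁻¹,
    QuotientGroup.rightRel_apply.1 (Quotient.mk_out g)⟩)
  invFun p := p.2 * p.1.out
  left_inv g := by simp
  right_inv p := by
    have h : (Quotient.mk (QuotientGroup.rightRel H) (p.2 * p.1.out)) = p.1 := by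
      conv_rhs => rw [← p.1.out_eq]
      refine Quotient.sound (QuotientGroup.rightRel_apply.2 ?_)
      simp
    refine Prod.ext h (Subtype.ext ?_)
    simp [h]

theorem tsum_indicator_const_of_finite {ι M : Type*} [AddCommMonoid M] [TopologicalSpace M]
    {s : Set ι} (hs : s.Finite) (x : M) : ∑' i, s.indicator (fun _ ↦ x) i = s.ncard • x := by
  rw [tsum_eq_sum (s := hs.toFinset) fun i hi ↦
      Set.indicator_of_notMem (fun h ↦ hi (hs.mem_toFinset.2 h)) _,
    Finset.sum_congr rfl fun i hi ↦ Set.indicator_of_mem (hs.mem_toFinset.1 hi) _,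
    Finset.sum_const, Set.ncard_eq_toFinset_card _ hs]

namespace HilbertModular

variable {K : Type*} [Field K] [NumberField K]

/-- The cosets `Γ_λ \ Γ`. -/
abbrev CuspCosets (lam : ℙ K (Fin 2 → K)) : Type _ :=
  Quotient (QuotientGroup.rightRel (MulAction.stabilizer (modularGroup K) lam))

theorem height_stabilizer_smul {lam : ℙ K (Fin 2 → K)}
    (δ : MulAction.stabilizer (modularGroup K) lam) (z : Space K) :
    height lam ((δ : modularGroup K) • z) = height lam z := by
  have h := height_smul (δ : modularGroup K) lam z
  rwa [MulAction.mem_stabilizer_iff.1 δ.2] at h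

theorem eisensteinTerm_eq (lam : ℙ K (Fin 2 → K)) (s : ℂ) (z : Space K) (c : CuspCosets lam) :
    eisensteinTerm lam s z c = (height lam (c.out • z) : ℂ) ^ s := by
  conv_lhs => rw [← c.out_eq]
  rfl

variable {A : SL(2, K)} {lam : ℙ K (Fin 2 → K)}
  (α : Module.Basis (Fin (Module.finrank ℚ K)) ℤ
    (((idealOf (A 0 0) (A 1 0)) ^ 2)⁻¹ : FractionalIdeal (𝓞 K)⁰ K))
  {ε : Fin (Units.rank K) → (𝓞 K)ˣ}

/-- The sum has `ω / 2` equal nonzero terms at most; the factor `2` avoids division, so one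
statement serves both `ENNReal` and `ℂ`. -/
theorem tsum_stabilizer_indicator {M : Type*} [AddCommMonoid M] [TopologicalSpace M]
    (hA : IsAssociated A lam) (hε : IsFundamentalSystem ε) {Φ : Space K → M}
    (hΦ : ∀ (δ : MulAction.stabilizer (modularGroup K) lam) z, Φ ((δ : modularGroup K) • z) = Φ z)
    (z : Space K) :
    2 • ∑' δ : MulAction.stabilizer (modularGroup K) lam,
      (cuspBox A (fun j ↦ (α j : K)) ε).indicator Φ ((δ : modularGroup K) • z) =
      Units.torsionOrder K • Φ z := by
  obtain ⟨h1, h2⟩ := finite_stabilizer_smul_mem_cuspBox α hA hε z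
  rw [← h2, mul_smul, ← tsum_indicator_const_of_finite h1]
  have key : ∀ δ : MulAction.stabilizer (modularGroup K) lam,
      (cuspBox A (fun j ↦ (α j : K)) ε).indicator Φ ((δ : modularGroup K) • z) =
      {δ : MulAction.stabilizer (modularGroup K) lam |
        (δ : modularGroup K) • z ∈ cuspBox A (fun j ↦ (α j : K)) ε}.indicator (fun _ ↦ Φ z) δ := by
    classical
    intro δ
    rw [Set.indicator_apply, Set.indicator_apply, hΦ]
    rfl
  simp only [key]

/-- Sum over `Γ` coset by coset: inside each coset of `Γ_λ` the indicator is met `ω / 2` times. -/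
theorem tsum_indicator_ennreal (hA : IsAssociated A lam) (hε : IsFundamentalSystem ε)
    {Φ : Space K → ENNReal}
    (hΦ : ∀ (δ : MulAction.stabilizer (modularGroup K) lam) z, Φ ((δ : modularGroup K) • z) = Φ z)
    (z : Space K) :
    2 * ∑' γ : modularGroup K, (cuspBox A (fun j ↦ (α j : K)) ε).indicator Φ (γ • z) =
      Units.torsionOrder K * ∑' c : CuspCosets lam, Φ (c.out • z) := by
  rw [← (rightCosetEquiv (MulAction.stabilizer (modularGroup K) lam)).symm.tsum_eq,
    ENNReal.tsum_prod', ← ENNReal.tsum_mul_left, ← ENNReal.tsum_mul_left]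
  refine tsum_congr fun c ↦ ?_
  have h := tsum_stabilizer_indicator α hA hε hΦ (c.out • z)
  rw [nsmul_eq_mul, nsmul_eq_mul] at h
  rw [← h]
  congr 1
  refine tsum_congr fun δ ↦ ?_
  rw [← mul_smul]
  rfl

theorem tsum_indicator_complex (hA : IsAssociated A lam) (hε : IsFundamentalSystem ε)
    {Φ : Space K → ℂ}
    (hΦ : ∀ (δ : MulAction.stabilizer (modularGroup K) lam) z, Φ ((δ : modularGroup K) • z) = Φ z)
    (z : Space K) (hs : Summable fun c : CuspCosets lam ↦ Φ (c.out • z)) :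
    2 * ∑' γ : modularGroup K, (cuspBox A (fun j ↦ (α j : K)) ε).indicator Φ (γ • z) =
      Units.torsionOrder K * ∑' c : CuspCosets lam, Φ (c.out • z) := by
  -- The nonnegative version, applied to norms, gives the absolute convergence that permits the
  -- rearrangement.
  have hne : ∑' γ : modularGroup K,
      (cuspBox A (fun j ↦ (α j : K)) ε).indicator (fun z ↦ ‖Φ z‖ₑ) (γ • z) ≠ ⊤ := by
    have h := tsum_indicator_ennreal α hA hε (Φ := fun z ↦ ‖Φ z‖ₑ)
      (fun δ z ↦ by rw [hΦ]) z
    have h2 : ∑' c : CuspCosets lam, ‖Φ (c.out • z)‖ₑ ≠ ⊤ := by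
      have := hs.norm
      rw [← tsum_enorm_ne_top_iff_summable_norm] at this
      exact this
    intro h3
    rw [h3, ENNReal.mul_top two_ne_zero] at h
    exact ENNReal.mul_ne_top (ENNReal.natCast_ne_top _) h2 h.symm
  have hsum : Summable fun γ : modularGroup K ↦
      (cuspBox A (fun j ↦ (α j : K)) ε).indicator Φ (γ • z) := by
    refine Summable.of_norm (tsum_enorm_ne_top_iff_summable_norm.1 ?_)
    simpa only [enorm_indicator_eq_indicator_enorm] using hne
  let e := (rightCosetEquiv (MulAction.stabilizer (modularGroup K) lam)).symm
  rw [← e.tsum_eq]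
  refine (congrArg (2 * ·) (e.summable_iff.2 hsum).tsum_prod).trans ?_
  rw [← tsum_mul_left, ← tsum_mul_left]
  refine tsum_congr fun c ↦ ?_
  have h := tsum_stabilizer_indicator α hA hε hΦ (c.out • z)
  rw [nsmul_eq_mul, nsmul_eq_mul] at h
  rw [← h]
  push_cast
  congr 1
  refine tsum_congr fun δ ↦ ?_
  rw [← mul_smul]
  rfl

/-! ### Integration in the local coordinates -/

theorem measurePreserving_smul_starMap (hε : IsFundamentalSystem ε) :
    MeasurePreserving (fun p ↦ A • starMap A (fun j ↦ (α j : K)) ε p)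
      (ENNReal.ofReal (jacobian K) • volume.prod heightMeasure) volume :=
  (Space.measurePreserving_smul A).comp (measurePreserving_starMap A α hε)

theorem measurableEmbedding_smul_starMap (hε : IsFundamentalSystem ε) :
    MeasurableEmbedding (fun p ↦ A • starMap A (fun j ↦ (α j : K)) ε p) :=
  (measurePreserving_smul_starMap α hε).measurable.measurableEmbedding
    ((MulAction.injective A).comp (starMap_bijective α hε).1)

variable (K) in
theorem coordBox_eq : coordBox K = ((Set.univ.pi fun _ ↦ Set.Ico (-(1 / 2) : ℝ) (1 / 2)) ×ˢ
    (Set.univ.pi fun _ ↦ Set.Ico (-(1 / 2) : ℝ) (1 / 2))) ×ˢ Set.univ := by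
  ext p
  simp [coordBox]

theorem measurableSet_coordBox : MeasurableSet (coordBox K) := by
  rw [coordBox_eq]
  exact ((MeasurableSet.univ_pi fun _ ↦ measurableSet_Ico).prod
    (MeasurableSet.univ_pi fun _ ↦ measurableSet_Ico)).prod MeasurableSet.univ

theorem measurableSet_cuspBox (hε : IsFundamentalSystem ε) :
    MeasurableSet (cuspBox A (fun j ↦ (α j : K)) ε) :=
  (measurableEmbedding_smul_starMap α hε).measurableSet_image.2 measurableSet_coordBox

theorem indicator_cuspBox_comp {M : Type*} [Zero M] (hε : IsFundamentalSystem ε)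
    (Φ : Space K → M) (p : ((Fin (Module.finrank ℚ K) → ℝ) × (Fin (Units.rank K) → ℝ)) × ℝ) :
    (cuspBox A (fun j ↦ (α j : K)) ε).indicator Φ (A • starMap A (fun j ↦ (α j : K)) ε p) =
      (coordBox K).indicator (fun p ↦ Φ (A • starMap A (fun j ↦ (α j : K)) ε p)) p := by
  by_cases h : p ∈ coordBox K
  · rw [Set.indicator_of_mem h, Set.indicator_of_mem
      ((smul_starMap_mem_cuspBox_iff α hε p).2 h)]
  · rw [Set.indicator_of_notMem h, Set.indicator_of_notMem
      (mt (smul_starMap_mem_cuspBox_iff α hε p).1 h)]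

theorem height_smul_starMap (hA : IsAssociated A lam)
    (p : ((Fin (Module.finrank ℚ K) → ℝ) × (Fin (Units.rank K) → ℝ)) × ℝ) :
    height lam (A • starMap A (fun j ↦ (α j : K)) ε p) = Real.exp p.2 :=
  height_localPoint hA _ _ _ _ _ _

/-- The integrand is `e^((σ - 1) τ)`, which decays as `τ → -∞` because `σ > 1`. This is the source
of the half-plane of convergence. -/
theorem lintegral_exp_heightMeasure_lt_top {σ : ℝ} (hσ : 1 < σ) (B : ℝ) :
    ∫⁻ τ in Set.Iic B, ENNReal.ofReal (Real.exp τ ^ σ) ∂heightMeasure < ⊤ := by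
  have h := (integrableOn_exp_mul_Iic (sub_pos.2 hσ) B).lintegral_lt_top
  rw [heightMeasure, restrict_withDensity measurableSet_Iic,
    lintegral_withDensity_eq_lintegral_mul _ (by fun_prop) (by fun_prop)]
  refine lt_of_eq_of_lt (lintegral_congr fun τ ↦ ?_) h
  rw [Pi.mul_apply, ← ENNReal.ofReal_mul (Real.exp_pos _).le, ← Real.exp_mul, ← Real.exp_add]
  congr 2
  ring

variable (K) in
theorem volume_box_lt_top : volume (((Set.univ.pi fun _ ↦ Set.Ico (-(1 / 2) : ℝ) (1 / 2)) ×ˢ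
    (Set.univ.pi fun _ ↦ Set.Ico (-(1 / 2) : ℝ) (1 / 2))) :
    Set ((Fin (Module.finrank ℚ K) → ℝ) × (Fin (Units.rank K) → ℝ))) < ⊤ := by
  rw [Measure.volume_eq_prod, Measure.prod_prod, Real.volume_pi_Ico, Real.volume_pi_Ico]
  exact ENNReal.mul_lt_top (ENNReal.prod_lt_top fun _ _ ↦ ENNReal.ofReal_lt_top)
    (ENNReal.prod_lt_top fun _ _ ↦ ENNReal.ofReal_lt_top)

theorem lintegral_cuspBox_lt_top (hA : IsAssociated A lam) (hε : IsFundamentalSystem ε) {σ : ℝ}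
    (hσ : 1 < σ) {B : ℝ} (hB : 0 < B) :
    ∫⁻ z, (cuspBox A (fun j ↦ (α j : K)) ε).indicator ({z | height lam z ≤ B}.indicator
      fun z ↦ ENNReal.ofReal (height lam z ^ σ)) z < ⊤ := by
  rw [← (measurePreserving_smul_starMap α hε).lintegral_comp_emb
    (measurableEmbedding_smul_starMap α hε), lintegral_smul_measure]
  refine ENNReal.mul_lt_top ENNReal.ofReal_lt_top ?_
  have h : ∀ p : ((Fin (Module.finrank ℚ K) → ℝ) × (Fin (Units.rank K) → ℝ)) × ℝ,
      (cuspBox A (fun j ↦ (α j : K)) ε).indicator ({z | height lam z ≤ B}.indicator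
        fun z ↦ ENNReal.ofReal (height lam z ^ σ)) (A • starMap A (fun j ↦ (α j : K)) ε p) =
      (((Set.univ.pi fun _ ↦ Set.Ico (-(1 / 2) : ℝ) (1 / 2)) ×ˢ
        (Set.univ.pi fun _ ↦ Set.Ico (-(1 / 2) : ℝ) (1 / 2))).indicator (fun _ ↦ 1) p.1) *
      (Set.Iic (Real.log B)).indicator (fun τ ↦ ENNReal.ofReal (Real.exp τ ^ σ)) p.2 := by
    classical
    intro p
    rw [indicator_cuspBox_comp α hε, coordBox_eq]
    simp only [Set.indicator_apply, Set.mem_prod, Set.mem_univ, and_true, Set.mem_ofPred_eq,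
      height_smul_starMap α hA, Set.mem_Iic, Real.le_log_iff_exp_le hB, ite_mul, one_mul, zero_mul]
  simp only [h]
  have hm : MeasurableSet ((Set.univ.pi fun _ ↦ Set.Ico (-(1 / 2) : ℝ) (1 / 2)) ×ˢ
      (Set.univ.pi fun _ ↦ Set.Ico (-(1 / 2) : ℝ) (1 / 2)) :
      Set ((Fin (Module.finrank ℚ K) → ℝ) × (Fin (Units.rank K) → ℝ))) :=
    (MeasurableSet.univ_pi fun _ ↦ measurableSet_Ico).prod
      (MeasurableSet.univ_pi fun _ ↦ measurableSet_Ico)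
  rw [lintegral_prod_mul ((measurable_const.indicator hm).aemeasurable)
    (Measurable.indicator (by fun_prop) measurableSet_Iic).aemeasurable,
    lintegral_indicator hm, lintegral_indicator measurableSet_Iic, setLIntegral_one]
  exact ENNReal.mul_lt_top (volume_box_lt_top K) (lintegral_exp_heightMeasure_lt_top hσ _)

end HilbertModular

/-! ### Absolute convergence of the Eisenstein series. -/

namespace HilbertModular

variable {K : Type*} [Field K] [NumberField K]

instance : Countable (CuspCosets (K := K) lam) := Quotient.countable

/-- If some translate of `w` lies in the bounded set, take it as base point; every other one then
comes from an element of the finite set in `Space.finite_smul`. -/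
theorem tsum_indicator_size_le (t : ℝ) (w : Space K) :
    ∑' γ : modularGroup K, {z : Space K | Space.size z ≤ t}.indicator (1 : Space K → ENNReal) (γ • w) ≤
      ((Space.finite_smul (K := K) t).toFinset.card : ENNReal) := by
  classical
  by_cases h : ∃ γ₀ : modularGroup K, Space.size (γ₀ • w) ≤ t
  · obtain ⟨γ₀, h0⟩ := h
    rw [← (Equiv.mulRight γ₀).tsum_eq]
    calc _ ≤ ∑' γ : modularGroup K, {γ : modularGroup K | ∃ z, Space.size z ≤ t ∧
          Space.size (γ • z) ≤ t}.indicator (fun _ ↦ (1 : ENNReal)) γ := by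
          refine ENNReal.tsum_le_tsum fun γ ↦ ?_
          rw [Set.indicator_apply]
          split_ifs with h
          · rw [Set.indicator_of_mem]
            · rfl
            · refine ⟨γ₀ • w, h0, ?_⟩
              rw [← mul_smul]
              exact h
          · exact zero_le
      _ = _ := by
          rw [tsum_indicator_const_of_finite (Space.finite_smul t),
            Set.ncard_eq_toFinset_card _ (Space.finite_smul t), nsmul_eq_mul, mul_one]
  · push Not at h
    have : ∀ γ : modularGroup K,
        {z : Space K | Space.size z ≤ t}.indicator (1 : Space K → ENNReal) (γ • w) = 0 := fun γ ↦
      Set.indicator_of_notMem (show γ • w ∉ {z : Space K | Space.size z ≤ t} from not_le.2 (h γ)) _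
    simp [this]

theorem measurableSet_size_le (t : ℝ) : MeasurableSet {z : Space K | Space.size z ≤ t} :=
  measurableSet_le Space.continuous_size.measurable measurable_const

/-- By invariance each `γ` can be moved from `H` to the indicator of the bounded set, and the sum of
these indicators is bounded by the overlap number. -/
theorem setLIntegral_tsum_smul_le (t : ℝ) {H : Space K → ENNReal} (hH : Measurable H) :
    ∫⁻ w in {z : Space K | Space.size z ≤ t}, ∑' γ : modularGroup K, H (γ • w) ≤
      (Space.finite_smul (K := K) t).toFinset.card * ∫⁻ w, H w := by
  have hU := measurableSet_size_le (K := K) t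
  set U : Set (Space K) := {z : Space K | Space.size z ≤ t} with hUdef
  have hHγ : ∀ γ : modularGroup K, Measurable fun w ↦ H (γ • w) := fun γ ↦
    hH.comp (measurable_const_smul γ)
  have hm : ∀ γ : modularGroup K, Measurable fun w ↦
      U.indicator (1 : Space K → ENNReal) (γ⁻¹ • w) * H w := fun γ ↦
    ((measurable_one.indicator hU).comp (measurable_const_smul γ⁻¹)).mul hH
  have h1 : ∀ γ : modularGroup K, ∫⁻ w in U, H (γ • w) =
      ∫⁻ w, U.indicator (1 : Space K → ENNReal) (γ⁻¹ • w) * H w := fun γ ↦ by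
    rw [← lintegral_indicator hU, ← (measurePreserving_smul γ volume).lintegral_comp (hm γ)]
    refine lintegral_congr fun w ↦ ?_
    rw [inv_smul_smul]
    by_cases hw : w ∈ U <;> simp [hw]
  rw [lintegral_tsum fun γ ↦ (hHγ γ).aemeasurable, tsum_congr h1,
    ← lintegral_tsum fun γ ↦ (hm γ).aemeasurable, ← lintegral_const_mul _ hH]
  refine lintegral_mono fun w ↦ ?_
  rw [ENNReal.tsum_mul_right]
  gcongr
  refine le_of_eq_of_le ?_ (tsum_indicator_size_le t w)
  exact (Equiv.inv (modularGroup K)).tsum_eq fun γ ↦ U.indicator (1 : Space K → ENNReal) (γ • w)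

variable {A : SL(2, K)} {lam : ℙ K (Fin 2 → K)} {ε : Fin (Units.rank K) → (𝓞 K)ˣ}

theorem volume_ne_zero : (volume : Measure (Space K)) ≠ 0 := by
  classical
  intro h
  have hΨ := Space.measurePreserving_ofLog (K := K)
  have h1 := hΨ.map_eq
  rw [h, Measure.map_eq_zero_iff hΨ.measurable.aemeasurable] at h1
  have hX : (volume : Measure (mixedEmbedding.mixedSpace K)).IsAddHaarMeasure :=
    Measure.prod.instIsAddHaarMeasure _ _
  have h2 := DFunLike.congr_fun h1 Set.univ
  rw [Measure.coe_zero, Pi.zero_apply] at h2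
  rw [← Set.univ_prod_univ, Measure.prod_prod, mul_eq_zero] at h2
  have hd : Measurable fun t : InfinitePlace K → ℝ ↦
    ENNReal.ofReal (Real.exp (-∑ v, v.mult * t v)) := by fun_prop
  rcases h2 with h2 | h2
  · exact isOpen_univ.measure_ne_zero volume Set.univ_nonempty h2
  · have h3 := withDensity_absolutelyContinuous' (μ := (volume : Measure (InfinitePlace K → ℝ)))
      hd.aemeasurable
      (Filter.Eventually.of_forall fun τ ↦ (ENNReal.ofReal_pos.2 (Real.exp_pos _)).ne')
    exact isOpen_univ.measure_ne_zero volume Set.univ_nonempty (h3 h2)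

theorem exists_volume_size_le_ne_zero (z : Space K) :
    ∃ t : ℝ, 0 < t ∧ Space.size z ≤ t ∧ volume {z : Space K | Space.size z ≤ t} ≠ 0 := by
  by_contra! h
  refine volume_ne_zero (K := K) (Measure.measure_univ_eq_zero.1 ?_)
  have : (Set.univ : Set (Space K)) = ⋃ n : ℕ, {w : Space K | Space.size w ≤ n + 1 + Space.size z} := by
    refine (Set.eq_univ_of_forall fun w ↦ Set.mem_iUnion.2 ?_).symm
    obtain ⟨n, hn⟩ := exists_nat_ge (Space.size w)
    exact ⟨n, show Space.size w ≤ n + 1 + Space.size z by linarith [Space.size_nonneg z]⟩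
  rw [this, measure_iUnion_null_iff]
  intro n
  have := Space.size_nonneg z
  refine h _ (by positivity) ?_
  linarith [(Nat.cast_nonneg n : (0 : ℝ) ≤ n)]

/-- The height of `γ z` at `λ` is that of `z` at `γ⁻¹ λ`, so uniformity in the cusp becomes
uniformity in `γ`. -/
theorem exists_height_smul_le_mul (t : ℝ) : ∃ C : ℝ, 0 < C ∧ ∀ (lam : ℙ K (Fin 2 → K))
    (γ : modularGroup K) (z w : Space K), Space.size z ≤ t → Space.size w ≤ t →
      height lam (γ • z) ≤ C * height lam (γ • w) := by
  obtain ⟨C, hC, h⟩ := exists_height_le_mul (K := K) t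
  refine ⟨C, hC, fun lam γ z w hz hw ↦ ?_⟩
  have e : ∀ z, height lam (γ • z) = height (γ⁻¹ • lam) z := fun z ↦ by
    rw [← height_smul γ (γ⁻¹ • lam) z, smul_inv_smul]
  rw [e, e]
  exact h _ _ _ hz hw

theorem height_smul_le_of_size_le (lam : ℙ K (Fin 2 → K)) (γ : modularGroup K) {z : Space K} {t : ℝ}
    (hz : Space.size z ≤ t) : height lam (γ • z) ≤ t ^ Module.finrank ℚ K := by
  have := height_le_of_size_le (γ⁻¹ • lam) hz
  rwa [← height_smul γ (γ⁻¹ • lam) z, smul_inv_smul] at this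

/-- Were the series infinite at `z`, comparability of heights would make it infinite on a whole
bounded set of positive volume. But its integral there is at most a constant times the integral of
`H`, the power of the height over the box below `B`, which is finite. -/
theorem tsum_height_rpow_ne_top (hA : IsAssociated A lam)
    (α : Module.Basis (Fin (Module.finrank ℚ K)) ℤ
      (((idealOf (A 0 0) (A 1 0)) ^ 2)⁻¹ : FractionalIdeal (𝓞 K)⁰ K))
    (hε : IsFundamentalSystem ε) {σ : ℝ} (hσ : 1 < σ) (z : Space K) :
    ∑' c : CuspCosets lam, ENNReal.ofReal (height lam (c.out • z) ^ σ) ≠ ⊤ := by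
  obtain ⟨t, ht, hz, hvol⟩ := exists_volume_size_le_ne_zero z
  obtain ⟨C, hC, hCle⟩ := exists_height_smul_le_mul (K := K) t
  have hB : 0 < t ^ Module.finrank ℚ K := by positivity
  have hfin := lintegral_cuspBox_lt_top α hA hε hσ hB
  set B := t ^ Module.finrank ℚ K with hBdef
  set Φ : Space K → ENNReal := fun z ↦ ENNReal.ofReal (height lam z ^ σ) with hΦ
  have hΦm : Measurable Φ :=
    ((continuous_height lam).measurable.pow_const σ).ennreal_ofReal
  set H := (cuspBox A (fun j ↦ (α j : K)) ε).indicator ({z | height lam z ≤ B}.indicator Φ) with hH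
  have hHm : Measurable H :=
    (hΦm.indicator (measurableSet_le (continuous_height lam).measurable measurable_const)).indicator
      (measurableSet_cuspBox α hε)
  set S := ∑' c : CuspCosets lam, Φ (c.out • z) with hS
  have h1 : ∀ w : Space K, Space.size w ≤ t →
      Units.torsionOrder K * S ≤
        ENNReal.ofReal (C ^ σ) * (2 * ∑' γ : modularGroup K, H (γ • w)) := by
    intro w hw
    have e1 : S ≤ ENNReal.ofReal (C ^ σ) * ∑' c : CuspCosets lam, Φ (c.out • w) := by
      rw [hS, ← ENNReal.tsum_mul_left]
      refine ENNReal.tsum_le_tsum fun c ↦ ?_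
      rw [hΦ, ← ENNReal.ofReal_mul (by positivity),
        ← Real.mul_rpow hC.le (height_pos _ _).le]
      refine ENNReal.ofReal_le_ofReal ?_
      exact Real.rpow_le_rpow (height_pos _ _).le (hCle _ _ _ _ hz hw) (by linarith)
    have e2 := tsum_indicator_ennreal α hA hε (Φ := Φ)
      (fun δ z ↦ by simp only [hΦ, height_stabilizer_smul]) w
    -- Truncation at `B` changes nothing on the bounded set, as all translates of its points have
    -- height at most `B`.
    have e3 : ∀ γ : modularGroup K,
        H (γ • w) = (cuspBox A (fun j ↦ (α j : K)) ε).indicator Φ (γ • w) := fun γ ↦ by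
      classical
      have h : γ • w ∈ {z | height lam z ≤ B} := height_smul_le_of_size_le lam γ hw
      rw [hH, Set.indicator_apply, Set.indicator_apply, Set.indicator_apply, if_pos h]
    rw [tsum_congr e3, e2, mul_left_comm]
    gcongr
  have h2 : Units.torsionOrder K * S * volume {z : Space K | Space.size z ≤ t} ≤
      ENNReal.ofReal (C ^ σ) * (2 * ((Space.finite_smul (K := K) t).toFinset.card * ∫⁻ w, H w)) := by
    calc _ = ∫⁻ _ in {z : Space K | Space.size z ≤ t}, Units.torsionOrder K * S := by
          rw [setLIntegral_const]
      _ ≤ ∫⁻ w in {z : Space K | Space.size z ≤ t},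
            ENNReal.ofReal (C ^ σ) * (2 * ∑' γ : modularGroup K, H (γ • w)) :=
          setLIntegral_mono' (measurableSet_size_le t) h1
      _ = ENNReal.ofReal (C ^ σ) * (2 * ∫⁻ w in {z : Space K | Space.size z ≤ t},
            ∑' γ : modularGroup K, H (γ • w)) := by
          rw [lintegral_const_mul' _ _ ENNReal.ofReal_ne_top, lintegral_const_mul' _ _ (by simp)]
      _ ≤ _ := by
          gcongr
          exact setLIntegral_tsum_smul_le t hHm
  have h3 : ENNReal.ofReal (C ^ σ) *
      (2 * ((Space.finite_smul (K := K) t).toFinset.card * ∫⁻ w, H w)) ≠ ⊤ :=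
    ENNReal.mul_ne_top ENNReal.ofReal_ne_top (ENNReal.mul_ne_top (by simp)
      (ENNReal.mul_ne_top (ENNReal.natCast_ne_top _) hfin.ne))
  intro hStop
  rw [hStop, ENNReal.mul_top (by exact_mod_cast Units.torsionOrder_ne_zero K),
    ENNReal.top_mul hvol] at h2
  exact h3 (top_le_iff.1 h2)

theorem enorm_height_cpow (lam : ℙ K (Fin 2 → K)) (s : ℂ) (z : Space K) :
    ‖(height lam z : ℂ) ^ s‖ₑ = ENNReal.ofReal (height lam z ^ s.re) := by
  rw [← ofReal_norm, Complex.norm_cpow_eq_rpow_re_of_pos (height_pos _ _)]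

theorem summable_eisensteinTerm (hA : IsAssociated A lam)
    (α : Module.Basis (Fin (Module.finrank ℚ K)) ℤ
      (((idealOf (A 0 0) (A 1 0)) ^ 2)⁻¹ : FractionalIdeal (𝓞 K)⁰ K))
    (hε : IsFundamentalSystem ε) {s : ℂ} (hs : 1 < s.re) (z : Space K) : Summable (eisensteinTerm lam s z) := by
  refine Summable.of_norm (tsum_enorm_ne_top_iff_summable_norm.1 ?_)
  have := tsum_height_rpow_ne_top hA α hε hs z
  simpa only [eisensteinTerm_eq, enorm_height_cpow] using this

end HilbertModular

/-! ### Unfolding the integral over the orbifold. -/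

namespace HilbertModular

variable {K : Type*} [Field K] [NumberField K]

theorem continuous_toOrbifold : Continuous (toOrbifold : Space K → Orbifold K) :=
  continuous_quotient_mk'

theorem isOpenMap_toOrbifold : IsOpenMap (toOrbifold : Space K → Orbifold K) :=
  isOpenMap_quotient_mk'_mul

/-- The height is bounded on the preimage of a compact subset of the orbifold. -/
theorem exists_height_le_of_isCompact {S : Set (Orbifold K)} (hS : IsCompact S) :
    ∃ B : ℝ, 0 < B ∧ ∀ (lam : ℙ K (Fin 2 → K)) (z : Space K), toOrbifold z ∈ S → height lam z ≤ B := by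
  -- These open sets increase to the whole orbifold, so one contains `S`. On it every point has a
  -- bounded representative, and heights of its translates are bounded too.
  let U : ℕ → Set (Orbifold K) := fun n ↦ toOrbifold '' {z : Space K | Space.size z < n}
  have hU : ∀ n, IsOpen (U n) := fun n ↦
    isOpenMap_toOrbifold _ (isOpen_lt Space.continuous_size continuous_const)
  have hmono : Monotone U := fun m n hmn ↦ Set.image_mono fun z (hz : Space.size z < m) ↦
    hz.trans_le (Nat.cast_le.2 hmn)
  have hcover : S ⊆ ⋃ n, U n := by
    intro p _
    induction p using Quotient.inductionOn with | _ z =>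
    obtain ⟨n, hn⟩ := exists_nat_gt (Space.size z)
    exact Set.mem_iUnion.2 ⟨n, z, hn, rfl⟩
  obtain ⟨n, hn⟩ := hS.elim_directed_cover U hU hcover hmono.directed_le
  refine ⟨n ^ Module.finrank ℚ K + 1, by positivity, fun lam z hz ↦ ?_⟩
  obtain ⟨w, hw, hwz⟩ := hn hz
  obtain ⟨γ, rfl⟩ := toOrbifold_eq_iff.1 hwz.symm
  exact (height_smul_le_of_size_le lam γ (le_of_lt hw)).trans (by linarith)

/-- The series of measurable functions is measurable. -/
theorem measurable_tsum_of_summable {ι X : Type*} [Countable ι] [MeasurableSpace X] {g : ι → X → ℂ}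
    (hg : ∀ i, Measurable (g i)) (hs : ∀ x, Summable fun i ↦ g i x) :
    Measurable fun x ↦ ∑' i, g i x := by
  refine measurable_of_tendsto_metrizable' Filter.atTop
    (f := fun (s : Finset ι) x ↦ ∑ i ∈ s, g i x) (fun s ↦ Finset.measurable_sum _ fun i _ ↦ hg i) ?_
  exact tendsto_pi_nhds.2 fun x ↦ (hs x).hasSum

theorem measurable_of_comp_toOrbifold {Y : Type*} [MeasurableSpace Y] {G : Orbifold K → Y}
    (hG : Measurable (G ∘ toOrbifold)) : Measurable G :=
  measurable_from_quotient.2 hG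

theorem measurable_height_cpow (lam : ℙ K (Fin 2 → K)) (s : ℂ) :
    Measurable fun z : Space K ↦ (height lam z : ℂ) ^ s :=
  (Complex.measurable_ofReal.comp (continuous_height lam).measurable).pow_const s

variable {A : SL(2, K)} {lam : ℙ K (Fin 2 → K)}
  (α : Module.Basis (Fin (Module.finrank ℚ K)) ℤ
    (((idealOf (A 0 0) (A 1 0)) ^ 2)⁻¹ : FractionalIdeal (𝓞 K)⁰ K))
  {ε : Fin (Units.rank K) → (𝓞 K)ˣ}

/-- The function on a box at the cusp whose sum over the Hilbert modular group is a multiple of the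
product of `f` and the Eisenstein series. -/
def unfolded (A : SL(2, K)) (α : Fin (Module.finrank ℚ K) → K) (ε : Fin (Units.rank K) → (𝓞 K)ˣ)
    (lam : ℙ K (Fin 2 → K)) (s : ℂ) (f : Orbifold K → ℂ) : Space K → ℂ :=
  (cuspBox A α ε).indicator fun z ↦ (height lam z : ℂ) ^ s * f (toOrbifold z)

theorem two_mul_tsum_unfolded (hA : IsAssociated A lam) (hε : IsFundamentalSystem ε) {s : ℂ}
    (hs : 1 < s.re) (f : Orbifold K → ℂ) (z : Space K) :
    2 * ∑' γ : modularGroup K, unfolded A (fun j ↦ (α j : K)) ε lam s f (γ • z) =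
      Units.torsionOrder K * (eisensteinOrbifold lam s (toOrbifold z) * f (toOrbifold z)) := by
  have hE := summable_eisensteinTerm hA α hε hs z
  have e : ∀ c : CuspCosets lam, (height lam (c.out • z) : ℂ) ^ s * f (toOrbifold (c.out • z)) =
      eisensteinTerm lam s z c * f (toOrbifold z) := fun c ↦ by
    rw [eisensteinTerm_eq, toOrbifold_smul]
  rw [unfolded, tsum_indicator_complex α hA hε (fun δ z ↦ by
    rw [height_stabilizer_smul, toOrbifold_smul]) z (by
      simp only [e]
      exact hE.mul_right _), tsum_congr e, tsum_mul_right]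
  rfl

variable {f : Orbifold K → ℂ}

theorem measurable_unfolded (hε : IsFundamentalSystem ε) (s : ℂ) (hf : Continuous f) :
    Measurable (unfolded A (fun j ↦ (α j : K)) ε lam s f) :=
  ((measurable_height_cpow lam s).mul (hf.comp continuous_toOrbifold).measurable).indicator
    (measurableSet_cuspBox α hε)

/-- Compact support of `f` bounds the height from above on the relevant part of the box, `f` itself
is bounded, and `Re s > 1` handles small heights. -/
theorem integrable_unfolded (hA : IsAssociated A lam) (hε : IsFundamentalSystem ε) {s : ℂ}
    (hs : 1 < s.re) (hf : Continuous f) (hfc : HasCompactSupport f) :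
    Integrable (unfolded A (fun j ↦ (α j : K)) ε lam s f) := by
  refine ⟨(measurable_unfolded α hε s hf).aestronglyMeasurable, ?_⟩
  obtain ⟨B, hB, hheight⟩ := exists_height_le_of_isCompact hfc
  obtain ⟨C, hC⟩ := hfc.exists_bound_of_continuous hf
  have h := lintegral_cuspBox_lt_top α hA hε hs hB
  refine lt_of_le_of_lt (lintegral_mono (g := fun z ↦ ENNReal.ofReal C *
    (cuspBox A (fun j ↦ (α j : K)) ε).indicator ({z | height lam z ≤ B}.indicator
      fun z ↦ ENNReal.ofReal (height lam z ^ s.re)) z) fun z ↦ ?_) ?_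
  · classical
    beta_reduce
    rw [unfolded, enorm_indicator_eq_indicator_enorm, Set.indicator_apply, Set.indicator_apply]
    split_ifs with hz
    · by_cases hfz : f (toOrbifold z) = 0
      · simp [hfz]
      · have hz' : z ∈ {z | height lam z ≤ B} := hheight lam z (subset_tsupport f hfz)
        rw [Set.indicator_of_mem hz', enorm_mul, enorm_height_cpow, mul_comm]
        gcongr
        rw [← ofReal_norm]
        exact ENNReal.ofReal_le_ofReal (hC _)
    · exact zero_le
  · rw [lintegral_const_mul' _ _ ENNReal.ofReal_ne_top]
    exact ENNReal.mul_lt_top ENNReal.ofReal_lt_top h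

theorem eisenstein_mul_eq_tsum (hA : IsAssociated A lam) (hε : IsFundamentalSystem ε) {s : ℂ}
    (hs : 1 < s.re) (f : Orbifold K → ℂ) (z : Space K) :
    eisensteinOrbifold lam s (toOrbifold z) * f (toOrbifold z) =
      (2 / Units.torsionOrder K : ℂ) *
        ∑' γ : modularGroup K, unfolded A (fun j ↦ (α j : K)) ε lam s f (γ • z) := by
  have h0 : (Units.torsionOrder K : ℂ) ≠ 0 := by exact_mod_cast Units.torsionOrder_ne_zero K
  rw [div_mul_eq_mul_div, two_mul_tsum_unfolded α hA hε hs, mul_div_cancel_left₀ _ h0]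

theorem measurable_eisenstein_mul (α : Module.Basis (Fin (Module.finrank ℚ K)) ℤ
      (((idealOf (A 0 0) (A 1 0)) ^ 2)⁻¹ : FractionalIdeal (𝓞 K)⁰ K))
    (hA : IsAssociated A lam) (hε : IsFundamentalSystem ε) {s : ℂ}
    (hs : 1 < s.re) (hf : Continuous f) :
    Measurable fun p ↦ eisensteinOrbifold lam s p * f p := by
  refine measurable_of_comp_toOrbifold (Measurable.mul ?_ (hf.comp continuous_toOrbifold).measurable)
  refine measurable_tsum_of_summable (fun c ↦ ?_) fun z ↦ summable_eisensteinTerm hA α hε hs z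
  simp only [eisensteinTerm_eq]
  exact (measurable_height_cpow lam s).comp (measurable_const_smul c.out)

theorem tsum_lintegral_unfolded_ne_top (hA : IsAssociated A lam) (hε : IsFundamentalSystem ε) {s : ℂ}
    (hs : 1 < s.re) (hf : Continuous f) (hfc : HasCompactSupport f) :
    ∑' γ : modularGroup K, ∫⁻ z in fundamentalSet K,
      ‖unfolded A (fun j ↦ (α j : K)) ε lam s f (γ • z)‖ₑ ≠ ⊤ := by
  rw [← isFundamentalDomain_fundamentalSet.lintegral_eq_tsum'' fun z ↦
    ‖unfolded A (fun j ↦ (α j : K)) ε lam s f z‖ₑ]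
  exact (integrable_unfolded α hA hε hs hf hfc).2.ne

/-- The product is dominated by the sum of the norms of all translates of the unfolded function,
whose integral over the fundamental domain is its integral over the whole space. -/
theorem integrable_eisenstein_mul (α : Module.Basis (Fin (Module.finrank ℚ K)) ℤ
      (((idealOf (A 0 0) (A 1 0)) ^ 2)⁻¹ : FractionalIdeal (𝓞 K)⁰ K))
    (hA : IsAssociated A lam) (hε : IsFundamentalSystem ε) {s : ℂ}
    (hs : 1 < s.re) (hf : Continuous f) (hfc : HasCompactSupport f) :
    Integrable (fun p ↦ eisensteinOrbifold lam s p * f p) (orbifoldVolume K) := by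
  have hm := measurable_eisenstein_mul α hA hε hs hf
  rw [orbifoldVolume_eq, integrable_map_measure hm.aestronglyMeasurable
    measurable_toOrbifold.aemeasurable]
  refine ⟨(hm.comp measurable_toOrbifold).aestronglyMeasurable, ?_⟩
  have h := tsum_lintegral_unfolded_ne_top α hA hε hs hf hfc
  have hmu : ∀ γ : modularGroup K, Measurable fun z ↦
      unfolded A (fun j ↦ (α j : K)) ε lam s f (γ • z) := fun γ ↦
    (measurable_unfolded (lam := lam) α hε s hf).comp (measurable_const_smul γ)
  rw [← lintegral_tsum fun γ ↦ (hmu γ).enorm.aemeasurable] at h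
  refine lt_of_le_of_lt (lintegral_mono (g := fun z ↦ ‖(2 / Units.torsionOrder K : ℂ)‖ₑ *
    ∑' γ : modularGroup K, ‖unfolded A (fun j ↦ (α j : K)) ε lam s f (γ • z)‖ₑ) fun z ↦ ?_) ?_
  · change ‖eisensteinOrbifold lam s (toOrbifold z) * f (toOrbifold z)‖ₑ ≤ _
    rw [eisenstein_mul_eq_tsum α hA hε hs, enorm_mul]
    beta_reduce
    gcongr
    exact enorm_tsum_le_tsum_enorm
  · rw [lintegral_const_mul' _ _ enorm_ne_top]
    exact ENNReal.mul_lt_top enorm_lt_top h.lt_top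

/-- The translates of the fundamental domain tile the space, so the sum over `Γ` under the integral
becomes an integral over everything. -/
theorem integral_eisenstein_mul (hA : IsAssociated A lam) (hε : IsFundamentalSystem ε) {s : ℂ}
    (hs : 1 < s.re) (hf : Continuous f) (hfc : HasCompactSupport f) :
    ∫ p, eisensteinOrbifold lam s p * f p ∂(orbifoldVolume K) =
      (2 / Units.torsionOrder K : ℂ) * ∫ z, unfolded A (fun j ↦ (α j : K)) ε lam s f z := by
  have hm := measurable_eisenstein_mul α hA hε hs hf
  have hmu : ∀ γ : modularGroup K, Measurable fun z ↦
      unfolded A (fun j ↦ (α j : K)) ε lam s f (γ • z) := fun γ ↦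
    (measurable_unfolded (lam := lam) α hε s hf).comp (measurable_const_smul γ)
  rw [orbifoldVolume_eq, integral_map measurable_toOrbifold.aemeasurable hm.aestronglyMeasurable]
  simp only [eisenstein_mul_eq_tsum α hA hε hs]
  rw [integral_const_mul, isFundamentalDomain_fundamentalSet.integral_eq_tsum'' _
    (integrable_unfolded α hA hε hs hf hfc), integral_tsum
      (fun γ ↦ (hmu γ).aestronglyMeasurable) (tsum_lintegral_unfolded_ne_top α hA hε hs hf hfc)]

end HilbertModular

/-! ### The Mellin transform and the constant. -/

namespace HilbertModular

variable {K : Type*} [Field K] [NumberField K]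

theorem heightMeasure_map_exp : heightMeasure.map Real.exp =
    (volume.restrict (Set.Ioi 0)).withDensity fun q ↦ ((1 / q ^ 2 : ℝ).toNNReal : ENNReal) := by
  have := map_exp_withDensity 1
  simp only [Nat.cast_one, one_mul] at this
  exact this

/-- The measure `e^(-τ) dτ` is `dq / q²`, and `q^s m dq / q² = q^(s - 1) (m / q) dq`; hence the
factor `q⁻¹` in front of the mean. -/
theorem cpow_smul_eq {q : ℝ} (hq : 0 < q) (s m : ℂ) :
    (1 / q ^ 2 : ℝ).toNNReal • ((q : ℂ) ^ s * m) = (q : ℂ) ^ (s - 1) • ((q : ℂ)⁻¹ * m) := by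
  have hq' : (q : ℂ) ≠ 0 := by exact_mod_cast hq.ne'
  rw [NNReal.smul_def, Real.coe_toNNReal _ (by positivity), Complex.real_smul,
    _root_.smul_eq_mul, Complex.cpow_sub _ _ hq', Complex.cpow_one]
  push_cast
  field_simp

/-- The Mellin transform in the logarithmic coordinate. -/
theorem mellin_of_integrable_heightMeasure {m : ℝ → ℂ} {s : ℂ}
    (h : Integrable (fun τ ↦ (Real.exp τ : ℂ) ^ s * m (Real.exp τ)) heightMeasure) :
    MellinConvergent (fun q ↦ (q : ℂ)⁻¹ * m q) s ∧
      ∫ τ, (Real.exp τ : ℂ) ^ s * m (Real.exp τ) ∂heightMeasure =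
        mellin (fun q ↦ (q : ℂ)⁻¹ * m q) s := by
  have he : MeasurableEmbedding Real.exp :=
    Real.continuous_exp.measurableEmbedding Real.exp_injective
  have hd : Measurable fun q : ℝ ↦ (1 / q ^ 2 : ℝ).toNNReal := by fun_prop
  constructor
  · have h1 : Integrable (fun q : ℝ ↦ (q : ℂ) ^ s * m q) (heightMeasure.map Real.exp) :=
      he.integrable_map_iff.2 h
    rw [heightMeasure_map_exp, integrable_withDensity_iff_integrable_smul hd] at h1
    exact IntegrableOn.congr_fun h1 (fun q hq ↦ cpow_smul_eq hq s (m q)) measurableSet_Ioi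
  · have h1 : ∫ q, (q : ℂ) ^ s * m q ∂(heightMeasure.map Real.exp) =
        ∫ τ, (Real.exp τ : ℂ) ^ s * m (Real.exp τ) ∂heightMeasure := he.integral_map _
    rw [← h1, heightMeasure_map_exp, integral_withDensity_eq_integral_smul hd]
    exact setIntegral_congr_fun measurableSet_Ioi fun q hq ↦ cpow_smul_eq hq s (m q)

variable {A : SL(2, K)} {lam : ℙ K (Fin 2 → K)}
  (α : Module.Basis (Fin (Module.finrank ℚ K)) ℤ
    (((idealOf (A 0 0) (A 1 0)) ^ 2)⁻¹ : FractionalIdeal (𝓞 K)⁰ K))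
  {ε : Fin (Units.rank K) → (𝓞 K)ˣ} {f : Orbifold K → ℂ}

theorem integral_unfolded_section (hA : IsAssociated A lam) (hε : IsFundamentalSystem ε) (s : ℂ)
    (τ : ℝ) :
    ∫ p : (Fin (Module.finrank ℚ K) → ℝ) × (Fin (Units.rank K) → ℝ),
      unfolded A (fun j ↦ (α j : K)) ε lam s f (A • starMap A (fun j ↦ (α j : K)) ε (p, τ)) =
      (Real.exp τ : ℂ) ^ s * crossSectionMean A (fun j ↦ (α j : K)) ε f (Real.exp τ) := by
  have hm : MeasurableSet ((Set.univ.pi fun _ ↦ Set.Ico (-(1 / 2) : ℝ) (1 / 2)) ×ˢ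
      (Set.univ.pi fun _ ↦ Set.Ico (-(1 / 2) : ℝ) (1 / 2)) :
      Set ((Fin (Module.finrank ℚ K) → ℝ) × (Fin (Units.rank K) → ℝ))) :=
    (MeasurableSet.univ_pi fun _ ↦ measurableSet_Ico).prod
      (MeasurableSet.univ_pi fun _ ↦ measurableSet_Ico)
  -- Exact counting needs half-open boxes and the mean uses closed ones; they differ by a null set.
  have hae : ((Set.univ.pi fun _ ↦ Set.Ico (-(1 / 2) : ℝ) (1 / 2)) ×ˢ
      (Set.univ.pi fun _ ↦ Set.Ico (-(1 / 2) : ℝ) (1 / 2)) :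
      Set ((Fin (Module.finrank ℚ K) → ℝ) × (Fin (Units.rank K) → ℝ))) =ᵐ[volume]
      ((Set.univ.pi fun _ ↦ Set.Icc (-(1 / 2) : ℝ) (1 / 2)) ×ˢ
      (Set.univ.pi fun _ ↦ Set.Icc (-(1 / 2) : ℝ) (1 / 2)) :
      Set ((Fin (Module.finrank ℚ K) → ℝ) × (Fin (Units.rank K) → ℝ))) := by
    have h : ∀ n : ℕ, (Set.univ.pi fun _ : Fin n ↦ Set.Ico (-(1 / 2) : ℝ) (1 / 2)) =ᵐ[volume]
        Set.univ.pi fun _ : Fin n ↦ Set.Icc (-(1 / 2) : ℝ) (1 / 2) := fun n ↦ by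
      have := Measure.univ_pi_Ico_ae_eq_Icc (μ := fun _ : Fin n ↦ (volume : Measure ℝ))
        (f := fun _ ↦ -(1 / 2)) (g := fun _ ↦ 1 / 2)
      rw [← Set.pi_univ_Icc] at this
      exact this
    exact Measure.set_prod_ae_eq (h _) (h _)
  have h1 : ∀ p : (Fin (Module.finrank ℚ K) → ℝ) × (Fin (Units.rank K) → ℝ),
      unfolded A (fun j ↦ (α j : K)) ε lam s f (A • starMap A (fun j ↦ (α j : K)) ε (p, τ)) =
      ((Set.univ.pi fun _ ↦ Set.Ico (-(1 / 2) : ℝ) (1 / 2)) ×ˢ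
        (Set.univ.pi fun _ ↦ Set.Ico (-(1 / 2) : ℝ) (1 / 2))).indicator
        (fun p : (Fin (Module.finrank ℚ K) → ℝ) × (Fin (Units.rank K) → ℝ) ↦
          (Real.exp τ : ℂ) ^ s * f (toOrbifold
            (localPoint A (fun j ↦ (α j : K)) ε p.1 p.2 (Real.exp τ) (Real.exp_pos τ)))) p := by
    classical
    intro p
    rw [unfolded, indicator_cuspBox_comp α hε, coordBox_eq, Set.indicator_apply,
      Set.indicator_apply]
    simp only [Set.mem_prod, Set.mem_univ, and_true, height_smul_starMap α hA]
    rfl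
  simp only [h1]
  rw [integral_indicator hm, integral_const_mul, crossSectionMean, dif_pos (Real.exp_pos τ),
    setIntegral_congr_set hae]

/-- Fubini in `((X, Y), τ)`: the height is constant on each slice, so the inner integral is `q^s`
times the mean of `f`. Integrability of the slices gives convergence of the Mellin integral. -/
theorem integral_unfolded (hA : IsAssociated A lam) (hε : IsFundamentalSystem ε) {s : ℂ}
    (hs : 1 < s.re) (hf : Continuous f) (hfc : HasCompactSupport f) :
    MellinConvergent (fun q ↦ (q : ℂ)⁻¹ * crossSectionMean A (fun j ↦ (α j : K)) ε f q) s ∧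
    ∫ z, unfolded A (fun j ↦ (α j : K)) ε lam s f z = (jacobian K : ℂ) *
      mellin (fun q ↦ (q : ℂ)⁻¹ * crossSectionMean A (fun j ↦ (α j : K)) ε f q) s := by
  have hΨ := measurePreserving_smul_starMap (A := A) α hε
  have hemb := measurableEmbedding_smul_starMap (A := A) α hε
  have hint := (hΨ.integrable_comp_emb hemb).2 (integrable_unfolded α hA hε hs hf hfc)
  rw [integrable_smul_measure (ENNReal.ofReal_pos.2 jacobian_pos).ne' ENNReal.ofReal_ne_top] at hint
  have h1 := hint.integral_prod_right
  have h2 := integral_prod_symm _ hint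
  simp only [Function.comp_apply, integral_unfolded_section α hA hε] at h1 h2
  obtain ⟨h3, h4⟩ := mellin_of_integrable_heightMeasure h1
  refine ⟨h3, ?_⟩
  rw [← hΨ.integral_comp hemb, integral_smul_measure, h2, h4,
    ENNReal.toReal_ofReal jacobian_pos.le, Complex.real_smul]

-- The power of two is `2 · 2^(r - 1) · 2^(-r₂) · 2^(-r₂) = 2^(r₁ - r₂)`. One factor `2^(-r₂)` comes
-- from the logarithms at complex places, the other from the covolume, and the leading `2` from `2 /
-- ω`.
variable (K) in
theorem two_mul_jacobian : 2 * (jacobian K : ℂ) =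
    2 ^ ((nrRealPlaces K : ℤ) - nrComplexPlaces K) * (Units.regulator K : ℂ) *
      (√|(discr K : ℝ)| : ℂ) := by
  have h1 : Units.rank K + 1 = nrRealPlaces K + nrComplexPlaces K := by
    rw [← card_eq_nrRealPlaces_add_nrComplexPlaces, Units.rank]
    exact Nat.sub_add_cancel Fintype.card_pos
  have h2 : (2 : ℂ) ^ ((nrRealPlaces K : ℤ) - nrComplexPlaces K) =
      2 * (2 ^ Units.rank K * 2⁻¹ ^ nrComplexPlaces K * 2⁻¹ ^ nrComplexPlaces K) := by
    rw [zpow_sub₀ two_ne_zero, zpow_natCast, zpow_natCast]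
    have h3 : (2 : ℂ) * 2 ^ Units.rank K = 2 ^ nrRealPlaces K * 2 ^ nrComplexPlaces K := by
      rw [← pow_succ', h1, pow_add]
    rw [← mul_assoc, ← mul_assoc, h3, inv_pow]
    field_simp
  rw [h2, jacobian]
  push_cast
  ring

end HilbertModular

end

theorem mainTheorem4 (K : Type*) [Field K] [NumberField K]
    (lam : ℙ K (Fin 2 → K)) (A : SL(2, K)) (hA : IsAssociated A lam)
    (α : Module.Basis (Fin (Module.finrank ℚ K)) ℤ
      (((idealOf (A 0 0) (A 1 0)) ^ 2)⁻¹ : FractionalIdeal (𝓞 K)⁰ K))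
    (ε : Fin (Units.rank K) → (𝓞 K)ˣ) (hε : IsFundamentalSystem ε)
    (f : Orbifold K → ℂ) (hf : Continuous f) (hfc : HasCompactSupport f)
    (s : ℂ) (hs : 1 < s.re) :
    (∀ z : Space K, Summable (eisensteinTerm lam s z)) ∧
    Integrable (fun p ↦ eisensteinOrbifold lam s p * f p) (orbifoldVolume K) ∧
    MellinConvergent (fun q ↦ (q : ℂ)⁻¹ * crossSectionMean A (fun j ↦ (α j : K)) ε f q) s ∧
    ∫ p, eisensteinOrbifold lam s p * f p ∂(orbifoldVolume K) =
      (Units.torsionOrder K : ℂ)⁻¹ * 2 ^ ((nrRealPlaces K : ℤ) - nrComplexPlaces K) *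
        (Units.regulator K : ℂ) * (√|(discr K : ℝ)| : ℂ) *
        mellin (fun q ↦ (q : ℂ)⁻¹ * crossSectionMean A (fun j ↦ (α j : K)) ε f q) s := by
  obtain ⟨h1, h2⟩ := integral_unfolded α hA hε hs hf hfc
  refine ⟨summable_eisensteinTerm hA α hε hs, integrable_eisenstein_mul α hA hε hs hf hfc, h1, ?_⟩
  rw [integral_eisenstein_mul α hA hε hs hf hfc, h2]
  linear_combination ((Units.torsionOrder K : ℂ)⁻¹ *
    mellin (fun q ↦ (q : ℂ)⁻¹ * crossSectionMean A (fun j ↦ (α j : K)) ε f q) s) *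
      two_mul_jacobian K
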